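/- For a group $\Gamma$ let $C(\Gamma)$ denote its centre. A group is of type $F$ if it has a classifying space which is a finite complex. A group $\Gamma$ of type $F$ is an oriented rational Poincaré duality group of dimension $d$ if $H^k(\Gamma;\mathbb{Q}\Gamma)=0$ for $k\neq d$ and $H^d(\Gamma;\mathbb{Q}\Gamma)\cong\mathbb{Q}$ with trivial $\Gamma$-action. For such a group and a central extension $1\to A\to\Gamma\to Q\to 1$, let $\pi\colon \mathrm{B}Q\to \mathrm{B}^2A$ be the map classifying the extension, which is (up to equivalence) a fibration with fibre $\mathrm{B}\Gamma$, and let $$\pi_!\colon H^{*}(\mathrm{B}Q;\mathbb{Q})\to H^{*-d}(\mathrm{B}^2A;\mathbb{Q})$$ be its Gysin map, i.e. the composite $H^{s+d}(\mathrm{B}Q;\mathbb{Q})\to E_\infty^{s,d}\subseteq E_2^{s,d}=H^{s}(\mathrm{B}^2A;H^d(\mathrm{B}\Gamma;\mathbb{Q}))\cong H^s(\mathrm{B}^2A;\mathbb{Q})$ in the Serre spectral sequence of $\pi$, where the last isomorphism is induced by a choice of isomorphism $H^d(\mathrm{B}\Gamma;\mathbb{Q})\cong\mathbb{Q}$. Let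 $\mathcal{VP}$ be the class of oriented rational Poincaré duality groups $\Gamma$ (of some dimension $d$) for which the Gysin map $H^*(\mathrm{B}(\Gamma/C(\Gamma));\mathbb{Q})\to H^{*-d}(\mathrm{B}^2C(\Gamma);\mathbb{Q})$ of the extension $1\to C(\Gamma)\to\Gamma\to\Gamma/C(\Gamma)\to 1$ vanishes. Let $\mathcal{IVP}$ be the class of oriented rational Poincaré duality groups $\Gamma$ (of some dimension $d$) such that for every central element $g\in\Gamma$ of infinite order the Gysin map $H^*(\mathrm{B}(\Gamma/\langle g\rangle);\mathbb{Q})\to H^{*-d}(\mathrm{B}^2\mathbb{Z};\mathbb{Q})$ of the extension $1\to\mathbb{Z}\xrightarrow{g}\Gamma\to\Gamma/\langle g\rangle\to 1$ vanishes. **Proposition.** A group $\Gamma$ in $\mathcal{IVP}$ lies in $\mathcal{VP}$ if and only if $C(\Gamma)\otimes_{\mathbb{Z}}\mathbb{Q}\neq 0$. -/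

import Mathlib

open CategoryTheory MonoidalCategory CartesianMonoidalCategory Simplicial Opposite

noncomputable section

namespace OscarTrick

/-! ### Rational cohomology of simplicial sets -/

/-- The simplicial coboundary `(δ f)(x) = ∑ᵢ (-1)ⁱ f(dᵢ x)` on rational cochains. -/
def coboundary (X : SSet.{0}) (n : ℕ) : (X _⦋n⦌ → ℚ) →ₗ[ℚ] (X _⦋n + 1⦌ → ℚ) :=
  ∑ i : Fin (n + 2), (-1 : ℚ) ^ (i : ℕ) • LinearMap.funLeft ℚ ℚ (fun x => X.δ i x)

/-- Cocycles of degree `n`. -/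
def cocycles (X : SSet.{0}) (n : ℕ) : Submodule ℚ (X _⦋n⦌ → ℚ) :=
  LinearMap.ker (coboundary X n)

/-- Coboundaries of degree `n`. -/
def coboundaries (X : SSet.{0}) (n : ℕ) : Submodule ℚ (X _⦋n⦌ → ℚ) :=
  match n with
  | 0 => ⊥
  | n + 1 => LinearMap.range (coboundary X n)

/-- The rational cohomology `Hⁿ(X; ℚ)`. -/
abbrev Cohomology (X : SSet.{0}) (n : ℕ) : Type :=
  cocycles X n ⧸ (coboundaries X n).submoduleOf (cocycles X n)

/-- The class of a cocycle. -/
abbrev cohomologyClass (X : SSet.{0}) (n : ℕ) : cocycles X n →ₗ[ℚ] Cohomology X n :=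
  Submodule.mkQ _

/-- Pull-back of cochains. -/
def cochainPullback {X Y : SSet.{0}} (f : X ⟶ Y) (n : ℕ) : (Y _⦋n⦌ → ℚ) →ₗ[ℚ] (X _⦋n⦌ → ℚ) :=
  LinearMap.funLeft ℚ ℚ (fun x => f.app (op ⦋n⦌) x)

lemma coboundary_cochainPullback {X Y : SSet.{0}} (f : X ⟶ Y) (n : ℕ) (c : Y _⦋n⦌ → ℚ) :
    coboundary X n (cochainPullback f n c) = cochainPullback f (n + 1) (coboundary Y n c) := by
  ext x
  simp [coboundary, cochainPullback, LinearMap.funLeft_apply, SSet.δ_naturality_apply]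

lemma cochainPullback_mem_cocycles {X Y : SSet.{0}} (f : X ⟶ Y) (n : ℕ) :
    ∀ c ∈ cocycles Y n, cochainPullback f n c ∈ cocycles X n := by
  intro c hc
  have hc' : coboundary Y n c = 0 := hc
  change coboundary X n _ = 0
  rw [coboundary_cochainPullback, hc', map_zero]

lemma cochainPullback_mem_coboundaries {X Y : SSet.{0}} (f : X ⟶ Y) (n : ℕ) :
    ∀ c ∈ coboundaries Y n, cochainPullback f n c ∈ coboundaries X n := by
  intro c hc
  cases n with
  | zero =>
    have hc' : c = 0 := hc
    rw [hc', map_zero]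
    exact Submodule.zero_mem _
  | succ n =>
    obtain ⟨b, rfl⟩ := hc
    exact ⟨cochainPullback f n b, coboundary_cochainPullback f n b⟩

/-- The map `f^* : Hⁿ(Y; ℚ) → Hⁿ(X; ℚ)` induced by a simplicial map `f : X ⟶ Y`. -/
def cohomologyMap {X Y : SSet.{0}} (f : X ⟶ Y) (n : ℕ) : Cohomology Y n →ₗ[ℚ] Cohomology X n :=
  Submodule.mapQ _ _ ((cochainPullback f n).restrict (cochainPullback_mem_cocycles f n))
    (fun c hc => cochainPullback_mem_coboundaries f n c.1 hc)

/-! ### The Serre spectral sequence and the Gysin map of a simplicial map -/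

/-- The rows of Dress's bisimplicial set of a simplicial map `p : X ⟶ Y`, whose double complex of
cochains gives the Serre spectral sequence of a Kan fibration `p`: an element of bidegree `(m, n)`
is an `m`-simplex `σ` of `Y` with a map `τ : Δ[m] × Δ[n] ⟶ X` lying over `σ ∘ pr₁`.
For fixed `m` this is the disjoint union, over the `m`-simplices `σ` of `Y`, of the simplicial sets
of sections of `p` over `σ`; for `m = 0` it is the disjoint union of the fibres of `p` over the
vertices of `Y`. -/
def serreFibre {X Y : SSet.{0}} (p : X ⟶ Y) (m : SimplexCategory) : SSet.{0} where
  obj n := {κ : (SSet.stdSimplex.{0}.obj m ⊗ SSet.stdSimplex.{0}.obj n.unop ⟶ X) ×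
    (SSet.stdSimplex.{0}.obj m ⟶ Y) // κ.1 ≫ p = fst _ _ ≫ κ.2}
  map f := ↾fun κ => ⟨((SSet.stdSimplex.{0}.obj m ◁ SSet.stdSimplex.{0}.map f.unop) ≫ κ.1.1,
    κ.1.2), by simp [κ.2]⟩
  map_id n := by
    refine ConcreteCategory.hom_ext _ _ fun κ => ?_
    refine Subtype.ext (Prod.ext (?_ :
      (SSet.stdSimplex.{0}.obj m ◁ SSet.stdSimplex.{0}.map (𝟙 n.unop)) ≫ κ.1.1 = κ.1.1) rfl)
    have h := SSet.stdSimplex.{0}.map_id n.unop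
    rw [h, whiskerLeft_id, Category.id_comp]
  map_comp f g := by
    refine ConcreteCategory.hom_ext _ _ fun κ => ?_
    refine Subtype.ext (Prod.ext (?_ :
      (SSet.stdSimplex.{0}.obj m ◁ SSet.stdSimplex.{0}.map (g.unop ≫ f.unop)) ≫ κ.1.1 =
      (SSet.stdSimplex.{0}.obj m ◁ SSet.stdSimplex.{0}.map g.unop) ≫
        (SSet.stdSimplex.{0}.obj m ◁ SSet.stdSimplex.{0}.map f.unop) ≫ κ.1.1) rfl)
    have h := SSet.stdSimplex.{0}.map_comp g.unop f.unop
    rw [h, whiskerLeft_comp, Category.assoc]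

/-- The simplicial structure of Dress's bisimplicial set in the base direction. -/
def serreBase {X Y : SSet.{0}} (p : X ⟶ Y) {m m' : SimplexCategory} (f : m ⟶ m') :
    serreFibre p m' ⟶ serreFibre p m where
  app n := ↾fun κ => ⟨((SSet.stdSimplex.{0}.map f ▷ SSet.stdSimplex.{0}.obj n.unop) ≫ κ.1.1,
    SSet.stdSimplex.{0}.map f ≫ κ.1.2), by simp [κ.2]⟩
  naturality n n' g := by
    refine ConcreteCategory.hom_ext _ _ fun κ => Subtype.ext (Prod.ext ?_ rfl)
    change (SSet.stdSimplex.{0}.map f ▷ _) ≫ (_ ◁ SSet.stdSimplex.{0}.map g.unop) ≫ κ.1.1 =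
      (_ ◁ SSet.stdSimplex.{0}.map g.unop) ≫ (SSet.stdSimplex.{0}.map f ▷ _) ≫ κ.1.1
    rw [← Category.assoc, ← Category.assoc, whisker_exchange]

/-- The differential in the base direction of the double complex of cochains of Dress's
bisimplicial set. The differential in the fibre direction is `coboundary (serreFibre p ⦋m⦌) n`. -/
def coboundaryBase {X Y : SSet.{0}} (p : X ⟶ Y) (m n : ℕ) :
    (serreFibre p ⦋m⦌ _⦋n⦌ → ℚ) →ₗ[ℚ] (serreFibre p ⦋m + 1⦌ _⦋n⦌ → ℚ) :=
  ∑ i : Fin (m + 2), (-1 : ℚ) ^ (i : ℕ) •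
    LinearMap.funLeft ℚ ℚ (fun κ => (serreBase p (SimplexCategory.δ i)).app (op ⦋n⦌) κ)

/-- The cochain `y × μ` of bidegree `(s, d)`, for a cochain `y` on the base and a cochain `μ` on the
fibres over vertices: `μ` is evaluated on the restriction to the initial vertex. -/
def crossCochain {X Y : SSet.{0}} (p : X ⟶ Y) {s d : ℕ} (y : Y _⦋s⦌ → ℚ)
    (μ : serreFibre p ⦋0⦌ _⦋d⦌ → ℚ) : serreFibre p ⦋s⦌ _⦋d⦌ → ℚ :=
  fun κ => y (SSet.yonedaEquiv κ.1.2) *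
    μ ((serreBase p (SimplexCategory.const ⦋0⦌ ⦋s⦌ 0)).app (op ⦋d⦌) κ)

/-- An `m`-simplex of the total space, as an element of bidegree `(m, 0)`. The restriction of
cochains along this map is the identification of the cohomology of the total complex
with the cohomology of `X`. -/
def serreTotal {X Y : SSet.{0}} (p : X ⟶ Y) (m : ℕ) (x : X _⦋m⦌) : serreFibre p ⦋m⦌ _⦋0⦌ :=
  ⟨(fst _ _ ≫ SSet.yonedaEquiv.symm x, SSet.yonedaEquiv.symm x ≫ p), by simp⟩

/-- The graph of the Gysin map `p_! : H^{s+d}(X; ℚ) → H^s(Y; ℚ)` of a fibration `p` over a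
simply connected reduced base (one vertex) whose fibre has rational cohomology
vanishing above degree `d` and of dimension one in degree `d`, spanned by `μ`.
In the Serre spectral sequence, `p_!` is the composite
`H^{s+d}(X) = F^s H^{s+d}(X) → E_∞^{s,d} ⊆ E_2^{s,d} = H^s(Y; H^d(fibre)) ≅ H^s(Y; ℚ)`.
Thus `p_!(x) = y` means that `x` is represented in the total complex by a cocycle
`∑_{i + n = d} z i n`, with `z i n` of bidegree `(s + i, n)`
(so of base filtration at least `s`), whose leading term `z 0 d` is `y × μ`. -/
def IsGysin {X Y : SSet.{0}} (p : X ⟶ Y) {d : ℕ} (μ : Cohomology (serreFibre p ⦋0⦌) d) {s : ℕ}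
    (x : Cohomology X (s + d)) (y : Cohomology Y s) : Prop :=
  ∃ (μ' : cocycles (serreFibre p ⦋0⦌) d) (y' : cocycles Y s) (x' : cocycles X (s + d))
    (z : ∀ i n : ℕ, serreFibre p ⦋s + i⦌ _⦋n⦌ → ℚ),
    cohomologyClass _ _ μ' = μ ∧ cohomologyClass _ _ y' = y ∧ cohomologyClass _ _ x' = x ∧
    -- the sum of the `z i n` with `i + n = d` is a cocycle of the total complex
    coboundary (serreFibre p ⦋s⦌) d (z 0 d) = 0 ∧
    (∀ i n : ℕ, i + n + 1 = d →
      coboundaryBase p (s + i) (n + 1) (z i (n + 1)) +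
        (-1 : ℚ) ^ (s + i + 1) • coboundary (serreFibre p ⦋s + i + 1⦌) n (z (i + 1) n) = 0) ∧
    coboundaryBase p (s + d) 0 (z d 0) = 0 ∧
    -- its leading term
    z 0 d = crossCochain p y'.1 μ'.1 ∧
    -- it represents `x`
    (fun e => z d 0 (serreTotal p (s + d) e)) = x'.1

/-! ### Classifying spaces and the classifying map of a central extension -/

/-- The classifying space `BG = K(G, 1)`: an `n`-simplex is a `G`-valued `1`-cocycle on `Δ[n]`
(equivalently, a functor from `0 < ⋯ < n` to `G`). The edges of a triangle
`τ : ⦋2⦌ ⟶ ⦋n⦌` are `δ 2 ≫ τ = τ|₀₁`, `δ 0 ≫ τ = τ|₁₂` and `δ 1 ≫ τ = τ|₀₂`. -/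
def classifyingSpace (G : Type) [Group G] : SSet.{0} where
  obj n := {γ : (⦋1⦌ ⟶ n.unop) → G // ∀ τ : ⦋2⦌ ⟶ n.unop,
    γ (SimplexCategory.δ 2 ≫ τ) * γ (SimplexCategory.δ 0 ≫ τ) = γ (SimplexCategory.δ 1 ≫ τ)}
  map f := ↾fun γ => ⟨fun e => γ.1 (e ≫ f.unop), fun τ => by
    simpa only [Category.assoc] using γ.2 (τ ≫ f.unop)⟩
  map_id n := by
    refine ConcreteCategory.hom_ext _ _ fun γ => Subtype.ext (funext fun e => ?_)
    change γ.1 (e ≫ 𝟙 _) = γ.1 e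
    rw [Category.comp_id]
  map_comp f g := by
    refine ConcreteCategory.hom_ext _ _ fun γ => Subtype.ext (funext fun e => ?_)
    change γ.1 (e ≫ g.unop ≫ f.unop) = γ.1 ((e ≫ g.unop) ≫ f.unop)
    rw [Category.assoc]

/-- The Eilenberg-MacLane space `B²A = K(A, 2)`, for an abelian group `A` written multiplicatively:
an `n`-simplex is a normalised `A`-valued `2`-cocycle on `Δ[n]`. -/
def doubleClassifyingSpace (A : Type) [CommGroup A] : SSet.{0} where
  obj n := {a : (⦋2⦌ ⟶ n.unop) → A //
    (∀ (i : Fin 2) (e : ⦋1⦌ ⟶ n.unop), a (SimplexCategory.σ i ≫ e) = 1) ∧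
    ∀ θ : ⦋3⦌ ⟶ n.unop,
      a (SimplexCategory.δ 0 ≫ θ) * a (SimplexCategory.δ 2 ≫ θ) =
        a (SimplexCategory.δ 1 ≫ θ) * a (SimplexCategory.δ 3 ≫ θ)}
  map f := ↾fun a => ⟨fun τ => a.1 (τ ≫ f.unop),
    fun i e => by simpa only [Category.assoc] using a.2.1 i (e ≫ f.unop),
    fun θ => by simpa only [Category.assoc] using a.2.2 (θ ≫ f.unop)⟩
  map_id n := by
    refine ConcreteCategory.hom_ext _ _ fun a => Subtype.ext (funext fun τ => ?_)
    change a.1 (τ ≫ 𝟙 _) = a.1 τ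
    rw [Category.comp_id]
  map_comp f g := by
    refine ConcreteCategory.hom_ext _ _ fun a => Subtype.ext (funext fun τ => ?_)
    change a.1 (τ ≫ g.unop ≫ f.unop) = a.1 ((τ ≫ g.unop) ≫ f.unop)
    rw [Category.assoc]

variable {A Γ Q : Type} [CommGroup A] [Group Γ] [Group Q]

/-- The total space of the fibration `BΓ → BQ → B²A` of a central extension `1 → A → Γ → Q → 1`.
An `n`-simplex is an `n`-simplex of `BQ` with a normalised lift of its edges to a
`Γ`-valued `1`-cochain `γ` on `Δ[n]`, together with the `2`-cocycle `a` with values in `A` by which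
`γ` fails to be a cocycle: `γ₀₁ γ₁₂ = a₀₁₂ γ₀₂`. The choice of the lift being contractible,
this space is equivalent to `BQ`. -/
def extensionTotalSpace (S : GroupExtension A Γ Q) : SSet.{0} where
  obj n := {γa : ((⦋1⦌ ⟶ n.unop) → Γ) × (doubleClassifyingSpace A).obj n //
    (∀ v : ⦋0⦌ ⟶ n.unop, γa.1 (SimplexCategory.σ 0 ≫ v) = 1) ∧
    ∀ τ : ⦋2⦌ ⟶ n.unop, γa.1 (SimplexCategory.δ 2 ≫ τ) * γa.1 (SimplexCategory.δ 0 ≫ τ) =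
      S.inl (γa.2.1 τ) * γa.1 (SimplexCategory.δ 1 ≫ τ)}
  map f := ↾fun γa => ⟨(fun e => γa.1.1 (e ≫ f.unop), (doubleClassifyingSpace A).map f γa.1.2),
    fun v => by simpa only [Category.assoc] using γa.2.1 (v ≫ f.unop),
    fun τ => by
      have h := γa.2.2 (τ ≫ f.unop)
      simp only [← Category.assoc] at h
      exact h⟩
  map_id n := by
    refine ConcreteCategory.hom_ext _ _ fun γa => Subtype.ext (Prod.ext (funext fun e => ?_) ?_)
    · change γa.1.1 (e ≫ 𝟙 _) = γa.1.1 e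
      rw [Category.comp_id]
    · change (doubleClassifyingSpace A).map (𝟙 n) γa.1.2 = γa.1.2
      simp
  map_comp f g := by
    refine ConcreteCategory.hom_ext _ _ fun γa => Subtype.ext (Prod.ext (funext fun e => ?_) ?_)
    · change γa.1.1 (e ≫ g.unop ≫ f.unop) = γa.1.1 ((e ≫ g.unop) ≫ f.unop)
      rw [Category.assoc]
    · change (doubleClassifyingSpace A).map (f ≫ g) γa.1.2 =
        (doubleClassifyingSpace A).map g ((doubleClassifyingSpace A).map f γa.1.2)
      simp

/-- The equivalence from the total space to `BQ`, which projects the lifts back to `Q`. -/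
def extensionToQuotient (S : GroupExtension A Γ Q) :
    extensionTotalSpace S ⟶ classifyingSpace Q where
  app n := ↾fun γa => ⟨fun e => S.rightHom (γa.1.1 e), fun τ => by
    rw [← map_mul, γa.2.2 τ, map_mul, S.rightHom_inl, one_mul]⟩

/-- The fibration `BQ → B²A` classifying the central extension `S`: it takes the cocycle of the
extension associated with the chosen lifts. Its fibre is `BΓ`. -/
def extensionClassifyingMap (S : GroupExtension A Γ Q) :
    extensionTotalSpace S ⟶ doubleClassifyingSpace A where
  app n := ↾fun γa => γa.1.2

/-- The Gysin map `H^{*}(BQ; ℚ) → H^{*-d}(B²A; ℚ)` of the map classifying the central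
extension `S` is (defined and) zero, whatever generator of the degree `d` cohomology of the fibre is
used as orientation. In degrees `* < d` there is nothing to say. -/
def GysinVanishes (S : GroupExtension A Γ Q) (d : ℕ) : Prop :=
  ∀ μ : Cohomology (serreFibre (extensionClassifyingMap S) ⦋0⦌) d,
    μ ≠ 0 → Submodule.span ℚ {μ} = ⊤ →
    ∀ (s : ℕ) (x : Cohomology (classifyingSpace Q) (s + d))
      (y : Cohomology (doubleClassifyingSpace A) s),
      IsGysin (extensionClassifyingMap S) μ
        (cohomologyMap (extensionToQuotient S) (s + d) x) y ↔ y = 0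

/-- The centre, as an abelian group. -/
instance centerCommGroup (Γ : Type) [Group Γ] : CommGroup (Subgroup.center Γ) :=
  { (Subgroup.center Γ).toGroup with
    mul_comm := fun a b => Subtype.ext (Subgroup.mem_center_iff.1 b.2 a.1) }

/-- The central extension `1 → C(Γ) → Γ → Γ/C(Γ) → 1`. -/
def centerExtension (Γ : Type) [Group Γ] :
    GroupExtension (Subgroup.center Γ) Γ (Γ ⧸ Subgroup.center Γ) where
  inl := (Subgroup.center Γ).subtype
  rightHom := QuotientGroup.mk' (Subgroup.center Γ)
  inl_injective := Subtype.val_injective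
  range_inl_eq_ker_rightHom := by simp
  rightHom_surjective := QuotientGroup.mk'_surjective _

lemma zpowers_normal {g : Γ} (hg : g ∈ Subgroup.center Γ) : (Subgroup.zpowers g).Normal where
  conj_mem n hn x := by
    have hn' : n ∈ Subgroup.center Γ := (Subgroup.zpowers_le.2 hg) hn
    rw [Subgroup.mem_center_iff.1 hn' x, mul_inv_cancel_right]
    exact hn

/-- The central extension `1 → ℤ → Γ → Γ/⟨g⟩ → 1` given by a central element `g` of
infinite order. -/
def cyclicExtension (g : Γ) (hg : g ∈ Subgroup.center Γ) (hord : ¬ IsOfFinOrder g) :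
    haveI := zpowers_normal hg
    GroupExtension (Multiplicative ℤ) Γ (Γ ⧸ Subgroup.zpowers g) :=
  haveI := zpowers_normal hg
  { inl := zpowersHom Γ g
    rightHom := QuotientGroup.mk' (Subgroup.zpowers g)
    inl_injective := fun a b h => (injective_zpow_iff_not_isOfFinOrder.2 hord) h
    range_inl_eq_ker_rightHom := by
      rw [QuotientGroup.ker_mk']
      rfl
    rightHom_surjective := QuotientGroup.mk'_surjective _ }

/-! ### Poincaré duality groups and the classes `VP` and `IVP` -/

/-- A simplicial set is (weakly) contractible if it is non-empty and each of its maps to a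
Kan complex is homotopic to a constant map. -/
def IsContractible (Y : SSet.{0}) : Prop :=
  Nonempty (Y _⦋0⦌) ∧ ∀ (Z : SSet.{0}) [SSet.KanComplex Z] (f : Y ⟶ Z),
    ∃ z : Z _⦋0⦌, Nonempty (SSet.Homotopy f (SSet.const z))

/-- A group `Γ` is of type `F` if it has a classifying space which is a finite complex, i.e. if it
acts freely on a contractible complex `Y` such that `Y/Γ` is finite. -/
def IsTypeF (Γ : Type) [Group Γ] : Prop :=
  ∃ (Y : SSet.{0}) (ρ : Γ →* Aut Y), IsContractible Y ∧
    (∀ (g : Γ) (n : ℕ) (y : Y _⦋n⦌), (ρ g).hom.app (op ⦋n⦌) y = y → g = 1) ∧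
    ∃ F : Set (Σ n : ℕ, Y _⦋n⦌), F.Finite ∧
      ∀ (n : ℕ) (y : Y _⦋n⦌), y ∈ Y.nonDegenerate n →
        ∃ g : Γ, (⟨n, (ρ g).hom.app (op ⦋n⦌) y⟩ : Σ n : ℕ, Y _⦋n⦌) ∈ F

/-- `Γ` is an oriented rational Poincaré duality group of formal dimension `d`: it is of type `F`,
and `H^k(Γ; ℚΓ)` is concentrated in degree `d`, where it is isomorphic to `ℚ` with trivial action
of `Γ` (the action induced by right multiplication on the coefficients `ℚΓ`). -/
structure IsOrientedPoincareDualityGroup (Γ : Type) [Group Γ] (d : ℕ) : Prop where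
  typeF : IsTypeF Γ
  concentrated : ∀ k : ℕ, k ≠ d → Subsingleton (groupCohomology (Rep.leftRegular ℚ Γ) k)
  equiv_rat : Nonempty (groupCohomology (Rep.leftRegular ℚ Γ) d ≃ₗ[ℚ] ℚ)
  trivial_action : ∀ g : Γ,
    (groupCohomology.functor ℚ Γ d).map
      (Rep.leftRegularHom (Rep.leftRegular ℚ Γ) (MonoidAlgebra.single g 1)) = 𝟙 _

/-- The class `VP` (vanishing property). -/
def VP (Γ : Type) [Group Γ] : Prop :=
  ∃ d : ℕ, IsOrientedPoincareDualityGroup Γ d ∧ GysinVanishes (centerExtension Γ) d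

/-- The class `IVP` (individual vanishing property). -/
def IVP (Γ : Type) [Group Γ] : Prop :=
  ∃ d : ℕ, IsOrientedPoincareDualityGroup Γ d ∧
    ∀ (g : Γ) (hg : g ∈ Subgroup.center Γ) (hord : ¬ IsOfFinOrder g),
      haveI := zpowers_normal hg
      GysinVanishes (cyclicExtension g hg hord) d

end OscarTrick

end

/-! A group of type `F` acts freely on a finite-dimensional contractible complex, so it is
torsion-free, and `C(Γ) ⊗ ℚ = 0` exactly when `C(Γ)` is trivial. In that case `B²C(Γ)` is a point
and the Gysin map in degree `d` is the orientation `H^d(BΓ) ≅ ℚ`, which is not zero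
(`not_gysinVanishes_of_subsingleton`).

If `C = C(Γ)` is not trivial, each `a ∈ C` of infinite order gives a map from the cyclic extension
to the central one, covering `B²ℤ → B²C` and inducing an isomorphism on the fibre `BΓ`. The Gysin
relation is natural (`IsGysin.cohomologyMap`), so the hypothesis says that every Gysin image
restricts to zero along each such `a` (`GysinVanishes.pullback_eq_zero`). What remains is that
rational classes of `B²C` are detected on infinite cyclic subgroups
(`eq_zero_of_forall_not_isOfFinOrder`).

For `C` free of finite rank the cohomology of `B²C` consists of polynomial functions on `C ⊗ ℚ`, and
a polynomial is determined by its values at lattice points. The ring is not computed. Instead, let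
`χ : C → ℤ` be a character with section `σ`; then `twistedSpace χ` is the circle bundle over `B²C`
with Euler class `e`. On it a class `y` agrees with its pull-back under the projection `killing` to
the kernel of `χ`, so the Gysin sequence gives `y = killing^* y + e y'`. Induction on rank and
degree, with injectivity of the Euler class on `K(ℤ, 2)`, finishes this case
(`IsDetected.of_retract`). Other torsion-free groups reduce to it because rational cohomology is
dual to homology and cycles have finite support.

The Gysin map is a relation between cochains and has to be shown total (`exists_isGysin`).
`extensionTotalSpace S` is the twisted product `twistedSpace S.inl`, which is trivial over each
simplex of the base, since a 2-cocycle on a simplex is a coboundary by coning. Hence the columns of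
Dress's double complex are copies of the cochains of `BΓ`, while its rows are equivalent to the
cochains of the total space (`serreRowContraction`). This uses that `H^n(BΓ; ℚ)` vanishes for `n >
d` and is one-dimensional for `n = d`, which follows from the hypothesis on `H^*(Γ; ℚΓ)` by
dimension shifting along the resolution by chains of a finite model. -/

open CategoryTheory MonoidalCategory CartesianMonoidalCategory Simplicial Opposite

noncomputable section

namespace OscarTrick

/-! ### Simplicial homotopies induce cochain homotopies -/

section

/-- The functor sending a set to the space of rational functions on it. -/
def rationalFunctions : Type ⥤ (ModuleCat.{0} ℚ)ᵒᵖ where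
  obj T := op (ModuleCat.of ℚ (T → ℚ))
  map f := (ModuleCat.ofHom (LinearMap.funLeft ℚ ℚ f)).op
  map_id _ := rfl
  map_comp _ _ := rfl

/-- The cochain complex of a simplicial set, in the opposite category. -/
abbrev cochainComplexOp (X : SSet.{0}) : ChainComplex (ModuleCat.{0} ℚ)ᵒᵖ ℕ :=
  (AlgebraicTopology.alternatingFaceMapComplex _).obj
    (((SimplicialObject.whiskering _ _).obj rationalFunctions).obj X)

lemma cochainComplexOp_d (X : SSet.{0}) (n : ℕ) :
    ((cochainComplexOp X).d (n + 1) n).unop = ModuleCat.ofHom (coboundary X n) := by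
  rw [AlgebraicTopology.alternatingFaceMapComplex_obj_d,
    AlgebraicTopology.AlternatingFaceMapComplex.objD, unop_sum]
  refine ModuleCat.hom_ext ?_
  rw [ModuleCat.hom_sum]
  change _ = ∑ i : Fin (n + 2), _
  refine Finset.sum_congr rfl fun i _ => ?_
  rw [unop_zsmul, ModuleCat.hom_zsmul, ← Int.cast_smul_eq_zsmul ℚ]
  push_cast
  rfl

lemma coboundary_coboundary (X : SSet.{0}) (n : ℕ) (c : X _⦋n⦌ → ℚ) :
    coboundary X (n + 1) (coboundary X n c) = 0 := by
  have h := congrArg Quiver.Hom.unop ((cochainComplexOp X).d_comp_d (n + 2) (n + 1) n)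
  rw [unop_comp, cochainComplexOp_d, cochainComplexOp_d] at h
  exact ConcreteCategory.congr_hom h c

/-- A simplicial homotopy becomes a chain homotopy in the opposite category of vector spaces, and
`unop` turns this into a cochain homotopy. Degree 0 is separate: coboundaries are zero there by
convention and one of the two homotopy terms is missing. -/
lemma sub_mem_coboundaries_of_homotopy {X Z : SSet.{0}} {f g : X ⟶ Z} (H : SSet.Homotopy f g)
    {n : ℕ} {c : Z _⦋n⦌ → ℚ} (hc : c ∈ cocycles Z n) :
    cochainPullback f n c - cochainPullback g n c ∈ coboundaries X n := by
  have h := (H.toSimplicialObjectHomotopy.whiskerRight rationalFunctions).toChainHomotopy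
  let B (i j : ℕ) : (Z _⦋j⦌ → ℚ) →ₗ[ℚ] (X _⦋i⦌ → ℚ) := (h.hom i j).unop.hom
  have hc : coboundary Z n c = 0 := hc
  cases n with
  | zero =>
    have := h.comm 0
    rw [prevD_eq (j' := 1) (w := by simp), dNext_eq_zero _ _ (by simp), zero_add] at this
    have := congrArg Quiver.Hom.unop this
    rw [unop_add, unop_comp, cochainComplexOp_d] at this
    have : cochainPullback f 0 c = B 0 1 (coboundary Z 0 c) +
        cochainPullback g 0 c := ConcreteCategory.congr_hom this c
    rw [hc, map_zero, zero_add] at this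
    rw [this, sub_self]
    exact Submodule.zero_mem _
  | succ n =>
    have := h.comm (n + 1)
    rw [dNext_eq (i' := n) (w := by simp), prevD_eq (j' := n + 2) (w := by simp)] at this
    have := congrArg Quiver.Hom.unop this
    rw [unop_add, unop_add, unop_comp, unop_comp, cochainComplexOp_d, cochainComplexOp_d] at this
    have : cochainPullback f (n + 1) c = coboundary X n (B n (n + 1) c) +
        B (n + 1) (n + 2) (coboundary Z (n + 1) c) +
        cochainPullback g (n + 1) c := ConcreteCategory.congr_hom this c
    rw [hc, map_zero, add_zero] at this
    exact ⟨_, (sub_eq_of_eq_add this).symm⟩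

/-- A family of maps `X_n × Hom([n], [1]) → Z_n`, natural in `n`, as a homotopy. -/
def homotopyOfFamily {X Z : SSet.{0}} (f g : X ⟶ Z)
    (H : ∀ n : SimplexCategoryᵒᵖ, X.obj n → (n.unop ⟶ ⦋1⦌) → Z.obj n)
    (nat : ∀ {n n' : SimplexCategoryᵒᵖ} (φ : n ⟶ n') (x : X.obj n) (t : n.unop ⟶ ⦋1⦌),
      Z.map φ (H n x t) = H n' (X.map φ x) (φ.unop ≫ t))
    (h₀ : ∀ (n : SimplexCategoryᵒᵖ) (x : X.obj n),
      H n x (SimplexCategory.const _ ⦋1⦌ 0) = f.app n x)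
    (h₁ : ∀ (n : SimplexCategoryᵒᵖ) (x : X.obj n),
      H n x (SimplexCategory.const _ ⦋1⦌ 1) = g.app n x) :
    SSet.Homotopy f g where
  h :=
    { app n := ↾fun x => H n x.1 (SSet.stdSimplex.objEquiv x.2)
      naturality n n' φ := by
        refine ConcreteCategory.hom_ext _ _ fun x => ?_
        exact (nat φ x.1 (SSet.stdSimplex.objEquiv x.2)).symm }
  h₀ := by
    ext n x
    exact h₀ n x
  h₁ := by
    ext n x
    exact h₁ n x
  rel := by
    ext n x
    exact x.1.2.elim

end

section

/-! ### Double complexes -/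

/-- A first quadrant double complex of rational vector spaces, with anticommuting differentials. -/
structure DoubleComplex where
  C : ℕ → ℕ → Type
  [addCommGroup : ∀ i n, AddCommGroup (C i n)]
  [module : ∀ i n, Module ℚ (C i n)]
  dh : ∀ i n, C i n →ₗ[ℚ] C (i + 1) n
  dv : ∀ i n, C i n →ₗ[ℚ] C i (n + 1)
  dh_dh : ∀ i n c, dh (i + 1) n (dh i n c) = 0
  dv_dv : ∀ i n c, dv i (n + 1) (dv i n c) = 0
  dh_dv : ∀ i n c, dh i (n + 1) (dv i n c) = -dv (i + 1) n (dh i n c)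

namespace DoubleComplex

attribute [instance] addCommGroup module

variable (D : DoubleComplex)

/-- The total differential, on the product of all the terms of a double complex. -/
def tot (z : ∀ i n, D.C i n) (i n : ℕ) : D.C i n :=
  match i, n with
  | 0, 0 => 0
  | 0, n + 1 => D.dv 0 n (z 0 n)
  | i + 1, 0 => D.dh i 0 (z i 0)
  | i + 1, n + 1 => D.dh i (n + 1) (z i (n + 1)) + D.dv (i + 1) n (z (i + 1) n)

/-- The elements of total degree `N`. -/
def IsHomogeneous (N : ℕ) (z : ∀ i n, D.C i n) : Prop := ∀ i n, i + n ≠ N → z i n = 0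

/-- The coboundaries for the horizontal differential. -/
def hBoundaries (i n : ℕ) : Submodule ℚ (D.C i n) :=
  match i, n with
  | 0, _ => ⊥
  | i + 1, n => LinearMap.range (D.dh i n)

variable {D}

lemma tot_add (z w : ∀ i n, D.C i n) : D.tot (z + w) = D.tot z + D.tot w := by
  ext i n
  rcases i with _ | i <;> rcases n with _ | n <;> simp [tot]
  abel

lemma tot_neg (z : ∀ i n, D.C i n) : D.tot (-z) = -D.tot z := by
  ext i n
  rcases i with _ | i <;> rcases n with _ | n <;> simp [tot]
  abel

lemma tot_sub (z w : ∀ i n, D.C i n) : D.tot (z - w) = D.tot z - D.tot w := by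
  rw [sub_eq_add_neg, tot_add, tot_neg, sub_eq_add_neg]

lemma tot_tot (z : ∀ i n, D.C i n) : D.tot (D.tot z) = 0 := by
  ext i n
  rcases i with _ | _ | i <;> rcases n with _ | _ | n <;>
    simp [tot, D.dh_dh, D.dv_dv, D.dh_dv]

lemma IsHomogeneous.tot {N : ℕ} {z : ∀ i n, D.C i n} (hz : D.IsHomogeneous N z) :
    D.IsHomogeneous (N + 1) (D.tot z) := by
  intro i n h
  rcases i with _ | i <;> rcases n with _ | n <;> simp only [DoubleComplex.tot]
  · rw [hz _ _ (by omega), map_zero]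
  · rw [hz _ _ (by omega), map_zero]
  · rw [hz _ _ (by omega), hz _ _ (by omega), map_zero, map_zero, add_zero]

lemma IsHomogeneous.sub {N : ℕ} {z w : ∀ i n, D.C i n} (hz : D.IsHomogeneous N z)
    (hw : D.IsHomogeneous N w) : D.IsHomogeneous N (z - w) := by
  intro i n h
  simp [hz i n h, hw i n h]

lemma IsHomogeneous.add {N : ℕ} {z w : ∀ i n, D.C i n} (hz : D.IsHomogeneous N z)
    (hw : D.IsHomogeneous N w) : D.IsHomogeneous N (z + w) := by
  intro i n h
  simp [hz i n h, hw i n h]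

/-- The element concentrated in bidegree `(i, n)`. -/
def single (i n : ℕ) (c : D.C i n) : ∀ i n, D.C i n := Pi.single i (Pi.single n c)

@[simp]
lemma single_self (i n : ℕ) (c : D.C i n) : single i n c i n = c := by
  simp [single]

lemma single_of_ne {i n : ℕ} (c : D.C i n) {i' n' : ℕ} (h : i' ≠ i ∨ n' ≠ n) :
    single i n c i' n' = 0 := by
  by_cases hi : i' = i
  · subst hi
    simp [single, Pi.single_eq_of_ne (h.resolve_left (by simp))]
  · simp [single, Pi.single_eq_of_ne hi]

lemma isHomogeneous_single {N i n : ℕ} (h : i + n = N) (c : D.C i n) :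
    D.IsHomogeneous N (single i n c) := by
  intro i' n' h'
  exact single_of_ne _ (by omega)

lemma tot_single_of_lt {i n : ℕ} (c : D.C i n) {i' n' : ℕ} (h : i' < i) :
    D.tot (single i n c) i' n' = 0 := by
  rcases i' with _ | i' <;> rcases n' with _ | n' <;> simp only [tot]
  · rw [single_of_ne _ (by omega), map_zero]
  · rw [single_of_ne _ (by omega), map_zero]
  · rw [single_of_ne _ (by omega), single_of_ne _ (by omega), map_zero, map_zero, add_zero]

lemma tot_single_up (i n : ℕ) (c : D.C i n) : D.tot (single i n c) i (n + 1) = D.dv i n c := by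
  rcases i with _ | i <;> simp only [tot]
  · rw [single_self]
  · rw [single_of_ne _ (by omega), single_self, map_zero, zero_add]

lemma tot_single_right (i n : ℕ) (c : D.C i n) : D.tot (single i n c) (i + 1) n = D.dh i n c := by
  rcases n with _ | n <;> simp only [tot]
  · rw [single_self]
  · rw [single_of_ne _ (by omega : i + 1 ≠ i ∨ n ≠ n + 1), single_self, map_zero, add_zero]

/-- If the columns are acyclic above degree `d`, the terms of column less than `s` can be removed
from an element of total degree `s + d` by subtracting a total coboundary. -/
lemma exists_sub_tot {d s : ℕ} (hD : ∀ i n, d ≤ n → ∀ c : D.C i (n + 1), D.dv i (n + 1) c = 0 →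
      ∃ b, D.dv i n b = c) {z : ∀ i n, D.C i n} (hz : D.IsHomogeneous (s + d) z)
    (hz' : ∀ i < s, ∀ n, D.tot z i n = 0) :
    ∃ t, (∀ i n, i + n + 1 ≠ s + d → t i n = 0) ∧ ∀ i < s, ∀ n, (z - D.tot t) i n = 0 := by
  suffices h : ∀ k ≤ s, ∃ t, (∀ i n, i + n + 1 ≠ s + d → t i n = 0) ∧
      ∀ i < k, ∀ n, (z - D.tot t) i n = 0 from h s le_rfl
  intro k hk
  induction k with
  | zero => exact ⟨0, by simp, by simp⟩
  | succ k ih =>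
    obtain ⟨t, ht, htz⟩ := ih (by omega)
    -- The only entry of column `k` in total degree `s + d` lies in row `n + 1`. Since `k < s`, one
    -- has `d ≤ n`, so the column is exact there.
    obtain ⟨n, hn⟩ : ∃ n, k + n + 1 = s + d := ⟨s + d - k - 1, by omega⟩
    have ht' : D.IsHomogeneous (s + d) (D.tot t) := by
      have : D.IsHomogeneous (k + n) t := fun i j hij => ht i j (by omega)
      rw [← hn]
      exact this.tot
    have h0 : D.tot (z - D.tot t) k (n + 2) = 0 := by
      rw [tot_sub, tot_tot, sub_zero]
      exact hz' k (by omega) _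
    have h1 : D.dv k (n + 1) ((z - D.tot t) k (n + 1)) = 0 := by
      rcases k with _ | k
      · exact h0
      · simpa only [tot, htz k (by omega), map_zero, zero_add] using h0
    obtain ⟨b, hb⟩ := hD k n (by omega) _ h1
    refine ⟨t + single k n b, fun i j hij => ?_, fun i hi j => ?_⟩
    · rw [Pi.add_apply, Pi.add_apply, ht i j hij, single_of_ne _ (by omega), add_zero]
    · have e : (z - D.tot (t + single k n b)) i j =
          (z - D.tot t) i j - D.tot (single k n b) i j := by
        rw [tot_add]
        simp only [Pi.sub_apply, Pi.add_apply]
        abel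
      rw [e]
      rcases Nat.lt_succ_iff_lt_or_eq.1 hi with hi | rfl
      · rw [htz i hi, tot_single_of_lt _ hi, sub_zero]
      · by_cases hj : j = n + 1
        · subst hj
          rw [tot_single_up, hb, sub_self]
        · rw [(hz.sub ht') i j (by omega),
            (isHomogeneous_single rfl b).tot i j (by omega), sub_zero]

variable (D) in
/-- Data which show that all the rows of a double complex are equivalent to the bottom row. -/
structure RowContraction where
  V : ∀ m n, D.C m 0 →ₗ[ℚ] D.C m n
  S : ∀ m n, D.C m n →ₗ[ℚ] D.C m 0
  sgn : ℕ → ℚ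
  sgn_ne_zero : ∀ m, sgn m ≠ 0
  dh_V : ∀ m n c, D.dh m n (V m n c) = V (m + 1) n (D.dh m 0 c)
  dh_S : ∀ m n c, D.dh m 0 (S m n c) = S (m + 1) n (D.dh m n c)
  S_V : ∀ m n c, S m n (V m n c) = c
  V_S : ∀ m n c, D.dh m n c = 0 → c - V m n (S m n c) ∈ D.hBoundaries m n
  S_dv_even : ∀ m n c, Even n → S m (n + 1) (D.dv m n c) = 0
  S_dv_odd : ∀ m n c, Odd n → S m (n + 1) (D.dv m n c) = sgn m • S m n c

namespace RowContraction

variable (R : RowContraction D)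

include R

lemma dv_mem {m : ℕ} {x : D.C m 0} (hx : D.dh m 0 x = 0) : D.dv m 0 x ∈ D.hBoundaries m 1 := by
  have h := R.V_S m 1 (D.dv m 0 x) (by rw [D.dh_dv, hx, map_zero, neg_zero])
  rwa [R.S_dv_even m 0 x (by simp), map_zero, sub_zero] at h

lemma S_mem {m n : ℕ} {c : D.C m n} (hc : c ∈ D.hBoundaries m n) :
    R.S m n c ∈ D.hBoundaries m 0 := by
  rcases m with _ | m
  · obtain rfl : c = 0 := hc
    simp
  · obtain ⟨b, rfl⟩ := hc
    exact ⟨R.S m n b, R.dh_S _ _ _⟩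

lemma V_mem {m n : ℕ} {c : D.C m 0} (hc : c ∈ D.hBoundaries m 0) :
    R.V m n c ∈ D.hBoundaries m n := by
  rcases m with _ | m
  · obtain rfl : c = 0 := hc
    simp
  · obtain ⟨b, rfl⟩ := hc
    exact ⟨R.V m n b, R.dh_V _ _ _⟩

/-- On horizontal cohomology each row is a copy of the bottom one, and the vertical differential is
zero out of even rows and a nonzero scalar out of odd rows, as for a constant simplicial object. So
nothing survives above row 0. For `n` even the differential leaving row `n + 1` is injective and `e
= 0` serves; for `n` odd the one entering it is surjective. -/
lemma exists_sub_dv_mem {m n : ℕ} {c : D.C m (n + 1)} (hc : D.dh m (n + 1) c = 0)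
    (hc' : D.dv m (n + 1) c ∈ D.hBoundaries m (n + 2)) :
    ∃ e, D.dh m n e = 0 ∧ c - D.dv m n e ∈ D.hBoundaries m (n + 1) := by
  rcases Nat.even_or_odd n with hn | hn
  · refine ⟨0, map_zero _, ?_⟩
    have h := R.S_mem hc'
    rw [R.S_dv_odd _ _ _ hn.add_one] at h
    have h' := R.V_mem (n := n + 1) ((Submodule.smul_mem_iff _ (R.sgn_ne_zero m)).1 h)
    rw [map_zero, sub_zero, ← sub_add_cancel c (R.V m (n + 1) (R.S m (n + 1) c))]
    exact Submodule.add_mem _ (R.V_S _ _ _ hc) h'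
  · have he : D.dh m n ((R.sgn m)⁻¹ • R.V m n (R.S m (n + 1) c)) = 0 := by
      rw [map_smul, R.dh_V, R.dh_S, hc, map_zero, map_zero, smul_zero]
    refine ⟨_, he, ?_⟩
    have h := R.V_S m (n + 1) (D.dv m n ((R.sgn m)⁻¹ • R.V m n (R.S m (n + 1) c)))
      (by rw [D.dh_dv, he, map_zero, neg_zero])
    rw [R.S_dv_odd _ _ _ hn, map_smul (R.S m n), R.S_V, smul_smul, mul_inv_cancel₀ (R.sgn_ne_zero m),
      one_smul] at h
    have hsub := Submodule.sub_mem _ (R.V_S m (n + 1) c hc) h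
    rwa [sub_sub_sub_cancel_right] at hsub

/-- Every cocycle of the bottom row extends to a total cocycle. -/
lemma exists_tot_eq_zero {N : ℕ} {x : D.C N 0} (hx : D.dh N 0 x = 0) :
    ∃ z, D.IsHomogeneous N z ∧ D.tot z = 0 ∧ z N 0 = x := by
  -- Zigzag up the antidiagonal from `(N, 0)` to `(0, N)`. That the vertical differential of the
  -- last entry is a horizontal boundary is what allows the next entry to be chosen.
  suffices h : ∀ j m, m + j = N → ∃ z, D.IsHomogeneous N z ∧ z N 0 = x ∧
      (∀ i n, n ≤ j → D.tot z i n = 0) ∧ D.dv m j (z m j) ∈ D.hBoundaries m (j + 1) by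
    obtain ⟨z, hz, hzx, h, h'⟩ := h N 0 (zero_add _)
    refine ⟨z, hz, ?_, hzx⟩
    ext i n
    by_cases hin : i + n = N + 1
    · rcases Nat.lt_or_ge N n with hn | hn
      · obtain rfl : i = 0 := by omega
        obtain rfl : n = N + 1 := by omega
        exact h'
      · exact h i n hn
    · exact hz.tot i n hin
  intro j
  induction j with
  | zero =>
    rintro m rfl
    refine ⟨single m 0 x, isHomogeneous_single (by simp) _, single_self _ _ _, ?_, ?_⟩
    · intro i n hn
      obtain rfl : n = 0 := by omega
      rcases i with _ | i
      · rfl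
      · by_cases hi : i = m
        · subst hi
          rw [tot_single_right]
          exact hx
        · exact (isHomogeneous_single rfl x).tot _ _ (by simpa using hi)
    · rw [single_self]
      exact R.dv_mem hx
  | succ j ih =>
    intro m hm
    obtain ⟨z, hz, hzx, h, b, hb⟩ := ih (m + 1) (by omega)
    have hb1 : D.dh m (j + 1 + 1) (D.dv m (j + 1) b) = 0 := by
      rw [D.dh_dv, hb, D.dv_dv, neg_zero]
    -- Correcting the primitive `b` by a horizontal cocycle `e` does not affect `dh b` and makes `dv
    -- (b - e)` a horizontal boundary. The new entry in column `m` is `-(b - e)`.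
    obtain ⟨e, he, he'⟩ := R.exists_sub_dv_mem hb1
      (by rw [D.dv_dv]; exact Submodule.zero_mem _)
    have hzm : z m (j + 1) = z m (j + 1) := rfl
    refine ⟨z - single m (j + 1) (z m (j + 1) + (b - e)),
      hz.sub (isHomogeneous_single (by omega) _), ?_, ?_, ?_⟩
    · simp [hzx, single_of_ne]
    · intro i n hn
      rw [tot_sub, Pi.sub_apply, Pi.sub_apply]
      by_cases hin : i + n = N + 1
      · rcases Nat.lt_or_ge n (j + 1) with hn' | hn'
        · rw [h i n (by omega), zero_sub, neg_eq_zero]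
          rcases i with _ | i <;> rcases n with _ | n <;> simp only [tot]
          · rw [single_of_ne _ (by omega), map_zero]
          · rw [single_of_ne _ (by omega), map_zero]
          · rw [single_of_ne _ (by omega), single_of_ne _ (by omega), map_zero, map_zero, add_zero]
        · obtain rfl : n = j + 1 := by omega
          obtain rfl : i = m + 1 := by omega
          rw [tot_single_right]
          simp only [tot, ← hb, map_add, map_sub, he]
          abel
      · rw [hz.tot i n hin, (isHomogeneous_single (by omega) _).tot i n hin, sub_zero]
    · rw [Pi.sub_apply, Pi.sub_apply, single_self, sub_add_cancel_left, map_neg, map_sub]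
      exact Submodule.neg_mem _ he'

/-- A total cocycle is a total coboundary if its term in the bottom row is a coboundary. -/
lemma exists_tot_eq {N : ℕ} {z : ∀ i n, D.C i n} (hz : D.IsHomogeneous N z) (hz' : D.tot z = 0)
    (h : z N 0 ∈ D.hBoundaries N 0) :
    ∃ t, (∀ i n, i + n + 1 ≠ N → t i n = 0) ∧ D.tot t = z := by
  suffices h : ∀ j ≤ N, ∃ t, (∀ i n, i + n + 1 ≠ N → t i n = 0) ∧
      ∀ i, ∀ n ≤ j, (z - D.tot t) i n = 0 by
    obtain ⟨t, ht, htz⟩ := h N le_rfl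
    refine ⟨t, ht, ?_⟩
    ext i n
    by_cases hin : i + n = N
    · exact (sub_eq_zero.1 (htz i n (by omega))).symm
    · rw [hz i n hin]
      rcases N with _ | N
      · rcases i with _ | i <;> rcases n with _ | n <;> simp [tot, ht]
      · have : D.IsHomogeneous N t := fun i j hij => ht i j (by omega)
        exact this.tot i n hin
  intro j hj
  induction j with
  | zero =>
    rcases N with _ | N
    · refine ⟨0, by simp, fun i n hn => ?_⟩
      obtain rfl : n = 0 := by omega
      rcases i with _ | i
      · have h : z 0 0 = 0 := h
        simpa [tot] using h
      · simp [hz (i + 1) 0 (by omega), tot]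
    · obtain ⟨b, hb⟩ := h
      refine ⟨single N 0 b, fun i n hin => single_of_ne _ (by omega), fun i n hn => ?_⟩
      obtain rfl : n = 0 := by omega
      by_cases hi : i = N + 1
      · subst hi
        rw [Pi.sub_apply, Pi.sub_apply, tot_single_right, hb, sub_self]
      · exact (hz.sub (isHomogeneous_single (by simp) b).tot) i 0 (by simpa using hi)
  | succ j ih =>
    obtain ⟨t, ht, htz⟩ := ih (by omega)
    obtain ⟨m, hm⟩ : ∃ m, m + j + 1 = N := ⟨N - j - 1, by omega⟩
    have ht' : D.IsHomogeneous N (D.tot t) := by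
      have : D.IsHomogeneous (m + j) t := fun i j hij => ht i j (by omega)
      rw [← hm]
      exact this.tot
    have hw : D.tot (z - D.tot t) = 0 := by rw [tot_sub, tot_tot, hz', sub_zero]
    have hw' := hz.sub ht'
    generalize hwz : z - D.tot t = w at *
    have h1 : D.dh m (j + 1) (w m (j + 1)) = 0 := by
      have := congrFun (congrFun hw (m + 1)) (j + 1)
      simpa only [tot, htz _ j le_rfl, map_zero, add_zero, Pi.zero_apply] using this
    have h2 : D.dv m (j + 1) (w m (j + 1)) ∈ D.hBoundaries m (j + 2) := by
      have := congrFun (congrFun hw m) (j + 2)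
      rcases m with _ | m
      · exact this
      · exact ⟨-w m (j + 2), by rw [map_neg, neg_eq_iff_add_eq_zero]; exact this⟩
    -- Modulo `dv e`, the entry in row `j + 1` is a horizontal boundary `dh b`; subtracting the
    -- total coboundary of `e` and `b` clears this row and keeps the lower ones zero. In column 0
    -- horizontal boundaries vanish, so `e` alone suffices.
    obtain ⟨e, he, he'⟩ := R.exists_sub_dv_mem h1 h2
    rcases m with _ | m
    · refine ⟨t + single 0 j e, fun i n hin => ?_, fun i n hn => ?_⟩
      · rw [Pi.add_apply, Pi.add_apply, ht i n hin, single_of_ne _ (by omega), add_zero]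
      · rw [tot_add, ← sub_sub, hwz]
        by_cases hin : i + n = N
        · rcases Nat.lt_or_ge n (j + 1) with hn' | hn'
          · rw [Pi.sub_apply, Pi.sub_apply, htz _ _ (by omega), zero_sub, neg_eq_zero]
            by_cases hnj : n = j
            · subst hnj
              obtain rfl : i = 1 := by omega
              rw [tot_single_right, he]
            · rcases i with _ | i <;> rcases n with _ | n <;> simp only [tot]
              · rw [single_of_ne _ (by omega), map_zero]
              · rw [single_of_ne _ (by omega), map_zero]
              · rw [single_of_ne _ (by omega), single_of_ne _ (by omega)]; simp
          · obtain rfl : i = 0 := by omega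
            obtain rfl : n = j + 1 := by omega
            rw [Pi.sub_apply, Pi.sub_apply, tot_single_up]
            exact he'
        · exact (hw'.sub (by rw [← hm]; exact (isHomogeneous_single (by omega) e).tot)) i n hin
    · obtain ⟨b, hb⟩ := he'
      refine ⟨t + (single (m + 1) j e + single m (j + 1) b), fun i n hin => ?_, fun i n hn => ?_⟩
      · simp only [Pi.add_apply]
        rw [ht i n hin, single_of_ne _ (by omega), single_of_ne _ (by omega), add_zero, add_zero]
      · rw [tot_add, ← sub_sub, hwz, tot_add]
        simp only [Pi.add_apply, Pi.sub_apply]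
        by_cases hin : i + n = N
        · rcases Nat.lt_or_ge n (j + 1) with hn' | hn'
          · rw [htz _ _ (by omega)]
            rcases Nat.lt_or_ge n j with hn'' | hn''
            · rcases i with _ | i <;> rcases n with _ | n <;> simp only [tot]
              · simp
              · rw [single_of_ne _ (by omega), single_of_ne _ (by omega)]; simp
              · rw [single_of_ne _ (by omega), single_of_ne _ (by omega)]; simp
              · rw [single_of_ne _ (by omega), single_of_ne _ (by omega),
                  single_of_ne _ (by omega), single_of_ne _ (by omega)]; simp
            · obtain rfl : n = j := by omega
              obtain rfl : i = m + 2 := by omega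
              rw [tot_single_right, he, zero_add, zero_sub, neg_eq_zero]
              rcases n with _ | n <;> simp only [tot]
              · rw [single_of_ne _ (by omega), map_zero]
              · rw [single_of_ne _ (by omega), single_of_ne _ (by omega)]; simp
          · obtain rfl : n = j + 1 := by omega
            obtain rfl : i = m + 1 := by omega
            rw [tot_single_right, tot_single_up, hb]
            abel
        · rw [hw' i n hin, show N = m + 1 + j + 1 from hm.symm] at *
          rw [(isHomogeneous_single rfl e).tot i n hin,
            (isHomogeneous_single (by omega) b).tot i n hin, add_zero, sub_zero]

end RowContraction

end DoubleComplex

end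

section

/-! ### The double complex of cochains of Dress's bisimplicial set -/

/-- The contraction of a simplex to its initial vertex. -/
def contraction (n : SimplexCategory) :
    SSet.stdSimplex.{0}.obj n ⊗ SSet.stdSimplex.{0}.obj ⦋1⦌ ⟶ SSet.stdSimplex.{0}.obj n where
  app k := ↾fun x => SSet.stdSimplex.objEquiv.symm (SimplexCategory.Hom.mk
    { toFun := fun i => if SSet.stdSimplex.objEquiv x.2 i = 0 then 0
        else SSet.stdSimplex.objEquiv x.1 i
      monotone' := by
        intro i j hij
        have h1 := (SSet.stdSimplex.objEquiv x.1).toOrderHom.monotone hij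
        have h2 := (SSet.stdSimplex.objEquiv x.2).toOrderHom.monotone hij
        dsimp only
        split_ifs with h h'
        · exact le_rfl
        · exact Fin.zero_le _
        · rename_i h'
          exact absurd (Fin.le_zero_iff.1 (h2.trans_eq h')) h
        · exact h1 })
  naturality k k' f := rfl

lemma lift_contraction_zero {W : SSet.{0}} {n m : SimplexCategory}
    (f : W ⟶ SSet.stdSimplex.{0}.obj n) (g : W ⟶ SSet.stdSimplex.{0}.obj m) :
    lift f (g ≫ SSet.stdSimplex.map (SimplexCategory.const m ⦋1⦌ 0)) ≫ contraction n =
      g ≫ SSet.stdSimplex.map (SimplexCategory.const m n 0) := by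
  ext k w
  refine SSet.stdSimplex.objEquiv.injective ?_
  ext i
  rfl

lemma lift_contraction_one {W : SSet.{0}} {n m : SimplexCategory}
    (f : W ⟶ SSet.stdSimplex.{0}.obj n) (g : W ⟶ SSet.stdSimplex.{0}.obj m) :
    lift f (g ≫ SSet.stdSimplex.map (SimplexCategory.const m ⦋1⦌ 1)) ≫ contraction n = f := by
  ext k w
  refine SSet.stdSimplex.objEquiv.injective ?_
  ext i
  exact congrArg Fin.val (if_neg (t := (0 : Fin (n.len + 1)))
    (show ¬ (1 : Fin 2) = 0 by decide))

variable {X Y : SSet.{0}} (p : X ⟶ Y)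

/-- The rows of Dress's bisimplicial set of a simplicial map. -/
def serreRow (n : SimplexCategoryᵒᵖ) : SSet.{0} where
  obj m := (serreFibre p m.unop).obj n
  map f := (serreBase p f.unop).app n
  map_id m := by
    refine ConcreteCategory.hom_ext _ _ fun κ => ?_
    refine Subtype.ext (Prod.ext ?_ ?_)
    · change (SSet.stdSimplex.map (𝟙 m.unop) ▷ _) ≫ κ.1.1 = κ.1.1
      rw [SSet.stdSimplex.{0}.map_id m.unop, id_whiskerRight, Category.id_comp]
    · change SSet.stdSimplex.map (𝟙 m.unop) ≫ κ.1.2 = κ.1.2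
      rw [SSet.stdSimplex.{0}.map_id m.unop, Category.id_comp]
  map_comp f g := by
    refine ConcreteCategory.hom_ext _ _ fun κ => ?_
    refine Subtype.ext (Prod.ext ?_ ?_)
    · change (SSet.stdSimplex.map (g.unop ≫ f.unop) ▷ _) ≫ κ.1.1 =
        (SSet.stdSimplex.map g.unop ▷ _) ≫ (SSet.stdSimplex.map f.unop ▷ _) ≫ κ.1.1
      rw [SSet.stdSimplex.{0}.map_comp g.unop f.unop, comp_whiskerRight, Category.assoc]
    · change SSet.stdSimplex.map (g.unop ≫ f.unop) ≫ κ.1.2 =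
        SSet.stdSimplex.map g.unop ≫ SSet.stdSimplex.map f.unop ≫ κ.1.2
      rw [SSet.stdSimplex.{0}.map_comp g.unop f.unop, Category.assoc]

/-- The simplicial structure of Dress's bisimplicial set in the fibre direction. -/
def serreRowMap {n n' : SimplexCategoryᵒᵖ} (f : n ⟶ n') : serreRow p n ⟶ serreRow p n' where
  app m := (serreFibre p m.unop).map f
  naturality _ _ g := ((serreBase p g.unop).naturality f).symm

/-- The double complex of cochains of Dress's bisimplicial set. -/
def serreDouble : DoubleComplex where
  C i n := serreFibre p ⦋i⦌ _⦋n⦌ → ℚ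
  dh i n := coboundaryBase p i n
  dv i n := (-1 : ℚ) ^ i • coboundary (serreFibre p ⦋i⦌) n
  dh_dh i n c := coboundary_coboundary (serreRow p (op ⦋n⦌)) i c
  dv_dv i n c := by
    simp only [LinearMap.smul_apply, map_smul, coboundary_coboundary, smul_zero]
  dh_dv i n c := by
    have h : coboundaryBase p i (n + 1) (coboundary (serreFibre p ⦋i⦌) n c) =
        coboundary (serreFibre p ⦋i + 1⦌) n (coboundaryBase p i n c) := by
      simp only [coboundaryBase, LinearMap.sum_apply, LinearMap.smul_apply, map_sum, map_smul]
      refine Finset.sum_congr rfl fun k _ => ?_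
      congr 1
      exact (coboundary_cochainPullback (serreBase p (SimplexCategory.δ k)) n c).symm
    rw [LinearMap.smul_apply, map_smul, h, LinearMap.smul_apply, pow_succ, mul_neg_one, neg_smul,
      neg_neg]

lemma serreDouble_dv_mem {i n : ℕ} {c : serreFibre p ⦋i⦌ _⦋n + 1⦌ → ℚ} :
    (∃ b, (serreDouble p).dv i n b = c) ↔ c ∈ coboundaries (serreFibre p ⦋i⦌) (n + 1) := by
  have hne : ((-1 : ℚ) ^ i) ≠ 0 := pow_ne_zero _ (by norm_num)
  constructor
  · rintro ⟨b, rfl⟩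
    exact ⟨(-1 : ℚ) ^ i • b, map_smul _ _ _⟩
  · rintro ⟨b, rfl⟩
    refine ⟨((-1 : ℚ) ^ i)⁻¹ • b, ?_⟩
    change (-1 : ℚ) ^ i • coboundary _ n (((-1 : ℚ) ^ i)⁻¹ • b) = _
    rw [map_smul, smul_smul, mul_inv_cancel₀ hne, one_smul]

lemma serreDouble_dv_eq_zero {i n : ℕ} {c : serreFibre p ⦋i⦌ _⦋n⦌ → ℚ} :
    (serreDouble p).dv i n c = 0 ↔ c ∈ cocycles (serreFibre p ⦋i⦌) n := by
  have hne : ((-1 : ℚ) ^ i) ≠ 0 := pow_ne_zero _ (by norm_num)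
  exact smul_eq_zero_iff_right hne

lemma serreDouble_hBoundaries (m n : ℕ) :
    (serreDouble p).hBoundaries m n = coboundaries (serreRow p (op ⦋n⦌)) m := by
  cases m <;> rfl

/-- The contraction of the fibre direction of Dress's bisimplicial set. -/
def serreRowHomotopy (n : ℕ) :
    SSet.Homotopy
      (serreRowMap p (SimplexCategory.const ⦋0⦌ ⦋n⦌ 0).op ≫
        serreRowMap p (SimplexCategory.const ⦋n⦌ ⦋0⦌ 0).op)
      (𝟙 (serreRow p (op ⦋n⦌))) :=
  homotopyOfFamily _ _
    (fun m κ t => ⟨(lift (fst _ _) (lift (snd _ _) (fst _ _ ≫ SSet.stdSimplex.map t) ≫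
      contraction ⦋n⦌) ≫ κ.1.1, κ.1.2), by
        rw [Category.assoc, κ.2, lift_fst_assoc]⟩)
    (fun φ κ t => rfl)
    (fun m κ => Subtype.ext (Prod.ext (by rw [lift_contraction_zero]; rfl) rfl))
    (fun m κ => Subtype.ext (Prod.ext (by
      rw [lift_contraction_one]
      change lift (fst _ _) (snd _ _) ≫ κ.1.1 = κ.1.1
      rw [lift_fst_snd, Category.id_comp]) rfl))

/-- All faces of a simplex that is totally degenerate in the fibre direction coincide, so only an
alternating sum of `n + 2` signs is left. -/
lemma serreDouble_S_dv {m n : ℕ} (c : serreFibre p ⦋m⦌ _⦋n⦌ → ℚ) (κ : serreFibre p ⦋m⦌ _⦋0⦌) :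
    (serreDouble p).dv m n c ((serreFibre p ⦋m⦌).map (SimplexCategory.const ⦋n + 1⦌ ⦋0⦌ 0).op κ) =
      (-1) ^ m * ((∑ k : Fin (n + 2), (-1 : ℚ) ^ (k : ℕ)) *
        c ((serreFibre p ⦋m⦌).map (SimplexCategory.const ⦋n⦌ ⦋0⦌ 0).op κ)) := by
  change (-1 : ℚ) ^ m * coboundary (serreFibre p ⦋m⦌) n c _ = _
  congr 1
  rw [coboundary, LinearMap.sum_apply, Finset.sum_apply, Finset.sum_mul]
  refine Finset.sum_congr rfl fun k _ => ?_
  refine congrArg (fun a => (-1 : ℚ) ^ (k : ℕ) * c a) ?_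
  exact (Functor.map_comp_apply (serreFibre p ⦋m⦌) _ _ κ).symm

/-- The rows of the double complex of cochains of Dress's bisimplicial set are all equivalent to
the cochains of the total space. -/
def serreRowContraction : (serreDouble p).RowContraction where
  V m n := cochainPullback (serreRowMap p (SimplexCategory.const ⦋0⦌ ⦋n⦌ 0).op) m
  S m n := cochainPullback (serreRowMap p (SimplexCategory.const ⦋n⦌ ⦋0⦌ 0).op) m
  sgn m := (-1) ^ m
  sgn_ne_zero m := pow_ne_zero _ (by norm_num)
  dh_V m n c := coboundary_cochainPullback (serreRowMap p (SimplexCategory.const ⦋0⦌ ⦋n⦌ 0).op) m c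
  dh_S m n c := coboundary_cochainPullback (serreRowMap p (SimplexCategory.const ⦋n⦌ ⦋0⦌ 0).op) m c
  S_V m n c := by
    refine funext fun κ => congrArg c ?_
    have h : (SimplexCategory.const ⦋n⦌ ⦋0⦌ 0).op ≫ (SimplexCategory.const ⦋0⦌ ⦋n⦌ 0).op =
        𝟙 (op ⦋0⦌) := Quiver.Hom.unop_inj (Subsingleton.elim _ _)
    change (serreFibre p ⦋m⦌).map (SimplexCategory.const ⦋0⦌ ⦋n⦌ 0).op
      ((serreFibre p ⦋m⦌).map (SimplexCategory.const ⦋n⦌ ⦋0⦌ 0).op κ) = κ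
    rw [← Functor.map_comp_apply, h, Functor.map_id_apply]
  V_S m n c hc := by
    rw [serreDouble_hBoundaries]
    have h := sub_mem_coboundaries_of_homotopy (serreRowHomotopy p n) hc
    have h' := Submodule.neg_mem _ h
    rwa [neg_sub] at h'
  S_dv_even m n c hn := by
    refine funext fun κ => ?_
    refine (serreDouble_S_dv p c κ).trans ?_
    rw [Fin.sum_neg_one_pow, if_pos (by simpa [Nat.even_add] using hn), zero_mul, mul_zero]
    rfl
  S_dv_odd m n c hn := by
    refine funext fun κ => ?_
    refine (serreDouble_S_dv p c κ).trans ?_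
    rw [Fin.sum_neg_one_pow, if_neg (by simpa [Nat.even_add] using hn), one_mul]
    rfl

end

section

/-! ### Twisted products -/

variable {A Γ Q : Type} [CommGroup A] [Group Γ] [Group Q]

/-- The simplicial set of normalised `Γ`-valued `1`-cochains whose coboundary is the image of an
`A`-valued `2`-cocycle under a homomorphism `ι`. -/
def twistedSpace (ι : A →* Γ) : SSet.{0} where
  obj n := {γa : ((⦋1⦌ ⟶ n.unop) → Γ) × (doubleClassifyingSpace A).obj n //
    (∀ v : ⦋0⦌ ⟶ n.unop, γa.1 (SimplexCategory.σ 0 ≫ v) = 1) ∧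
    ∀ τ : ⦋2⦌ ⟶ n.unop, γa.1 (SimplexCategory.δ 2 ≫ τ) * γa.1 (SimplexCategory.δ 0 ≫ τ) =
      ι (γa.2.1 τ) * γa.1 (SimplexCategory.δ 1 ≫ τ)}
  map f := ↾fun γa => ⟨(fun e => γa.1.1 (e ≫ f.unop), (doubleClassifyingSpace A).map f γa.1.2),
    fun v => by simpa only [Category.assoc] using γa.2.1 (v ≫ f.unop),
    fun τ => by
      have h := γa.2.2 (τ ≫ f.unop)
      simp only [← Category.assoc] at h
      exact h⟩
  map_id n := by
    refine ConcreteCategory.hom_ext _ _ fun γa => Subtype.ext (Prod.ext (funext fun e => ?_) ?_)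
    · change γa.1.1 (e ≫ 𝟙 _) = γa.1.1 e
      rw [Category.comp_id]
    · change (doubleClassifyingSpace A).map (𝟙 n) γa.1.2 = γa.1.2
      simp
  map_comp f g := by
    refine ConcreteCategory.hom_ext _ _ fun γa => Subtype.ext (Prod.ext (funext fun e => ?_) ?_)
    · change γa.1.1 (e ≫ g.unop ≫ f.unop) = γa.1.1 ((e ≫ g.unop) ≫ f.unop)
      rw [Category.assoc]
    · change (doubleClassifyingSpace A).map (f ≫ g) γa.1.2 =
        (doubleClassifyingSpace A).map g ((doubleClassifyingSpace A).map f γa.1.2)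
      simp

/-- The projection of a twisted product to its base. -/
def twistedProj (ι : A →* Γ) : twistedSpace ι ⟶ doubleClassifyingSpace A where
  app n := ↾fun γa => γa.1.2

/-- The map `B²A' ⟶ B²A` induced by a homomorphism. -/
def doubleClassifyingMap {A' : Type} [CommGroup A'] (φ : A' →* A) :
    doubleClassifyingSpace A' ⟶ doubleClassifyingSpace A where
  app n := ↾fun a => ⟨fun τ => φ (a.1 τ), fun i e => (congrArg φ (a.2.1 i e)).trans (map_one φ),
    fun θ => by simpa only [map_mul] using congrArg φ (a.2.2 θ)⟩

/-- The map of twisted products over a homomorphism `φ`. -/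
def twistedMap {A' : Type} [CommGroup A'] (φ : A' →* A) (ι : A →* Γ) :
    twistedSpace (ι.comp φ) ⟶ twistedSpace ι where
  app n := ↾fun γa => ⟨(γa.1.1, (doubleClassifyingMap φ).app n γa.1.2), γa.2⟩

lemma twistedMap_twistedProj {A' : Type} [CommGroup A'] (φ : A' →* A) (ι : A →* Γ) :
    twistedProj (ι.comp φ) ≫ doubleClassifyingMap φ = twistedMap φ ι ≫ twistedProj ι := rfl

/-- The cone with vertex `0` on a simplex of a standard simplex. -/
def cone {i : SimplexCategory} {k : ℕ} (f : ⦋k⦌ ⟶ i) : ⦋k + 1⦌ ⟶ i :=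
  SimplexCategory.Hom.mk
    { toFun := fun j => Fin.cases 0 (fun j => f j) j
      monotone' := by
        intro j j' h
        induction j using Fin.cases with
        | zero => exact Fin.zero_le _
        | succ j =>
          induction j' using Fin.cases with
          | zero => exact absurd h (by simp)
          | succ j' => exact f.toOrderHom.monotone (Fin.succ_le_succ_iff.1 h) }

lemma δ_zero_cone {i : SimplexCategory} {k : ℕ} (f : ⦋k⦌ ⟶ i) :
    SimplexCategory.δ 0 ≫ cone f = f := by
  ext l : 3
  rfl

lemma δ_succ_cone {i : SimplexCategory} {k : ℕ} (f : ⦋k + 1⦌ ⟶ i) (j : Fin (k + 2)) :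
    SimplexCategory.δ j.succ ≫ cone f = cone (SimplexCategory.δ j ≫ f) := by
  ext l : 3
  change (cone f).toOrderHom (j.succ.succAbove l) = _
  induction l using Fin.cases with
  | zero => rfl
  | succ l =>
    rw [Fin.succ_succAbove_succ]
    rfl

lemma σ_succ_cone {i : SimplexCategory} {k : ℕ} (f : ⦋k⦌ ⟶ i) (j : Fin (k + 1)) :
    SimplexCategory.σ j.succ ≫ cone f = cone (SimplexCategory.σ j ≫ f) := by
  ext l : 3
  change (cone f).toOrderHom (j.succ.predAbove l) = _
  induction l using Fin.cases with
  | zero => simp; rfl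
  | succ l =>
    rw [Fin.succ_predAbove_succ]
    rfl

/-- The cochain which trivialises a `2`-cocycle on a standard simplex. -/
def trivialisation {i : SimplexCategory} (a : (doubleClassifyingSpace A).obj (op i))
    (e : ⦋1⦌ ⟶ i) : A := a.1 (cone e)

lemma trivialisation_σ {i : SimplexCategory} (a : (doubleClassifyingSpace A).obj (op i))
    (v : ⦋0⦌ ⟶ i) : trivialisation a (SimplexCategory.σ 0 ≫ v) = 1 := by
  rw [trivialisation, ← σ_succ_cone]
  exact a.2.1 1 _

/-- This is the cocycle identity of `a` on the cone over `τ` with apex the initial vertex. -/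
lemma trivialisation_δ {i : SimplexCategory} (a : (doubleClassifyingSpace A).obj (op i))
    (τ : ⦋2⦌ ⟶ i) : trivialisation a (SimplexCategory.δ 2 ≫ τ) *
      trivialisation a (SimplexCategory.δ 0 ≫ τ) =
      a.1 τ * trivialisation a (SimplexCategory.δ 1 ≫ τ) := by
  have h := a.2.2 (cone τ)
  rw [δ_zero_cone, show SimplexCategory.δ 2 ≫ cone τ = _ from δ_succ_cone τ 1,
    show SimplexCategory.δ 1 ≫ cone τ = _ from δ_succ_cone τ 0,
    show SimplexCategory.δ 3 ≫ cone τ = _ from δ_succ_cone τ 2] at h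
  rw [trivialisation, trivialisation, trivialisation, h, mul_comm]

/-- For 1-cocycles normalisation is automatic: on a constant triangle the cocycle identity reads `γ
γ = γ`. -/
lemma classifyingSpace_σ {n : SimplexCategoryᵒᵖ} (β : (classifyingSpace Γ).obj n)
    (v : ⦋0⦌ ⟶ n.unop) : β.1 (SimplexCategory.σ 0 ≫ v) = 1 := by
  have h := β.2 (SimplexCategory.const ⦋2⦌ ⦋0⦌ 0 ≫ v)
  simp only [← Category.assoc] at h
  rw [Subsingleton.elim (SimplexCategory.δ 2 ≫ SimplexCategory.const ⦋2⦌ ⦋0⦌ 0)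
      (SimplexCategory.σ 0),
    Subsingleton.elim (SimplexCategory.δ 0 ≫ SimplexCategory.const ⦋2⦌ ⦋0⦌ 0)
      (SimplexCategory.σ 0),
    Subsingleton.elim (SimplexCategory.δ 1 ≫ SimplexCategory.const ⦋2⦌ ⦋0⦌ 0)
      (SimplexCategory.σ 0)] at h
  exact mul_eq_left.1 h

variable {ι : A →* Γ} (hι : ∀ a g, ι a * g = g * ι a)

/-- The trivialisation of a twisted product over a simplex of the base. -/
def twist {i : SimplexCategory} (s : SSet.stdSimplex.{0}.obj i ⟶ doubleClassifyingSpace A) :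
    classifyingSpace Γ ⊗ SSet.stdSimplex.{0}.obj i ⟶ twistedSpace ι where
  app n := ↾fun x => ⟨(fun e => x.1.1 e *
      ι (trivialisation (SSet.yonedaEquiv s) (e ≫ SSet.stdSimplex.objEquiv x.2)), s.app n x.2), by
    refine ⟨fun v => ?_, fun τ => ?_⟩
    · dsimp only
      rw [Category.assoc, trivialisation_σ, classifyingSpace_σ, map_one, mul_one]
    · have h : (s.app n x.2).1 τ = (SSet.yonedaEquiv s).1 (τ ≫ SSet.stdSimplex.objEquiv x.2) := by
        obtain ⟨a, rfl⟩ := SSet.yonedaEquiv.symm.surjective s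
        rw [Equiv.apply_symm_apply]
        rfl
      dsimp only
      rw [h, ← mul_assoc, mul_assoc (x.1.1 _), hι, mul_assoc, mul_assoc, ← map_mul,
        Category.assoc, Category.assoc, trivialisation_δ, ← mul_assoc, x.1.2 τ, map_mul,
        ← mul_assoc, ← hι, ← mul_assoc]
      rw [hι (trivialisation _ _)]
      exact (hι _ _).symm⟩
  naturality n n' f := by
    refine ConcreteCategory.hom_ext _ _ fun x => Subtype.ext (Prod.ext (funext fun e => ?_) ?_)
    · rfl
    · exact ConcreteCategory.congr_hom (s.naturality f) x.2

/-- The inverse of the trivialisation of a twisted product over a simplex of the base. -/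
def untwist {W : SSet.{0}} {i : SimplexCategory}
    (s : SSet.stdSimplex.{0}.obj i ⟶ doubleClassifyingSpace A) (κ : W ⟶ twistedSpace ι)
    (w : W ⟶ SSet.stdSimplex.{0}.obj i) (h : κ ≫ twistedProj ι = w ≫ s) :
    W ⟶ classifyingSpace Γ where
  app n := ↾fun x => ⟨fun e => (κ.app n x).1.1 e * (ι (trivialisation (SSet.yonedaEquiv s)
      (e ≫ SSet.stdSimplex.objEquiv (w.app n x))))⁻¹, by
    intro τ
    have h0 := ConcreteCategory.congr_hom (congr_app h n) x
    have h1 : (κ.app n x).1.2 = s.app n (w.app n x) := h0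
    have h2 : (κ.app n x).1.2.1 τ =
        (SSet.yonedaEquiv s).1 (τ ≫ SSet.stdSimplex.objEquiv (w.app n x)) := by
      rw [h1]
      obtain ⟨a, rfl⟩ := SSet.yonedaEquiv.symm.surjective s
      rw [Equiv.apply_symm_apply]
      rfl
    have h3 := (κ.app n x).2.2 τ
    rw [h2] at h3
    have h4 := congrArg ι (trivialisation_δ (SSet.yonedaEquiv s)
      (τ ≫ SSet.stdSimplex.objEquiv (w.app n x)))
    rw [map_mul, map_mul] at h4
    have hι' : ∀ a g, (ι a)⁻¹ * g = g * (ι a)⁻¹ := fun a g => by rw [← map_inv, hι]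
    simp only [Category.assoc] at h3 h4 ⊢
    rw [mul_assoc, ← mul_assoc (ι _)⁻¹, hι', mul_assoc, ← mul_assoc, h3, ← mul_inv_rev,
      mul_inv_eq_iff_eq_mul, hι _ (ι _), h4, ← mul_assoc, mul_assoc, mul_assoc,
      ← mul_assoc (ι _)⁻¹, hι', mul_assoc, inv_mul_cancel, mul_one, ← hι]⟩
  naturality n n' f := by
    refine ConcreteCategory.hom_ext _ _ fun x => Subtype.ext (funext fun e => ?_)
    have h1 : κ.app n' (W.map f x) = (twistedSpace ι).map f (κ.app n x) :=
      ConcreteCategory.congr_hom (κ.naturality f) x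
    have h2 : w.app n' (W.map f x) = (SSet.stdSimplex.obj i).map f (w.app n x) :=
      ConcreteCategory.congr_hom (w.naturality f) x
    change (κ.app n' (W.map f x)).1.1 e * (ι (trivialisation (SSet.yonedaEquiv s)
      (e ≫ SSet.stdSimplex.objEquiv (w.app n' (W.map f x)))))⁻¹ = _
    rw [h1, h2]
    rfl

/-- Together with `untwist_lift_twist` this trivialises the twisted product over each simplex of the
base: lifts of a map `w` into the simplex correspond to maps to `BΓ`. -/
lemma lift_untwist_twist {W : SSet.{0}} {i : SimplexCategory}
    (s : SSet.stdSimplex.{0}.obj i ⟶ doubleClassifyingSpace A) (κ : W ⟶ twistedSpace ι)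
    (w : W ⟶ SSet.stdSimplex.{0}.obj i) (h : κ ≫ twistedProj ι = w ≫ s) :
    lift (untwist hι s κ w h) w ≫ twist hι s = κ := by
  ext n x
  refine Subtype.ext (Prod.ext (funext fun e => ?_) ?_)
  · exact inv_mul_cancel_right _ _
  · exact (ConcreteCategory.congr_hom (congr_app h n) x).symm

lemma twist_twistedProj {i : SimplexCategory}
    (s : SSet.stdSimplex.{0}.obj i ⟶ doubleClassifyingSpace A) :
    twist hι s ≫ twistedProj ι = snd _ _ ≫ s := rfl

lemma untwist_lift_twist {W : SSet.{0}} {i : SimplexCategory}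
    (s : SSet.stdSimplex.{0}.obj i ⟶ doubleClassifyingSpace A) (β : W ⟶ classifyingSpace Γ)
    (w : W ⟶ SSet.stdSimplex.{0}.obj i) (h : (lift β w ≫ twist hι s) ≫ twistedProj ι = w ≫ s) :
    untwist hι s (lift β w ≫ twist hι s) w h = β := by
  ext n x
  refine Subtype.ext (funext fun e => ?_)
  exact mul_inv_cancel_right _ _

lemma comp_untwist {W W' : SSet.{0}} {i : SimplexCategory} (f : W' ⟶ W)
    (s : SSet.stdSimplex.{0}.obj i ⟶ doubleClassifyingSpace A) (κ : W ⟶ twistedSpace ι)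
    (w : W ⟶ SSet.stdSimplex.{0}.obj i) (h : κ ≫ twistedProj ι = w ≫ s)
    (h' : (f ≫ κ) ≫ twistedProj ι = (f ≫ w) ≫ s) :
    untwist hι s (f ≫ κ) (f ≫ w) h' = f ≫ untwist hι s κ w h := rfl

lemma cone_comp {i j : SimplexCategory} {k : ℕ} (e : ⦋k⦌ ⟶ j) (f : j ⟶ i)
    (hf : f.toOrderHom 0 = 0) : cone e ≫ f = cone (e ≫ f) := by
  ext l : 3
  induction l using Fin.cases with
  | zero => exact hf
  | succ l => rfl

/-- The trivialisation cones from the initial vertex, so it is compatible with maps of simplices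
preserving that vertex. Its failure for face 0 is where the twisting of the fibration enters. -/
lemma untwist_map_comp {W : SSet.{0}} {i j : SimplexCategory} (f : j ⟶ i)
    (hf : f.toOrderHom 0 = 0)
    (s : SSet.stdSimplex.{0}.obj i ⟶ doubleClassifyingSpace A) (κ : W ⟶ twistedSpace ι)
    (w : W ⟶ SSet.stdSimplex.{0}.obj j) (h : κ ≫ twistedProj ι = w ≫ SSet.stdSimplex.map f ≫ s)
    (h' : κ ≫ twistedProj ι = (w ≫ SSet.stdSimplex.map f) ≫ s) :
    untwist hι (SSet.stdSimplex.map f ≫ s) κ w h =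
      untwist hι s κ (w ≫ SSet.stdSimplex.map f) h' := by
  ext n x
  refine Subtype.ext (funext fun e => ?_)
  refine congrArg (fun a => (κ.app n x).1.1 e * (ι a)⁻¹) ?_
  rw [← SSet.yonedaEquiv_naturality]
  change (SSet.yonedaEquiv s).1 (cone (e ≫ SSet.stdSimplex.objEquiv (w.app n x)) ≫ f) = _
  rw [cone_comp _ _ hf]
  rfl

lemma twist_twistedMap {A' : Type} [CommGroup A'] (φ : A' →* A)
    (hφ : ∀ a g, ι.comp φ a * g = g * ι.comp φ a) {i : SimplexCategory}
    (s : SSet.stdSimplex.{0}.obj i ⟶ doubleClassifyingSpace A') :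
    twist hφ s ≫ twistedMap φ ι = twist hι (s ≫ doubleClassifyingMap φ) := rfl

lemma untwist_app_apply {W : SSet.{0}} {i : SimplexCategory}
    (s : SSet.stdSimplex.{0}.obj i ⟶ doubleClassifyingSpace A) (κ : W ⟶ twistedSpace ι)
    (w : W ⟶ SSet.stdSimplex.{0}.obj i) (h : κ ≫ twistedProj ι = w ≫ s) {n : SimplexCategoryᵒᵖ}
    (x : W.obj n) (e : ⦋1⦌ ⟶ n.unop) :
    ((untwist hι s κ w h).app n x).1 e = (κ.app n x).1.1 e *
      (ι (trivialisation (SSet.yonedaEquiv s)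
      (e ≫ SSet.stdSimplex.objEquiv (w.app n x))))⁻¹ := rfl

attribute [irreducible] twist untwist

/-- The restriction to the initial vertex of the tautological simplex of `Δ[i] × Δ[n]`. -/
def initialSimplex (i n : SimplexCategory) :
    SSet.stdSimplex.{0}.obj n ⟶ SSet.stdSimplex.{0}.obj i ⊗ SSet.stdSimplex.{0}.obj n :=
  lift (SSet.stdSimplex.map (SimplexCategory.const n i 0)) (𝟙 _)

lemma map_initialSimplex (i : SimplexCategory) {n n' : SimplexCategory} (f : n ⟶ n') :
    SSet.stdSimplex.map f ≫ initialSimplex i n' =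
      initialSimplex i n ≫ (SSet.stdSimplex.obj i ◁ SSet.stdSimplex.map f) := rfl

lemma initialSimplex_snd (i n : SimplexCategory) : initialSimplex i n ≫ snd _ _ = 𝟙 _ := rfl

/-- The trivialised fibre over the initial vertex of the base simplex. -/
def fibreRestriction (i : SimplexCategory) :
    serreFibre (twistedProj ι) i ⟶ classifyingSpace Γ where
  app n := ↾fun κ => SSet.yonedaEquiv
    (initialSimplex i n.unop ≫ untwist hι κ.1.2 κ.1.1 (fst _ _) κ.2)
  naturality n n' f := by
    refine ConcreteCategory.hom_ext _ _ fun κ => ?_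
    refine Eq.trans ?_ (SSet.yonedaEquiv_naturality f.unop
      (initialSimplex i n.unop ≫ untwist hι κ.1.2 κ.1.1 (fst _ _) κ.2)).symm
    rw [← Category.assoc, map_initialSimplex, Category.assoc, ← comp_untwist]
    rfl

/-- Over the initial vertex the trivialising cochain is evaluated on degenerate edges, where it
equals 1. -/
lemma fibreRestriction_apply (i : SimplexCategory) {n : SimplexCategoryᵒᵖ}
    (κ : (serreFibre (twistedProj ι) i).obj n) (e : ⦋1⦌ ⟶ n.unop) :
    ((fibreRestriction hι i).app n κ).1 e =
      (SSet.yonedaEquiv (initialSimplex i n.unop ≫ κ.1.1)).1.1 e := by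
  refine (untwist_app_apply hι κ.1.2 κ.1.1 (fst _ _) κ.2
    (SSet.yonedaEquiv (initialSimplex i n.unop)) e).trans ?_
  have h : e ≫ SSet.stdSimplex.objEquiv
      ((fst _ _ : SSet.stdSimplex.{0}.obj i ⊗ SSet.stdSimplex.{0}.obj n.unop ⟶ _).app n
        (SSet.yonedaEquiv (initialSimplex i n.unop))) =
      SimplexCategory.σ 0 ≫ SimplexCategory.const ⦋0⦌ i 0 := rfl
  rw [h, trivialisation_σ, map_one, inv_one, mul_one]
  rfl

/-- The inclusion of the fibre as the constant sections over a simplex of the base. -/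
def fibreInclusion {i : SimplexCategory}
    (s : SSet.stdSimplex.{0}.obj i ⟶ doubleClassifyingSpace A) :
    classifyingSpace Γ ⟶ serreFibre (twistedProj ι) i where
  app n := ↾fun β => ⟨(lift (snd _ _ ≫ SSet.yonedaEquiv.symm β) (fst _ _) ≫ twist hι s, s), by
    rw [Category.assoc, twist_twistedProj, lift_snd_assoc]⟩
  naturality n n' f := by
    refine ConcreteCategory.hom_ext _ _ fun β => Subtype.ext (Prod.ext ?_ rfl)
    change lift (snd _ _ ≫ SSet.yonedaEquiv.symm ((classifyingSpace Γ).map f β)) (fst _ _) ≫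
      twist hι s = (_ ◁ SSet.stdSimplex.map f.unop) ≫ lift (snd _ _ ≫ SSet.yonedaEquiv.symm β)
        (fst _ _) ≫ twist hι s
    have h := SSet.yonedaEquiv_symm_naturality_left f.unop β
    rw [Quiver.Hom.op_unop] at h
    rw [← h]
    rfl

lemma fibreRestriction_fibreInclusion {i : SimplexCategory}
    (s : SSet.stdSimplex.{0}.obj i ⟶ doubleClassifyingSpace A) (n : SimplexCategoryᵒᵖ)
    (β : (classifyingSpace Γ).obj n) :
    (fibreRestriction hι i).app n ((fibreInclusion hι s).app n β) = β := by
  refine (congrArg (fun f => SSet.yonedaEquiv (initialSimplex i n.unop ≫ f))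
    (untwist_lift_twist hι s (snd _ _ ≫ SSet.yonedaEquiv.symm β) (fst _ _)
      ((fibreInclusion hι s).app n β).2)).trans ?_
  rw [← Category.assoc, initialSimplex_snd, Category.id_comp, Equiv.apply_symm_apply]

/-- The map retracting each space of sections to the subspace of constant sections. -/
def sectionRetraction (i : SimplexCategory) :
    serreFibre (twistedProj ι) i ⟶ serreFibre (twistedProj ι) i where
  app n := ↾fun κ => (fibreInclusion hι κ.1.2).app n ((fibreRestriction hι i).app n κ)
  naturality n n' f := by
    refine ConcreteCategory.hom_ext _ _ fun κ => ?_
    have h1 := ConcreteCategory.congr_hom ((fibreRestriction hι i).naturality f) κ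
    have h2 := ConcreteCategory.congr_hom ((fibreInclusion hι κ.1.2).naturality f)
      ((fibreRestriction hι i).app n κ)
    exact (congrArg ((fibreInclusion hι κ.1.2).app n') h1).trans h2

/-- The map of `Δ[i] × Δ[n]` contracting the first factor to the initial vertex, over the part of
`Δ[n]` where `t` vanishes. -/
def sectionContraction (i : SimplexCategory) {n : SimplexCategory} (t : n ⟶ ⦋1⦌) :
    SSet.stdSimplex.{0}.obj i ⊗ SSet.stdSimplex.{0}.obj n ⟶
      SSet.stdSimplex.{0}.obj i ⊗ SSet.stdSimplex.{0}.obj n :=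
  lift (lift (fst _ _) (snd _ _ ≫ SSet.stdSimplex.map t) ≫ contraction i) (snd _ _)

lemma sectionContraction_zero (i n : SimplexCategory) :
    sectionContraction i (SimplexCategory.const n ⦋1⦌ 0) = snd _ _ ≫ initialSimplex i n := by
  rw [sectionContraction, lift_contraction_zero]
  rfl

lemma sectionContraction_one (i n : SimplexCategory) :
    sectionContraction i (SimplexCategory.const n ⦋1⦌ 1) = 𝟙 _ := by
  rw [sectionContraction, lift_contraction_one, lift_fst_snd]

lemma whiskerLeft_sectionContraction (i : SimplexCategory) {n n' : SimplexCategory} (f : n ⟶ n')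
    (t : n' ⟶ ⦋1⦌) :
    (SSet.stdSimplex.obj i ◁ SSet.stdSimplex.map f) ≫ sectionContraction i t =
      sectionContraction i (f ≫ t) ≫ (SSet.stdSimplex.obj i ◁ SSet.stdSimplex.map f) := rfl

/-- The homotopy which retracts each space of sections to the constant sections. -/
def sectionHomotopy (i : SimplexCategory) :
    SSet.Homotopy (sectionRetraction hι i) (𝟙 (serreFibre (twistedProj ι) i)) :=
  homotopyOfFamily _ _
    (fun n κ t => ⟨(lift (sectionContraction i t ≫
      untwist hι κ.1.2 κ.1.1 (fst _ _) κ.2) (fst _ _) ≫ twist hι κ.1.2, κ.1.2), by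
      rw [Category.assoc, twist_twistedProj, lift_snd_assoc]⟩)
    (fun {n n'} φ κ t => by
      refine Subtype.ext (Prod.ext ?_ rfl)
      have e : untwist hι κ.1.2 ((_ ◁ SSet.stdSimplex.map φ.unop) ≫ κ.1.1) (fst _ _)
          ((serreFibre (twistedProj ι) i).map φ κ).2 =
          (_ ◁ SSet.stdSimplex.map φ.unop) ≫ untwist hι κ.1.2 κ.1.1 (fst _ _) κ.2 :=
        comp_untwist hι (_ ◁ SSet.stdSimplex.map φ.unop) κ.1.2 κ.1.1 (fst _ _) κ.2
          ((serreFibre (twistedProj ι) i).map φ κ).2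
      refine Eq.trans ?_ (congrArg (fun f => lift (sectionContraction i (φ.unop ≫ t) ≫ f)
        (fst _ _) ≫ twist hι κ.1.2) e).symm
      change (_ ◁ SSet.stdSimplex.map φ.unop) ≫ lift (sectionContraction i t ≫
        untwist hι κ.1.2 κ.1.1 (fst _ _) κ.2) (fst _ _) ≫ twist hι κ.1.2 = _
      rw [← Category.assoc, comp_lift, whiskerLeft_fst,
        ← Category.assoc, whiskerLeft_sectionContraction, Category.assoc])
    (fun n κ => by
      refine Subtype.ext (Prod.ext ?_ rfl)
      change lift (sectionContraction i _ ≫ untwist hι κ.1.2 κ.1.1 (fst _ _) κ.2) (fst _ _) ≫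
        twist hι κ.1.2 = lift (snd _ _ ≫ SSet.yonedaEquiv.symm (SSet.yonedaEquiv
          (initialSimplex i n.unop ≫ untwist hι κ.1.2 κ.1.1 (fst _ _) κ.2))) (fst _ _) ≫
          twist hι κ.1.2
      rw [sectionContraction_zero, Equiv.symm_apply_apply, Category.assoc])
    (fun n κ => by
      refine Subtype.ext (Prod.ext ?_ rfl)
      change lift (sectionContraction i _ ≫ untwist hι κ.1.2 κ.1.1 (fst _ _) κ.2) (fst _ _) ≫
        twist hι κ.1.2 = κ.1.1
      rw [sectionContraction_one, Category.id_comp, lift_untwist_twist])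

end

section

/-! ### The columns of the double complex of a twisted product -/

section Columns

variable {A Γ : Type} [CommGroup A] [Group Γ] {ι : A →* Γ} (hι : ∀ a g, ι a * g = g * ι a)

lemma fibreRestriction_serreBase {i j : SimplexCategory} (f : j ⟶ i) (hf : f.toOrderHom 0 = 0)
    (n : SimplexCategoryᵒᵖ) (κ : (serreFibre (twistedProj ι) i).obj n) :
    (fibreRestriction hι j).app n ((serreBase (twistedProj ι) f).app n κ) =
      (fibreRestriction hι i).app n κ := by
  have h : untwist hι (SSet.stdSimplex.map f ≫ κ.1.2)
      ((SSet.stdSimplex.map f ▷ _) ≫ κ.1.1) (fst _ _)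
      ((serreBase (twistedProj ι) f).app n κ).2 =
      (SSet.stdSimplex.map f ▷ _) ≫ untwist hι κ.1.2 κ.1.1 (fst _ _) κ.2 := by
    have h' : ((SSet.stdSimplex.map f ▷ SSet.stdSimplex.obj n.unop) ≫ κ.1.1) ≫ twistedProj ι =
        (fst _ _ ≫ SSet.stdSimplex.map f) ≫ κ.1.2 := by
      rw [Category.assoc (fst _ _)]
      exact ((serreBase (twistedProj ι) f).app n κ).2
    exact (untwist_map_comp hι f hf κ.1.2 _ (fst _ _) _ h').trans
      (comp_untwist hι (SSet.stdSimplex.map f ▷ _) κ.1.2 κ.1.1 (fst _ _) κ.2 h')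
  refine (congrArg (fun u => SSet.yonedaEquiv (initialSimplex j n.unop ≫ u)) h).trans ?_
  refine congrArg SSet.yonedaEquiv ?_
  rw [← Category.assoc]
  refine congrArg (· ≫ _) ?_
  have hf' : SimplexCategory.const n.unop j 0 ≫ f = SimplexCategory.const n.unop i 0 := by
    ext l : 3
    exact hf
  change lift (SSet.stdSimplex.map _) (𝟙 _) ≫ (SSet.stdSimplex.map f ▷ _) =
    lift (SSet.stdSimplex.map _) (𝟙 _)
  rw [lift_whiskerRight, ← hf']
  rfl

/-- Since `Δ[0] × Δ[n]` is `Δ[n]`, every section over a vertex is constant. -/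
lemma fibreInclusion_fibreRestriction_zero
    (s : SSet.stdSimplex.{0}.obj ⦋0⦌ ⟶ doubleClassifyingSpace A)
    (n : SimplexCategoryᵒᵖ) (κ : (serreFibre (twistedProj ι) ⦋0⦌).obj n) (hs : κ.1.2 = s) :
    (fibreInclusion hι s).app n ((fibreRestriction hι ⦋0⦌).app n κ) = κ := by
  subst hs
  refine Subtype.ext (Prod.ext ?_ rfl)
  change lift (snd _ _ ≫ SSet.yonedaEquiv.symm (SSet.yonedaEquiv
    (initialSimplex ⦋0⦌ n.unop ≫ untwist hι κ.1.2 κ.1.1 (fst _ _) κ.2))) (fst _ _) ≫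
    twist hι κ.1.2 = κ.1.1
  have h : snd _ _ ≫ initialSimplex ⦋0⦌ n.unop = 𝟙 _ := by
    refine CartesianMonoidalCategory.hom_ext _ _ ?_ rfl
    ext
  rw [Equiv.symm_apply_apply, ← Category.assoc, h, Category.id_comp, lift_untwist_twist]

/-- A family of cochains on the fibre, as a cochain on the spaces of sections. -/
def sectionCochain {i : SimplexCategory} {n : ℕ}
    (b : (SSet.stdSimplex.{0}.obj i ⟶ doubleClassifyingSpace A) → classifyingSpace Γ _⦋n⦌ → ℚ) :
    serreFibre (twistedProj ι) i _⦋n⦌ → ℚ :=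
  fun κ => b κ.1.2 ((fibreRestriction hι i).app _ κ)

lemma coboundary_sectionCochain {i : SimplexCategory} {n : ℕ}
    (b : (SSet.stdSimplex.{0}.obj i ⟶ doubleClassifyingSpace A) → classifyingSpace Γ _⦋n⦌ → ℚ) :
    coboundary (serreFibre (twistedProj ι) i) n (sectionCochain hι b) =
      sectionCochain hι (fun s => coboundary (classifyingSpace Γ) n (b s)) := by
  refine funext fun κ => ?_
  rw [sectionCochain]
  simp only [coboundary, LinearMap.sum_apply, LinearMap.smul_apply, Finset.sum_apply,
    Pi.smul_apply, LinearMap.funLeft_apply]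
  refine Finset.sum_congr rfl fun k _ => congrArg (_ • b κ.1.2 ·) ?_
  exact SSet.δ_naturality_apply (fibreRestriction hι i) k κ

lemma sectionCochain_mem_coboundaries {i : SimplexCategory} {n : ℕ}
    {b : (SSet.stdSimplex.{0}.obj i ⟶ doubleClassifyingSpace A) → classifyingSpace Γ _⦋n⦌ → ℚ}
    (hb : ∀ s, b s ∈ coboundaries (classifyingSpace Γ) n) :
    sectionCochain hι b ∈ coboundaries (serreFibre (twistedProj ι) i) n := by
  cases n with
  | zero =>
    have : b = 0 := funext hb
    rw [this]
    exact Submodule.zero_mem _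
  | succ n =>
    choose b' hb' using hb
    exact ⟨sectionCochain hι b', by rw [coboundary_sectionCochain]; simp only [hb']⟩

/-- Restricting to constant sections and extending again is pull-back along `sectionRetraction`,
which is homotopic to the identity. -/
lemma sub_sectionCochain_mem {i : SimplexCategory} {n : ℕ}
    {c : serreFibre (twistedProj ι) i _⦋n⦌ → ℚ}
    (hc : c ∈ cocycles (serreFibre (twistedProj ι) i) n) :
    c - sectionCochain hι (fun s => cochainPullback (fibreInclusion hι s) n c) ∈
      coboundaries (serreFibre (twistedProj ι) i) n := by
  have h := Submodule.neg_mem _ (sub_mem_coboundaries_of_homotopy (sectionHomotopy hι i) hc)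
  rwa [neg_sub] at h

-- A column is, up to homotopy, a disjoint union of copies of `BΓ` indexed by the simplices of the
-- base, so vanishing of the cohomology of the fibre passes to it.
include hι in
lemma mem_coboundaries_of_fibre {i : SimplexCategory} {n : ℕ}
    (h : ∀ c ∈ cocycles (classifyingSpace Γ) n, c ∈ coboundaries (classifyingSpace Γ) n)
    {c : serreFibre (twistedProj ι) i _⦋n⦌ → ℚ}
    (hc : c ∈ cocycles (serreFibre (twistedProj ι) i) n) :
    c ∈ coboundaries (serreFibre (twistedProj ι) i) n := by
  have hadd := Submodule.add_mem _ (sub_sectionCochain_mem hι hc)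
    (sectionCochain_mem_coboundaries hι fun s => h _ (cochainPullback_mem_cocycles
      (fibreInclusion hι s) n c hc))
  rwa [sub_add_cancel] at hadd

/-- The product of a cochain on the base and a cochain on the fibre. -/
def productCochain {i n : ℕ} (y : doubleClassifyingSpace A _⦋i⦌ → ℚ)
    (m : classifyingSpace Γ _⦋n⦌ → ℚ) : serreFibre (twistedProj ι) ⦋i⦌ _⦋n⦌ → ℚ :=
  sectionCochain hι fun s => y (SSet.yonedaEquiv s) • m

lemma productCochain_sub {i n : ℕ} (y y' : doubleClassifyingSpace A _⦋i⦌ → ℚ)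
    (m : classifyingSpace Γ _⦋n⦌ → ℚ) :
    productCochain hι (y - y') m = productCochain hι y m - productCochain hι y' m := by
  refine funext fun κ => ?_
  simp [productCochain, sectionCochain, sub_mul]

/-- The value of `y` on a base simplex is the coefficient of `c` over that simplex. If `m`
represents a generator of the cohomology of the fibre, this and `eq_zero_of_productCochain_mem`
identify the `E₁` term in row `n` with the cochains of the base. -/
lemma exists_sub_productCochain_mem {i n : ℕ} {m : classifyingSpace Γ _⦋n⦌ → ℚ}
    (h : ∀ c ∈ cocycles (classifyingSpace Γ) n, ∃ r : ℚ,
      c - r • m ∈ coboundaries (classifyingSpace Γ) n)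
    {c : serreFibre (twistedProj ι) ⦋i⦌ _⦋n⦌ → ℚ}
    (hc : c ∈ cocycles (serreFibre (twistedProj ι) ⦋i⦌) n) :
    ∃ y, c - productCochain hι y m ∈ coboundaries (serreFibre (twistedProj ι) ⦋i⦌) n := by
  choose r hr using fun s => h _ (cochainPullback_mem_cocycles (fibreInclusion hι s) n c hc)
  refine ⟨fun a => r (SSet.yonedaEquiv.symm a), ?_⟩
  have h' := Submodule.add_mem _ (sub_sectionCochain_mem hι hc)
    (sectionCochain_mem_coboundaries hι hr)
  refine (congrArg (· ∈ coboundaries _ n) ?_).mp h'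
  refine funext fun κ => ?_
  simp [productCochain, sectionCochain]

lemma eq_zero_of_productCochain_mem {i n : ℕ} {m : classifyingSpace Γ _⦋n⦌ → ℚ}
    (hm : m ∉ coboundaries (classifyingSpace Γ) n) {y : doubleClassifyingSpace A _⦋i⦌ → ℚ}
    (h : productCochain hι y m ∈ coboundaries (serreFibre (twistedProj ι) ⦋i⦌) n) : y = 0 := by
  refine funext fun a => ?_
  have h' := cochainPullback_mem_coboundaries (fibreInclusion hι (SSet.yonedaEquiv.symm a)) n _ h
  by_contra hy
  refine hm ((Submodule.smul_mem_iff _ hy).1 ((congrArg (· ∈ coboundaries _ n) ?_).mp h'))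
  refine funext fun β => ?_
  change y (SSet.yonedaEquiv (SSet.yonedaEquiv.symm a)) *
    m ((fibreRestriction hι ⦋i⦌).app _ ((fibreInclusion hι _).app _ β)) = y a * m β
  rw [fibreRestriction_fibreInclusion, Equiv.apply_symm_apply]

/-- Restriction to the initial vertex does not change `fibreRestriction`, and by `hs` all the
initial vertices have the same image in the base, so that a single fibre is involved. -/
lemma crossCochain_eq_productCochain {i n : ℕ} (y : doubleClassifyingSpace A _⦋i⦌ → ℚ)
    (μ : serreFibre (twistedProj ι) ⦋0⦌ _⦋n⦌ → ℚ)
    (s : SSet.stdSimplex.{0}.obj ⦋0⦌ ⟶ doubleClassifyingSpace A)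
    (hs : ∀ s' : SSet.stdSimplex.{0}.obj ⦋0⦌ ⟶ doubleClassifyingSpace A, s' = s) :
    crossCochain (twistedProj ι) y μ =
      productCochain hι y (cochainPullback (fibreInclusion hι s) n μ) := by
  refine funext fun κ => ?_
  have h := fibreInclusion_fibreRestriction_zero hι s _
    ((serreBase (twistedProj ι) (SimplexCategory.const ⦋0⦌ ⦋i⦌ 0)).app _ κ) (hs _)
  rw [fibreRestriction_serreBase hι _ rfl] at h
  exact congrArg (fun a => y (SSet.yonedaEquiv κ.1.2) * μ a) h.symm

end Columns

/-! ### `B²A` has one vertex and one edge -/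

section Connectivity

variable {A : Type} [CommGroup A]

lemma doubleClassifyingSpace_apply_eq_one {n : SimplexCategoryᵒᵖ}
    (a : (doubleClassifyingSpace A).obj n) (τ : ⦋2⦌ ⟶ n.unop)
    (hτ : τ.toOrderHom 0 = τ.toOrderHom 1 ∨ τ.toOrderHom 1 = τ.toOrderHom 2) : a.1 τ = 1 := by
  rcases hτ with h | h
  · have : τ = SimplexCategory.σ 0 ≫ SimplexCategory.δ 0 ≫ τ := by
      ext l : 3
      fin_cases l
      · exact h
      · rfl
      · rfl
    rw [this]
    exact a.2.1 0 _
  · have : τ = SimplexCategory.σ 1 ≫ SimplexCategory.δ 2 ≫ τ := by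
      ext l : 3
      fin_cases l
      · rfl
      · rfl
      · exact h.symm
    rw [this]
    exact a.2.1 1 _

/-- A monotone map from `⦋2⦌` to `⦋1⦌` repeats a vertex, and the cocycles are normalised. This
strict form of simple connectivity makes the coefficients in the spectral sequence untwisted. -/
instance subsingleton_doubleClassifyingSpace_one :
    Subsingleton (doubleClassifyingSpace A _⦋1⦌) where
  allEq a b := by
    refine Subtype.ext (funext fun τ => ?_)
    have h : τ.toOrderHom 0 = τ.toOrderHom 1 ∨ τ.toOrderHom 1 = τ.toOrderHom 2 := by
      have h₁ := τ.toOrderHom.monotone (show (0 : Fin 3) ≤ 1 by decide)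
      have h₂ := τ.toOrderHom.monotone (show (1 : Fin 3) ≤ 2 by decide)
      generalize τ.toOrderHom 0 = i, τ.toOrderHom 1 = j, τ.toOrderHom 2 = k at h₁ h₂
      change Fin 2 at i j k
      change i = j ∨ j = k
      change i ≤ j at h₁
      change j ≤ k at h₂
      revert i j k
      decide
    rw [doubleClassifyingSpace_apply_eq_one a τ h, doubleClassifyingSpace_apply_eq_one b τ h]

instance subsingleton_doubleClassifyingSpace_zero :
    Subsingleton (doubleClassifyingSpace A _⦋0⦌) where
  allEq a b := by
    refine Subtype.ext (funext fun τ => ?_)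
    have h : τ.toOrderHom 0 = τ.toOrderHom 1 := Subsingleton.elim (α := Fin 1) _ _
    rw [doubleClassifyingSpace_apply_eq_one a τ (.inl h),
      doubleClassifyingSpace_apply_eq_one b τ (.inl h)]

end Connectivity

/-! ### The first differential of the spectral sequence -/

section Transport

lemma coboundary_apply (X : SSet.{0}) (n : ℕ) (c : X _⦋n⦌ → ℚ) (x : X _⦋n + 1⦌) :
    coboundary X n c x = ∑ i : Fin (n + 2), (-1 : ℚ) ^ (i : ℕ) * c (X.δ i x) := by
  simp [coboundary, LinearMap.funLeft_apply]

lemma coboundaryBase_apply {X Y : SSet.{0}} (p : X ⟶ Y) (m n : ℕ)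
    (c : serreFibre p ⦋m⦌ _⦋n⦌ → ℚ) (κ : serreFibre p ⦋m + 1⦌ _⦋n⦌) :
    coboundaryBase p m n c κ = ∑ i : Fin (m + 2), (-1 : ℚ) ^ (i : ℕ) *
      c ((serreBase p (SimplexCategory.δ i)).app (op ⦋n⦌) κ) := by
  simp [coboundaryBase, LinearMap.funLeft_apply]

variable {X Y : SSet.{0}} (p : X ⟶ Y)

/-- Faces in the fibre direction do not change the base simplex, so multiplication by a function of
it commutes with the coboundary. -/
lemma mul_mem_coboundaries {i : SimplexCategory} {n : ℕ} (f : (SSet.stdSimplex.{0}.obj i ⟶ Y) → ℚ)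
    {c : serreFibre p i _⦋n⦌ → ℚ} (hc : c ∈ coboundaries (serreFibre p i) n) :
    (fun κ => f κ.1.2 * c κ) ∈ coboundaries (serreFibre p i) n := by
  cases n with
  | zero =>
    have : c = 0 := hc
    subst this
    simp only [Pi.zero_apply, mul_zero]
    exact Submodule.zero_mem _
  | succ n =>
    obtain ⟨b, rfl⟩ := hc
    refine ⟨fun κ => f κ.1.2 * b κ, funext fun κ => ?_⟩
    simp only [coboundary, LinearMap.sum_apply, LinearMap.smul_apply, Finset.sum_apply,
      Pi.smul_apply, LinearMap.funLeft_apply, Finset.mul_sum, smul_eq_mul]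
    exact Finset.sum_congr rfl fun k _ => mul_left_comm _ _ _

lemma stdSimplex_hom_ext_of_subsingleton {n : ℕ} [Subsingleton (Y _⦋n⦌)]
    (s s' : SSet.stdSimplex.{0}.obj ⦋n⦌ ⟶ Y) : s = s' :=
  SSet.yonedaEquiv.injective (Subsingleton.elim _ _)

/-- The only edge of `Y` is the degenerate one, so an edge of `s` is constant. -/
lemma edge_comp_eq [Subsingleton (Y _⦋1⦌)] {i : ℕ} (e : ⦋1⦌ ⟶ ⦋i⦌) (v : ⦋0⦌ ⟶ ⦋i⦌) {Z : SSet.{0}}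
    (s : SSet.stdSimplex.{0}.obj ⦋i⦌ ⟶ Y)
    (u : Z ⟶ SSet.stdSimplex.{0}.obj ⦋1⦌) (w : Z ⟶ SSet.stdSimplex.{0}.obj ⦋0⦌) :
    u ≫ SSet.stdSimplex.map e ≫ s = w ≫ SSet.stdSimplex.map v ≫ s := by
  have h : SSet.stdSimplex.map e ≫ s =
      SSet.stdSimplex.map (SimplexCategory.const ⦋1⦌ ⦋0⦌ 0) ≫ SSet.stdSimplex.map v ≫ s :=
    stdSimplex_hom_ext_of_subsingleton _ _
  have hu : u ≫ SSet.stdSimplex.map (SimplexCategory.const ⦋1⦌ ⦋0⦌ 0) = w := by ext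
  rw [h, ← Category.assoc, hu]

/-- The restrictions of the sections over a simplex to its vertices `0` and `1` are homotopic
if the base has only one edge. -/
def vertexHomotopy [Subsingleton (Y _⦋1⦌)] [Subsingleton (Y _⦋0⦌)] (i : ℕ) :
    SSet.Homotopy (serreBase p (SimplexCategory.const ⦋0⦌ ⦋i + 1⦌ 0))
      (serreBase p (SimplexCategory.const ⦋0⦌ ⦋i + 1⦌ 1)) :=
  homotopyOfFamily _ _
    (fun n κ t => ⟨(lift (snd _ _ ≫ SSet.stdSimplex.map (t ≫ SimplexCategory.mkOfSucc 0))
        (snd _ _) ≫ κ.1.1,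
        SSet.stdSimplex.map (SimplexCategory.const ⦋0⦌ ⦋i + 1⦌ 0) ≫ κ.1.2), by
      have h := SSet.stdSimplex.{0}.map_comp t (SimplexCategory.mkOfSucc (0 : Fin (i + 1)))
      rw [Category.assoc, κ.2, lift_fst_assoc, h, ← Category.assoc (snd _ _), Category.assoc]
      exact edge_comp_eq _ _ _ _ _⟩)
    (fun {n n'} φ κ t => by
      refine Subtype.ext (Prod.ext ?_ rfl)
      have h := SSet.stdSimplex.{0}.map_comp φ.unop (t ≫ SimplexCategory.mkOfSucc (0 : Fin (i + 1)))
      change (_ ◁ SSet.stdSimplex.map φ.unop) ≫ lift _ _ ≫ κ.1.1 =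
        lift _ _ ≫ (_ ◁ SSet.stdSimplex.map φ.unop) ≫ κ.1.1
      simp only [← Category.assoc]
      refine congrArg (· ≫ κ.1.1) ?_
      rw [lift_whiskerLeft, Category.assoc φ.unop, h, comp_lift]
      rfl)
    (fun n κ => by
      refine Subtype.ext (Prod.ext ?_ rfl)
      refine congrArg (· ≫ κ.1.1) ?_
      refine CartesianMonoidalCategory.hom_ext _ _ ?_ ?_
      · have h : SimplexCategory.const n.unop ⦋1⦌ 0 ≫ SimplexCategory.mkOfSucc (0 : Fin (i + 1)) =
          SimplexCategory.const n.unop ⦋0⦌ 0 ≫ SimplexCategory.const ⦋0⦌ ⦋i + 1⦌ 0 := rfl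
        have h' := SSet.stdSimplex.{0}.map_comp (SimplexCategory.const n.unop ⦋0⦌ 0)
          (SimplexCategory.const ⦋0⦌ ⦋i + 1⦌ 0)
        rw [lift_fst, h, h', ← Category.assoc, whiskerRight_fst]
        refine congrArg (· ≫ SSet.stdSimplex.map _) ?_
        ext
      · rw [lift_snd, whiskerRight_snd])
    (fun n κ => by
      refine Subtype.ext (Prod.ext ?_ (stdSimplex_hom_ext_of_subsingleton _ _))
      refine congrArg (· ≫ κ.1.1) ?_
      refine CartesianMonoidalCategory.hom_ext _ _ ?_ ?_
      · have h : SimplexCategory.const n.unop ⦋1⦌ 1 ≫ SimplexCategory.mkOfSucc (0 : Fin (i + 1)) =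
          SimplexCategory.const n.unop ⦋0⦌ 0 ≫ SimplexCategory.const ⦋0⦌ ⦋i + 1⦌ 1 := rfl
        have h' := SSet.stdSimplex.{0}.map_comp (SimplexCategory.const n.unop ⦋0⦌ 0)
          (SimplexCategory.const ⦋0⦌ ⦋i + 1⦌ 1)
        rw [lift_fst, h, h', ← Category.assoc, whiskerRight_fst]
        refine congrArg (· ≫ SSet.stdSimplex.map _) ?_
        ext
      · rw [lift_snd, whiskerRight_snd])

/-- All faces except face 0 preserve the initial vertex, where `μ` is evaluated. The Leibniz rule
thus fails only in the term of face 0, which reads `μ` at vertex 1 instead of vertex 0. -/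
lemma coboundaryBase_crossCochain_sub {i n : ℕ} (y : Y _⦋i⦌ → ℚ)
    (μ : serreFibre p ⦋0⦌ _⦋n⦌ → ℚ) (κ : serreFibre p ⦋i + 1⦌ _⦋n⦌) :
    (coboundaryBase p i n (crossCochain p y μ) - crossCochain p (coboundary Y i y) μ) κ =
      -(y (SSet.yonedaEquiv (SSet.stdSimplex.map (SimplexCategory.δ 0) ≫ κ.1.2)) *
        (μ ((serreBase p (SimplexCategory.const ⦋0⦌ ⦋i + 1⦌ 0)).app (op ⦋n⦌) κ) -
          μ ((serreBase p (SimplexCategory.const ⦋0⦌ ⦋i + 1⦌ 1)).app (op ⦋n⦌) κ))) := by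
  have key (k : Fin (i + 1)) :
      (serreBase p (SimplexCategory.const ⦋0⦌ ⦋i⦌ 0)).app (op ⦋n⦌)
      ((serreBase p (SimplexCategory.δ k.succ)).app (op ⦋n⦌) κ) =
      (serreBase p (SimplexCategory.const ⦋0⦌ ⦋i + 1⦌ 0)).app (op ⦋n⦌) κ := rfl
  have key₀ :
      (serreBase p (SimplexCategory.const ⦋0⦌ ⦋i⦌ 0)).app (op ⦋n⦌)
      ((serreBase p (SimplexCategory.δ 0)).app (op ⦋n⦌) κ) =
      (serreBase p (SimplexCategory.const ⦋0⦌ ⦋i + 1⦌ 1)).app (op ⦋n⦌) κ := rfl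
  have hy (k : Fin (i + 2)) : Y.δ k (SSet.yonedaEquiv κ.1.2) =
    SSet.yonedaEquiv (SSet.stdSimplex.map (SimplexCategory.δ k) ≫ κ.1.2) :=
    SSet.yonedaEquiv_naturality (SimplexCategory.δ k) κ.1.2
  have hb (k : Fin (i + 2)) : ((serreBase p (SimplexCategory.δ k)).app (op ⦋n⦌) κ).1.2 =
    SSet.stdSimplex.map (SimplexCategory.δ k) ≫ κ.1.2 := rfl
  rw [Pi.sub_apply, coboundaryBase_apply, Fin.sum_univ_succ]
  simp only [crossCochain, key]
  rw [key₀, coboundary_apply, Fin.sum_univ_succ (fun k : Fin (i + 2) =>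
    (-1 : ℚ) ^ (k : ℕ) * y (Y.δ k (SSet.yonedaEquiv κ.1.2)))]
  simp only [hy, hb, add_mul,
    Finset.sum_mul, mul_assoc]
  rw [add_sub_add_comm, sub_self]
  simp
  ring

/-- By `vertexHomotopy` the defect is a vertical coboundary, so on `E₁` the horizontal differential
is the coboundary of the base. -/
lemma coboundaryBase_crossCochain_sub_mem [Subsingleton (Y _⦋1⦌)] [Subsingleton (Y _⦋0⦌)]
    {i n : ℕ} (y : Y _⦋i⦌ → ℚ) {μ : serreFibre p ⦋0⦌ _⦋n⦌ → ℚ}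
    (hμ : μ ∈ cocycles (serreFibre p ⦋0⦌) n) :
    coboundaryBase p i n (crossCochain p y μ) - crossCochain p (coboundary Y i y) μ ∈
      coboundaries (serreFibre p ⦋i + 1⦌) n := by
  have h := Submodule.neg_mem _ (mul_mem_coboundaries p
    (fun s => y (SSet.yonedaEquiv (SSet.stdSimplex.map (SimplexCategory.δ 0) ≫ s)))
    (sub_mem_coboundaries_of_homotopy (vertexHomotopy p i) hμ))
  exact (congrArg (· ∈ coboundaries _ n)
    (funext fun κ => (coboundaryBase_crossCochain_sub p y μ κ).symm)).mp h

end Transport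

end

section

/-! ### The total complex and the cochains of the total space -/

section Total

variable {X Y : SSet.{0}} (p : X ⟶ Y)

/-- The inclusion of the total space as the bottom row of Dress's bisimplicial set. -/
def serreTotalMap : X ⟶ serreRow p (op ⦋0⦌) where
  app m := ↾fun x => ⟨(fst _ _ ≫ SSet.yonedaEquiv.symm x, SSet.yonedaEquiv.symm x ≫ p),
    Category.assoc _ _ _⟩
  naturality m m' f := by
    refine ConcreteCategory.hom_ext _ _ fun x => Subtype.ext (Prod.ext ?_ ?_)
    · change fst _ _ ≫ SSet.yonedaEquiv.symm (X.map f x) =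
        (SSet.stdSimplex.map f.unop ▷ _) ≫ fst _ _ ≫ SSet.yonedaEquiv.symm x
      rw [whiskerRight_fst_assoc]
      exact congrArg (fst _ _ ≫ ·) (SSet.yonedaEquiv_symm_naturality_left f.unop x).symm
    · change SSet.yonedaEquiv.symm (X.map f x) ≫ p =
        SSet.stdSimplex.map f.unop ≫ SSet.yonedaEquiv.symm x ≫ p
      rw [← Category.assoc]
      exact congrArg (· ≫ p) (SSet.yonedaEquiv_symm_naturality_left f.unop x).symm

/-- The bottom row of Dress's bisimplicial set is the total space. -/
def serreEval : serreRow p (op ⦋0⦌) ⟶ X where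
  app m := ↾fun κ => SSet.yonedaEquiv
    (lift (𝟙 _) (SSet.stdSimplex.map (SimplexCategory.const m.unop ⦋0⦌ 0)) ≫ κ.1.1)
  naturality m m' f := by
    refine ConcreteCategory.hom_ext _ _ fun κ => ?_
    refine Eq.trans ?_ (SSet.yonedaEquiv_naturality f.unop _).symm
    change SSet.yonedaEquiv (_ ≫ (SSet.stdSimplex.map f.unop ▷ _) ≫ κ.1.1) = _
    refine congrArg SSet.yonedaEquiv ?_
    rw [← Category.assoc, ← Category.assoc]
    refine congrArg (· ≫ κ.1.1) ?_
    refine CartesianMonoidalCategory.hom_ext _ _ ?_ ?_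
    · simp
    · ext

lemma serreEval_serreTotalMap (m : SimplexCategoryᵒᵖ) (x : X.obj m) :
    (serreEval p).app m ((serreTotalMap p).app m x) = x := by
  change SSet.yonedaEquiv (lift (𝟙 _) _ ≫ fst _ _ ≫ SSet.yonedaEquiv.symm x) = x
  rw [lift_fst_assoc, Category.id_comp, Equiv.apply_symm_apply]

end Total

/-! ### Leading terms in the double complex of a twisted product -/

section NormalForm

variable {A Γ : Type} [CommGroup A] [Group Γ] {ι : A →* Γ} (hι : ∀ a g, ι a * g = g * ι a)

/-- The base point of `B²A`. -/
abbrev basePoint (A : Type) [CommGroup A] :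
    SSet.stdSimplex.{0}.obj ⦋0⦌ ⟶ doubleClassifyingSpace A :=
  SSet.yonedaEquiv.symm ⟨fun _ => 1, fun _ _ => rfl, fun _ => rfl⟩

lemma fibreRestriction_basePoint_fibreInclusion (n : SimplexCategoryᵒᵖ)
    (κ : (serreFibre (twistedProj ι) ⦋0⦌).obj n) :
    (fibreInclusion hι (basePoint A)).app n ((fibreRestriction hι ⦋0⦌).app n κ) = κ :=
  fibreInclusion_fibreRestriction_zero hι _ n κ (stdSimplex_hom_ext_of_subsingleton _ _)

lemma coboundaryBase_productCochain_sub_mem {i n : ℕ} (y : doubleClassifyingSpace A _⦋i⦌ → ℚ)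
    {m : classifyingSpace Γ _⦋n⦌ → ℚ} (hm : m ∈ cocycles (classifyingSpace Γ) n) :
    coboundaryBase (twistedProj ι) i n (productCochain hι y m) -
        productCochain hι (coboundary _ i y) m ∈
      coboundaries (serreFibre (twistedProj ι) ⦋i + 1⦌) n := by
  have h := coboundaryBase_crossCochain_sub_mem (twistedProj ι) y
    (cochainPullback_mem_cocycles (fibreRestriction hι ⦋0⦌) n m hm)
  have h' : cochainPullback (fibreInclusion hι (basePoint A)) n
      (cochainPullback (fibreRestriction hι ⦋0⦌) n m) = m :=
    funext fun x => congrArg m (fibreRestriction_fibreInclusion hι _ _ x)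
  rw [crossCochain_eq_productCochain hι _ _ (basePoint A)
    fun _ => stdSimplex_hom_ext_of_subsingleton _ _,
    crossCochain_eq_productCochain hι _ _ (basePoint A)
    fun _ => stdSimplex_hom_ext_of_subsingleton _ _, h'] at h
  exact h

variable (ι) in
/-- The double complex of cochains of a twisted product. -/
abbrev twistedDouble : DoubleComplex := serreDouble (twistedProj ι)

/-- The leading term of an element of the total complex, when the cohomology of the fibre vanishes
above degree `d` and is spanned by `m` in degree `d`. -/
lemma exists_sub_tot_eq_productCochain {d s : ℕ} {m : classifyingSpace Γ _⦋d⦌ → ℚ}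
    (hvan : ∀ n, d < n → cocycles (classifyingSpace Γ) n ≤ coboundaries (classifyingSpace Γ) n)
    (hspan : ∀ c ∈ cocycles (classifyingSpace Γ) d, ∃ r : ℚ,
      c - r • m ∈ coboundaries (classifyingSpace Γ) d)
    {t : ∀ i n, (twistedDouble ι).C i n}
    (ht : (twistedDouble ι).IsHomogeneous (s + d) t)
    (ht' : ∀ i < s, ∀ n, (twistedDouble ι).tot t i n = 0)
    (ht'' : (twistedDouble ι).tot t s (d + 1) = 0) :
    ∃ w, (∀ i n, i + n + 1 ≠ s + d → w i n = 0) ∧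
      (∀ i < s, ∀ n, (t - (twistedDouble ι).tot w) i n = 0) ∧
      ∃ y, (t - (twistedDouble ι).tot w) s d = productCochain hι y m := by
  -- The columns are exact above row `d`, so everything to the left of column `s` can be removed.
  obtain ⟨w₁, hw₁, htw₁⟩ := DoubleComplex.exists_sub_tot (d := d) (s := s) (fun i n hn c hc =>
    (serreDouble_dv_mem _).2 (mem_coboundaries_of_fibre hι (hvan _ (by omega))
      ((serreDouble_dv_eq_zero _).1 hc))) ht ht'
  have hcoc : (twistedDouble ι).dv s d ((t - (twistedDouble ι).tot w₁) s d) = 0 := by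
    rw [← sub_zero ((twistedDouble ι).tot t), ← DoubleComplex.tot_tot w₁,
      ← DoubleComplex.tot_sub] at ht''
    cases s with
    | zero => exact ht''
    | succ s =>
      simp only [DoubleComplex.tot] at ht''
      rwa [htw₁ s (by omega), map_zero, zero_add] at ht''
  -- The entry at `(s, d)` is now a vertical cocycle, hence `y × m` up to a vertical coboundary. One
  -- more total coboundary absorbs the latter; for `d = 0` it is zero.
  obtain ⟨y, hy⟩ := exists_sub_productCochain_mem hι hspan ((serreDouble_dv_eq_zero _).1 hcoc)
  cases d with
  | zero => exact ⟨w₁, hw₁, htw₁, y, sub_eq_zero.1 hy⟩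
  | succ d =>
    obtain ⟨b, hb⟩ := (serreDouble_dv_mem _).2 hy
    refine ⟨w₁ + DoubleComplex.single (D := twistedDouble ι) s d b, fun i n hin => ?_,
      fun i hi n => ?_, y, ?_⟩
    · have := DoubleComplex.isHomogeneous_single (N := s + d) rfl b i n (by omega)
      simp only [Pi.add_apply, this, hw₁ i n hin, add_zero]
    · rw [DoubleComplex.tot_add, ← sub_sub]
      refine (congrArg₂ (· - ·) (htw₁ i hi n) (DoubleComplex.tot_single_of_lt b hi)).trans
        (sub_zero _)
    · rw [DoubleComplex.tot_add, ← sub_sub]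
      refine (congrArg ((t - (twistedDouble ι).tot w₁) s (d + 1) - ·)
        (DoubleComplex.tot_single_up s d b)).trans ?_
      rw [hb]
      exact sub_sub_cancel _ _

/-- Modulo vertical coboundaries the total differential at `(s + 1, d)` only sees the leading term.
With `c = 0` this shows that leading coefficients of total cocycles are cocycles; with `c` a product
cochain it produces primitives. -/
lemma productCochain_coboundary_sub_tot_mem {d s : ℕ} {m : classifyingSpace Γ _⦋d⦌ → ℚ}
    (hm : m ∈ cocycles (classifyingSpace Γ) d) {t : ∀ i n, (twistedDouble ι).C i n}
    {y : doubleClassifyingSpace A _⦋s⦌ → ℚ} (ht : t s d = productCochain hι y m)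
    {c : serreFibre (twistedProj ι) ⦋s + 1⦌ _⦋d⦌ → ℚ}
    (hc : (twistedDouble ι).tot t (s + 1) d = c) :
    productCochain hι (coboundary _ s y) m - c ∈
      coboundaries (serreFibre (twistedProj ι) ⦋s + 1⦌) d := by
  subst hc
  have h₁ : (twistedDouble ι).dh s d (t s d) - (twistedDouble ι).tot t (s + 1) d ∈
      coboundaries (serreFibre (twistedProj ι) ⦋s + 1⦌) d := by
    cases d with
    | zero => exact (sub_eq_zero.2 rfl : (twistedDouble ι).dh s 0 (t s 0) - _ = 0)
    | succ d =>
      refine (serreDouble_dv_mem _).1 ⟨- t (s + 1) d, ?_⟩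
      rw [map_neg]
      exact (sub_add_cancel_left _ _).symm
  rw [ht] at h₁
  have h₂ := Submodule.sub_mem _ h₁ (coboundaryBase_productCochain_sub_mem hι y hm)
  refine (congrArg (· ∈ coboundaries _ d) ?_).mp h₂
  exact sub_sub_sub_cancel_left _ _ _

end NormalForm

/-! ### Totality of the Gysin relation -/

section Existence

variable {A Γ : Type} [CommGroup A] [Group Γ] {ι : A →* Γ} (hι : ∀ a g, ι a * g = g * ι a)

lemma cohomologyClass_eq_zero {X : SSet.{0}} {n : ℕ} (c : cocycles X n) :
    cohomologyClass X n c = 0 ↔ c.1 ∈ coboundaries X n :=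
  Submodule.Quotient.mk_eq_zero _

lemma cohomologyClass_eq_iff {X : SSet.{0}} {n : ℕ} (c c' : cocycles X n) :
    cohomologyClass X n c = cohomologyClass X n c' ↔ c.1 - c'.1 ∈ coboundaries X n :=
  Submodule.Quotient.eq _

lemma coboundaries_le_cocycles (X : SSet.{0}) (n : ℕ) : coboundaries X n ≤ cocycles X n := by
  cases n with
  | zero => exact bot_le
  | succ n =>
    rintro _ ⟨b, rfl⟩
    exact coboundary_coboundary X n b

include hι in
lemma cochainPullback_fibreInclusion_notMem {n : ℕ}
    {μ : serreFibre (twistedProj ι) ⦋0⦌ _⦋n⦌ → ℚ}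
    (hμ : μ ∉ coboundaries (serreFibre (twistedProj ι) ⦋0⦌) n) :
    cochainPullback (fibreInclusion hι (basePoint A)) n μ ∉
      coboundaries (classifyingSpace Γ) n := by
  intro h
  refine hμ ((congrArg (· ∈ coboundaries _ n) (funext fun κ => ?_)).mp
    (cochainPullback_mem_coboundaries (fibreRestriction hι ⦋0⦌) n _ h))
  exact congrArg μ (fibreRestriction_basePoint_fibreInclusion hι _ κ)

lemma exists_sub_smul_mem {d : ℕ} (μ : cocycles (serreFibre (twistedProj ι) ⦋0⦌) d)
    (hspan : Submodule.span ℚ {cohomologyClass _ _ μ} = ⊤) :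
    ∀ c ∈ cocycles (classifyingSpace Γ) d, ∃ r : ℚ,
      c - r • cochainPullback (fibreInclusion hι (basePoint A)) d μ.1 ∈
        coboundaries (classifyingSpace Γ) d := by
  intro c hc
  have h : cohomologyClass _ d ⟨_, cochainPullback_mem_cocycles (fibreRestriction hι ⦋0⦌) d c hc⟩ ∈
    Submodule.span ℚ {cohomologyClass _ _ μ} := hspan ▸ Submodule.mem_top
  obtain ⟨r, hr⟩ := Submodule.mem_span_singleton.1 h
  refine ⟨r, ?_⟩
  rw [← map_smul, eq_comm, cohomologyClass_eq_iff] at hr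
  refine (congrArg (· ∈ coboundaries _ d) (funext fun x => ?_)).mp
    (cochainPullback_mem_coboundaries (fibreInclusion hι (basePoint A)) d _ hr)
  exact congrArg (fun a => c a - r * μ.1 ((fibreInclusion hι (basePoint A)).app _ x))
    (fibreRestriction_fibreInclusion hι _ _ x)

include hι in
/-- The Gysin map of a twisted product is defined everywhere. -/
lemma exists_isGysin {d : ℕ} (hvan : ∀ n, d < n → cocycles (classifyingSpace Γ) n ≤
      coboundaries (classifyingSpace Γ) n)
    {μ : Cohomology (serreFibre (twistedProj ι) ⦋0⦌) d} (hμ : μ ≠ 0)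
    (hspan : Submodule.span ℚ {μ} = ⊤) {s : ℕ} (x : Cohomology (twistedSpace ι) (s + d)) :
    ∃ y, IsGysin (twistedProj ι) μ x y := by
  obtain ⟨μ, rfl⟩ := Submodule.mkQ_surjective _ μ
  obtain ⟨x, rfl⟩ := Submodule.mkQ_surjective _ x
  change cohomologyClass _ _ μ ≠ 0 at hμ
  rw [Ne, cohomologyClass_eq_zero] at hμ
  -- The cocycle `x`, placed in the bottom row, extends to a total cocycle, which is then brought to
  -- the form with leading term `y × μ`.
  obtain ⟨z, hz, hz', hzx⟩ := (serreRowContraction (twistedProj ι)).exists_tot_eq_zero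
    (N := s + d) (x := cochainPullback (serreEval (twistedProj ι)) (s + d) x.1)
    (cochainPullback_mem_cocycles (serreEval (twistedProj ι)) _ x.1 x.2)
  obtain ⟨w, hw, hwz, y, hwy⟩ := exists_sub_tot_eq_productCochain hι hvan
    (exists_sub_smul_mem hι μ hspan) hz (fun i _ n => by rw [hz']; rfl) (by rw [hz']; rfl)
  set u := z - (twistedDouble ι).tot w with hu
  have hut : (twistedDouble ι).tot u = 0 := by
    rw [hu, DoubleComplex.tot_sub, DoubleComplex.tot_tot, sub_zero]
    exact hz'
  have hy : y ∈ cocycles (doubleClassifyingSpace A) s := by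
    have h := productCochain_coboundary_sub_tot_mem hι
      (cochainPullback_mem_cocycles (fibreInclusion hι (basePoint A)) d μ.1 μ.2) hwy
      (congrFun (congrFun hut (s + 1)) d)
    exact eq_zero_of_productCochain_mem hι (cochainPullback_fibreInclusion_notMem hι hμ)
      ((congrArg (· ∈ coboundaries _ d) (sub_zero _)).mp h)
  -- Subtracting a total coboundary changes the bottom entry by a horizontal coboundary, so the
  -- class of `x` is unaffected.
  have hx : cochainPullback (serreTotalMap (twistedProj ι)) (s + d) (u (s + d) 0) - x.1 ∈
      coboundaries (twistedSpace ι) (s + d) := by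
    have h₁ : cochainPullback (serreTotalMap (twistedProj ι)) (s + d) (z (s + d) 0) = x.1 := by
      rw [hzx]
      exact funext fun e => congrArg x.1 (serreEval_serreTotalMap _ _ e)
    rw [← h₁]
    refine cochainPullback_mem_coboundaries (serreTotalMap (twistedProj ι)) _
      (u (s + d) 0 - z (s + d) 0) ?_
    change (z (s + d) 0 - (twistedDouble ι).tot w (s + d) 0) - z (s + d) 0 ∈ _
    rw [sub_sub_cancel_left]
    refine Submodule.neg_mem _ ?_
    rw [← serreDouble_hBoundaries]
    generalize s + d = N at w ⊢
    cases N with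
    | zero => exact Submodule.zero_mem _
    | succ N => exact ⟨_, rfl⟩
  refine ⟨cohomologyClass _ _ ⟨y, hy⟩, μ, ⟨y, hy⟩,
    ⟨cochainPullback (serreTotalMap (twistedProj ι)) (s + d) (u (s + d) 0), ?_⟩,
    fun i n => u (s + i) n, rfl, rfl, ?_, ?_, ?_, ?_, ?_, rfl⟩
  · have := Submodule.add_mem _ (coboundaries_le_cocycles _ _ hx) x.2
    rwa [sub_add_cancel] at this
  · exact (cohomologyClass_eq_iff _ _).2 hx
  · refine (serreDouble_dv_eq_zero (twistedProj ι)).1 ?_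
    have := congrFun (congrFun hut s) (d + 1)
    cases s with
    | zero => exact this
    | succ s =>
      simp only [DoubleComplex.tot] at this
      rwa [hwz s (by omega), map_zero, zero_add] at this
  · intro i n hin
    exact congrFun (congrFun hut (s + i + 1)) (n + 1)
  · exact congrFun (congrFun hut (s + d + 1)) 0
  · rw [crossCochain_eq_productCochain hι _ _ (basePoint A)
      fun _ => stdSimplex_hom_ext_of_subsingleton _ _]
    exact hwy

end Existence

end

section

/-! ### Naturality of the Gysin map -/

section Naturality

variable {X X' Y Y' : SSet.{0}} {p : X ⟶ Y} {p' : X' ⟶ Y'} (f : X' ⟶ X) (g : Y' ⟶ Y)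
  (hfg : p' ≫ g = f ≫ p)

/-- The map of Dress's bisimplicial sets induced by a commutative square. -/
def serreFibreMap (m : SimplexCategory) : serreFibre p' m ⟶ serreFibre p m where
  app n := ↾fun κ => ⟨(κ.1.1 ≫ f, κ.1.2 ≫ g), by
    rw [Category.assoc, ← hfg, ← Category.assoc, κ.2, Category.assoc]⟩

lemma coboundaryBase_cochainPullback_serreFibreMap (m n : ℕ) (c : serreFibre p ⦋m⦌ _⦋n⦌ → ℚ) :
    coboundaryBase p' m n (cochainPullback (serreFibreMap f g hfg ⦋m⦌) n c) =
      cochainPullback (serreFibreMap f g hfg ⦋m + 1⦌) n (coboundaryBase p m n c) := by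
  refine funext fun κ => ?_
  rw [coboundaryBase_apply]
  exact (coboundaryBase_apply p m n c ((serreFibreMap f g hfg ⦋m + 1⦌).app _ κ)).symm

lemma serreFibreMap_serreTotal (m : ℕ) (x : X' _⦋m⦌) :
    (serreFibreMap f g hfg ⦋m⦌).app _ (serreTotal p' m x) =
      serreTotal p m (f.app (op ⦋m⦌) x) := by
  have h : SSet.yonedaEquiv.symm x ≫ f = SSet.yonedaEquiv.symm (f.app (op ⦋m⦌) x) := by
    refine SSet.yonedaEquiv.injective ?_
    rw [SSet.yonedaEquiv_comp, Equiv.apply_symm_apply, Equiv.apply_symm_apply]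
  refine Subtype.ext (Prod.ext ?_ ?_)
  · exact congrArg (fst _ _ ≫ ·) h
  · refine (Category.assoc _ _ _).trans ?_
    rw [hfg, ← Category.assoc, h]
    rfl

/-- All clauses of `IsGysin` are equations between cochains, so the whole witness can be pulled
back. -/
lemma IsGysin.cohomologyMap {d s : ℕ} {μ : Cohomology (serreFibre p ⦋0⦌) d}
    {x : Cohomology X (s + d)} {y : Cohomology Y s} (h : IsGysin p μ x y) :
    IsGysin p' (cohomologyMap (serreFibreMap f g hfg ⦋0⦌) d μ)
      (OscarTrick.cohomologyMap f (s + d) x) (OscarTrick.cohomologyMap g s y) := by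
  obtain ⟨μ, y, x, z, rfl, rfl, rfl, h₁, h₂, h₃, h₄, h₅⟩ := h
  refine ⟨⟨_, cochainPullback_mem_cocycles _ d μ.1 μ.2⟩,
    ⟨_, cochainPullback_mem_cocycles g s y.1 y.2⟩,
    ⟨_, cochainPullback_mem_cocycles f (s + d) x.1 x.2⟩,
    fun i n => cochainPullback (serreFibreMap f g hfg _) n (z i n), rfl, rfl, rfl, ?_, ?_, ?_, ?_,
    ?_⟩
  · refine (coboundary_cochainPullback (serreFibreMap f g hfg ⦋s⦌) d (z 0 d)).trans ?_
    rw [h₁, map_zero]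
  · intro i n hin
    rw [coboundaryBase_cochainPullback_serreFibreMap, coboundary_cochainPullback]
    exact congrArg (cochainPullback (serreFibreMap f g hfg ⦋s + i + 1⦌) (n + 1)) (h₂ i n hin)
  · rw [coboundaryBase_cochainPullback_serreFibreMap, h₃, map_zero]
  · refine (congrArg (cochainPullback (serreFibreMap f g hfg ⦋s⦌) d) h₄).trans ?_
    refine funext fun κ => ?_
    change y.1 (SSet.yonedaEquiv (κ.1.2 ≫ g)) * _ = y.1 (g.app _ (SSet.yonedaEquiv κ.1.2)) * _
    rw [SSet.yonedaEquiv_comp]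
    rfl
  · exact funext fun e => (congrArg (z d 0) (serreFibreMap_serreTotal f g hfg _ e)).trans
      (congrFun h₅ (f.app _ e))

end Naturality

/-! ### Maps of twisted products over `B²A' → B²A` -/

section TwistedNaturality

variable {A A' Γ : Type} [CommGroup A] [CommGroup A'] [Group Γ] {ι : A →* Γ} (φ : A' →* A)
  (hι : ∀ a g, ι a * g = g * ι a)

/-- The map induced on the fibres by a map of twisted products. -/
abbrev twistedFibreMap (ι : A →* Γ) :
    serreFibre (twistedProj (ι.comp φ)) ⦋0⦌ ⟶ serreFibre (twistedProj ι) ⦋0⦌ :=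
  serreFibreMap (twistedMap φ ι) (doubleClassifyingMap φ) (twistedMap_twistedProj φ ι) ⦋0⦌

lemma twistedFibreMap_fibreInclusion (n : SimplexCategoryᵒᵖ) (β : (classifyingSpace Γ).obj n) :
    (twistedFibreMap φ ι).app n
      ((fibreInclusion (fun a => hι (φ a)) (basePoint A')).app n β) =
      (fibreInclusion hι (basePoint A)).app n β := by
  refine Subtype.ext (Prod.ext ?_ (stdSimplex_hom_ext_of_subsingleton _ _))
  refine (Category.assoc _ _ _).trans (congrArg (_ ≫ ·) ?_)
  refine (twist_twistedMap hι φ _ _).trans ?_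
  rw [stdSimplex_hom_ext_of_subsingleton (basePoint A' ≫ doubleClassifyingMap φ) (basePoint A)]

-- Over the base points both fibres are identified with `BΓ` by `fibreInclusion`, and the map
-- corresponds to the identity.
include hι in
lemma twistedFibreMap_app_bijective (n : SimplexCategoryᵒᵖ) :
    Function.Bijective ((twistedFibreMap φ ι).app n) := by
  have h (κ) := fibreRestriction_basePoint_fibreInclusion hι n κ
  have h' (κ) := fibreRestriction_basePoint_fibreInclusion (ι := ι.comp φ) (fun a => hι (φ a)) n κ
  constructor
  · intro κ κ' hκ
    rw [← h' κ, ← h' κ']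
    rw [← h' κ, ← h' κ', twistedFibreMap_fibreInclusion φ hι,
      twistedFibreMap_fibreInclusion φ hι] at hκ
    have := congrArg ((fibreRestriction hι ⦋0⦌).app n) hκ
    rw [fibreRestriction_fibreInclusion, fibreRestriction_fibreInclusion] at this
    rw [this]
  · intro κ
    exact ⟨_, (twistedFibreMap_fibreInclusion φ hι n _).trans (h κ)⟩

end TwistedNaturality

lemma cohomologyMap_bijective {X Z : SSet.{0}} (f : X ⟶ Z)
    (hf : ∀ n, Function.Bijective (f.app (op ⦋n⦌))) (n : ℕ) :
    Function.Bijective (cohomologyMap f n) := by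
  have hinj (n : ℕ) : Function.Injective (cochainPullback f n) :=
    LinearMap.funLeft_injective_of_surjective _ _ _ (hf n).2
  have hsurj (n : ℕ) : Function.Surjective (cochainPullback f n) :=
    LinearMap.funLeft_surjective_of_injective _ _ _ (hf n).1
  constructor
  · rw [injective_iff_map_eq_zero]
    intro c hc
    obtain ⟨c, rfl⟩ := Submodule.mkQ_surjective _ c
    have hc' : cochainPullback f n c.1 ∈ coboundaries X n :=
      (cohomologyClass_eq_zero (⟨_, cochainPullback_mem_cocycles f n c.1 c.2⟩ :
        cocycles X n)).1 hc
    refine (cohomologyClass_eq_zero c).2 ?_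
    cases n with
    | zero => exact hinj 0 (hc'.trans (map_zero _).symm)
    | succ n =>
      obtain ⟨b, hb⟩ := hc'
      obtain ⟨b, rfl⟩ := hsurj n b
      rw [coboundary_cochainPullback] at hb
      exact ⟨b, hinj _ hb⟩
  · intro c
    obtain ⟨c, rfl⟩ := Submodule.mkQ_surjective _ c
    obtain ⟨b, hb⟩ := hsurj n c.1
    have hb' : b ∈ cocycles Z n := by
      refine hinj (n + 1) ?_
      rw [← coboundary_cochainPullback, hb, map_zero]
      exact c.2
    exact ⟨cohomologyClass Z n ⟨b, hb'⟩, congrArg (cohomologyClass X n) (Subtype.ext hb)⟩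

end

section

/-! ### Inhomogeneous cochains -/

section Bar

variable {G : Type} [Group G]

/-- The simplex of `BG` given by a family of elements at the vertices. -/
def vertexSimplex {n : ℕ} (P : Fin (n + 1) → G) : classifyingSpace G _⦋n⦌ :=
  ⟨fun e => (P (e.toOrderHom 0))⁻¹ * P (e.toOrderHom 1), fun τ => by
    change ((P (τ.toOrderHom 0))⁻¹ * P (τ.toOrderHom 1)) *
      ((P (τ.toOrderHom 1))⁻¹ * P (τ.toOrderHom 2)) =
      (P (τ.toOrderHom 0))⁻¹ * P (τ.toOrderHom 2)
    rw [mul_assoc, mul_inv_cancel_left]⟩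

lemma vertexSimplex_mul_left {n : ℕ} (P : Fin (n + 1) → G) (h : G) :
    vertexSimplex (fun i => h * P i) = vertexSimplex P := by
  refine Subtype.ext (funext fun e => ?_)
  simp [vertexSimplex]

lemma δ_vertexSimplex {n : ℕ} (P : Fin (n + 2) → G) (i : Fin (n + 2)) :
    (classifyingSpace G).δ i (vertexSimplex P) = vertexSimplex (P ∘ i.succAbove) := rfl

/-- The simplex of `BG` with given edges `g₀, …, gₙ₋₁` along its spine. -/
def barSimplex {n : ℕ} (g : Fin n → G) : classifyingSpace G _⦋n⦌ :=
  vertexSimplex (Fin.partialProd g)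

lemma δ_zero_barSimplex {n : ℕ} (g : Fin (n + 1) → G) :
    (classifyingSpace G).δ 0 (barSimplex g) = barSimplex (Fin.tail g) := by
  rw [barSimplex, δ_vertexSimplex, barSimplex, ← vertexSimplex_mul_left (Fin.partialProd (Fin.tail g)) (g 0)]
  exact congrArg vertexSimplex (funext fun i => (Fin.partialProd_succ' g i))

lemma δ_succ_barSimplex {n : ℕ} (g : Fin (n + 1) → G) (j : Fin (n + 1)) :
    (classifyingSpace G).δ j.succ (barSimplex g) = barSimplex (j.contractNth (· * ·) g) := by
  rw [barSimplex, δ_vertexSimplex, barSimplex, Fin.partialProd_contractNth]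

lemma barSimplex_mkOfSucc {n : ℕ} (g : Fin n → G) (i : Fin n) :
    (barSimplex g).1 (SimplexCategory.mkOfSucc i) = g i :=
  Fin.partialProd_right_inv g i

/-- Partial products along the spine are the values of the cocycle on the edges out of vertex 0, and
every other edge is a quotient of two of these. -/
lemma barSimplex_spine {n : ℕ} (γ : classifyingSpace G _⦋n⦌) :
    barSimplex (fun i => γ.1 (SimplexCategory.mkOfSucc i)) = γ := by
  have htri (i j k : Fin (n + 1)) (h₁ : i ≤ j) (h₂ : j ≤ k) :
      γ.1 (SimplexCategory.mkOfLe i j h₁) * γ.1 (SimplexCategory.mkOfLe j k h₂) =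
        γ.1 (SimplexCategory.mkOfLe i k (h₁.trans h₂)) := by
    have h := γ.2 (SimplexCategory.mkOfLeComp i j k h₁ h₂)
    convert h using 2
    · exact congrArg γ.1 (SimplexCategory.Hom.ext_one_left _ _)
    · exact congrArg γ.1 (SimplexCategory.Hom.ext_one_left _ _)
    · exact SimplexCategory.Hom.ext_one_left _ _
  have h (j : Fin (n + 1)) : Fin.partialProd (fun i => γ.1 (SimplexCategory.mkOfSucc i)) j =
      γ.1 (SimplexCategory.mkOfLe 0 j (Fin.zero_le _)) := by
    induction j using Fin.induction with
    | zero =>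
      rw [Fin.partialProd_zero]
      exact (mul_eq_left.1 (htri 0 0 0 le_rfl le_rfl)).symm
    | succ j ih =>
      rw [Fin.partialProd_succ, ih]
      exact htri 0 j.castSucc j.succ (Fin.zero_le _) (Fin.castSucc_le_succ j)
  refine Subtype.ext (funext fun e => ?_)
  change (Fin.partialProd _ _)⁻¹ * Fin.partialProd _ _ = _
  have he := e.toOrderHom.monotone (show (0 : Fin 2) ≤ 1 by decide)
  rw [h, h, ← htri 0 (e.toOrderHom 0) (e.toOrderHom 1) (Fin.zero_le _) he, inv_mul_cancel_left]
  exact congrArg γ.1 (SimplexCategory.Hom.ext_one_left _ _)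

variable (G) in
/-- The simplices of `BG` correspond to sequences of elements of `G`. -/
def barEquiv (n : ℕ) : (Fin n → G) ≃ classifyingSpace G _⦋n⦌ where
  toFun := barSimplex
  invFun γ i := γ.1 (SimplexCategory.mkOfSucc i)
  left_inv g := funext (barSimplex_mkOfSucc g)
  right_inv := barSimplex_spine

lemma coboundary_barSimplex {n : ℕ} (c : classifyingSpace G _⦋n⦌ → ℚ) (g : Fin (n + 1) → G) :
    coboundary (classifyingSpace G) n c (barSimplex g) = c (barSimplex (Fin.tail g)) +
      ∑ j : Fin (n + 1), (-1 : ℚ) ^ ((j : ℕ) + 1) *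
        c (barSimplex (j.contractNth (· * ·) g)) := by
  rw [coboundary_apply, Fin.sum_univ_succ]
  simp only [δ_zero_barSimplex, δ_succ_barSimplex]
  simp

lemma contractNth_zero_cons {n : ℕ} (t : G) (g : Fin (n + 1) → G) :
    (0 : Fin (n + 2)).contractNth (· * ·) (Fin.cons t g : Fin (n + 2) → G) =
      Fin.cons (t * g 0) (Fin.tail g) := by
  refine funext fun k => ?_
  induction k using Fin.cases with
  | zero => rw [Fin.contractNth_apply_of_eq _ _ _ _ rfl]; rfl
  | succ k => rw [Fin.contractNth_apply_of_gt _ _ _ _ (by simp)]; rfl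

lemma contractNth_succ_cons {n : ℕ} (t : G) (g : Fin (n + 1) → G) (j : Fin (n + 1)) :
    j.succ.contractNth (· * ·) (Fin.cons t g : Fin (n + 2) → G) =
      Fin.cons t (j.contractNth (· * ·) g) := by
  refine funext fun k => ?_
  induction k using Fin.cases with
  | zero => rw [Fin.contractNth_apply_of_lt _ _ _ _ (by simp)]; rfl
  | succ k => simp [Fin.contractNth, ← Fin.succ_castSucc]

/-- Face 0 drops `t` and face 1 merges it with `g 0`; all other faces keep `t` as first edge, where
`c` vanishes. -/
lemma coboundary_barSimplex_cons {n : ℕ} (c : classifyingSpace G _⦋n + 1⦌ → ℚ) (t : G)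
    (hc : ∀ g : Fin n → G, c (barSimplex (Fin.cons t g)) = 0) (g : Fin (n + 1) → G) :
    coboundary (classifyingSpace G) (n + 1) c (barSimplex (Fin.cons t g)) =
      c (barSimplex g) - c (barSimplex (Fin.cons (t * g 0) (Fin.tail g))) := by
  rw [coboundary_barSimplex, Fin.sum_univ_succ]
  simp only [contractNth_zero_cons, contractNth_succ_cons, hc]
  simp [sub_eq_add_neg]

end Bar

section Circle

/-- A function on the integers is constructed from its value at `1` and its increments. -/
lemma exists_int_recursion (f : ℤ → ℚ) : ∃ b : ℤ → ℚ, b 1 = 0 ∧ ∀ n, b n - b (1 + n) = f n := by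
  refine ⟨fun n => (∑ k ∈ Finset.range (1 - n).toNat, f (-k)) -
    ∑ k ∈ Finset.range (n - 1).toNat, f (1 + k), by simp, fun n => ?_⟩
  rcases le_or_gt 1 n with hn | hn
  · obtain ⟨m, rfl⟩ : ∃ m : ℕ, n = 1 + m := ⟨(n - 1).toNat, by omega⟩
    have h₁ : (1 - (1 + (m : ℤ))).toNat = 0 := by omega
    have h₂ : (1 - (1 + (1 + (m : ℤ)))).toNat = 0 := by omega
    have h₃ : (1 + (m : ℤ) - 1).toNat = m := by omega
    have h₄ : (1 + (1 + (m : ℤ)) - 1).toNat = m + 1 := by omega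
    simp only [h₁, h₂, h₃, h₄, Finset.sum_range_succ]
    simp
  · obtain ⟨m, rfl⟩ : ∃ m : ℕ, n = -m := ⟨(-n).toNat, by omega⟩
    have h₁ : (1 - (-(m : ℤ))).toNat = m + 1 := by omega
    have h₂ : (1 - (1 + -(m : ℤ))).toNat = m := by omega
    have h₃ : (-(m : ℤ) - 1).toNat = 0 := by omega
    have h₄ : (1 + -(m : ℤ) - 1).toNat = 0 := by omega
    simp only [h₁, h₂, h₃, h₄, Finset.sum_range_succ]
    simp

lemma int_eq_of_step {F : ℤ → ℚ} (h : ∀ k, F k = F (1 + k)) (k : ℤ) : F k = F 1 := by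
  have h₀ (k : ℤ) : F k = F 0 := by
    induction k using Int.induction_on with
    | zero => rfl
    | succ k ih => rw [← ih, h k, add_comm]
    | pred k ih => rw [← ih, h (-k - 1), add_sub_cancel]
  rw [h₀, h₀ 1]

/-- A cochain `β`, found by recursion along the first variable, makes `f - δβ` vanish on simplices
whose first edge is the generator. The cocycle identity then says that shifting the first edge by 1
does not change the value of `f - δβ`, so it is zero. -/
lemma cocycles_le_coboundaries_int {n : ℕ} (hn : 1 < n) :
    cocycles (classifyingSpace (Multiplicative ℤ)) n ≤
      coboundaries (classifyingSpace (Multiplicative ℤ)) n := by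
  obtain ⟨n, rfl⟩ : ∃ m, n = m + 2 := ⟨n - 2, by omega⟩
  intro f hf
  choose b hb₁ hb using fun g : Fin n → Multiplicative ℤ => exists_int_recursion fun k =>
    f (barSimplex (Fin.cons (Multiplicative.ofAdd 1) (Fin.cons (Multiplicative.ofAdd k) g)))
  let β : classifyingSpace (Multiplicative ℤ) _⦋n + 1⦌ → ℚ := fun x =>
    b (Fin.tail ((barEquiv _ _).symm x)) (Multiplicative.toAdd ((barEquiv _ _).symm x 0))
  have hβ (g) : β (barSimplex g) = b (Fin.tail g) (Multiplicative.toAdd (g 0)) := by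
    change b (Fin.tail ((barEquiv _ _).symm (barEquiv _ _ g)))
      (Multiplicative.toAdd ((barEquiv _ _).symm (barEquiv _ _ g) 0)) = _
    rw [Equiv.symm_apply_apply]
  have h₁ (g) : (f - coboundary _ _ β) (barSimplex (Fin.cons (Multiplicative.ofAdd 1) g)) = 0 := by
    rw [Pi.sub_apply, coboundary_barSimplex_cons, hβ, hβ, sub_eq_zero, Fin.tail_cons, Fin.cons_zero,
      toAdd_mul, toAdd_ofAdd, hb]
    · rw [ofAdd_toAdd, Fin.cons_self_tail]
    · intro g
      rw [hβ, Fin.cons_zero, toAdd_ofAdd, hb₁]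
  have h₂ : f - coboundary _ _ β = 0 := by
    have h₃ (g : Fin (n + 1) → Multiplicative ℤ) (k : ℤ) :
        (f - coboundary _ _ β) (barSimplex (Fin.cons (Multiplicative.ofAdd k) g)) =
        (f - coboundary _ _ β) (barSimplex (Fin.cons (Multiplicative.ofAdd (1 + k)) g)) := by
      have h := coboundary_barSimplex_cons _ _ h₁ (Fin.cons (Multiplicative.ofAdd k) g)
      rw [map_sub, coboundary_coboundary, hf, sub_zero, Pi.zero_apply, eq_comm, sub_eq_zero,
        Fin.tail_cons] at h
      exact h
    refine funext fun x => ?_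
    obtain ⟨g, rfl⟩ := (barEquiv _ _).surjective x
    change (f - coboundary _ _ β) (barSimplex g) = 0
    rw [← Fin.cons_self_tail g, ← ofAdd_toAdd (g 0)]
    generalize Multiplicative.toAdd (g 0) = k
    exact (int_eq_of_step (h₃ (Fin.tail g)) k).trans (h₁ _)
  exact ⟨β, (sub_eq_zero.1 h₂).symm⟩

/-- The fundamental cochain of the circle `Bℤ`. -/
def circleCochain : classifyingSpace (Multiplicative ℤ) _⦋1⦌ → ℚ :=
  fun x => (Multiplicative.toAdd (x.1 (𝟙 _)) : ℤ)

lemma circleCochain_barSimplex (g : Fin 1 → Multiplicative ℤ) :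
    circleCochain (barSimplex g) = (Multiplicative.toAdd (g 0) : ℤ) := by
  rw [circleCochain, ← SimplexCategory.mkOfSucc_eq_id, barSimplex_mkOfSucc]

lemma circleCochain_mem_cocycles :
    circleCochain ∈ cocycles (classifyingSpace (Multiplicative ℤ)) 1 := by
  refine funext fun x => ?_
  obtain ⟨g, rfl⟩ := (barEquiv _ _).surjective x
  refine (coboundary_barSimplex _ _).trans ?_
  rw [Fin.sum_univ_two]
  simp [circleCochain_barSimplex, Fin.tail, Fin.contractNth]

lemma coboundary_zero_classifyingSpace {G : Type} [Group G] (c : classifyingSpace G _⦋0⦌ → ℚ) :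
    coboundary (classifyingSpace G) 0 c = 0 := by
  refine funext fun x => ?_
  obtain ⟨g, rfl⟩ := (barEquiv _ _).surjective x
  refine (coboundary_barSimplex _ _).trans ?_
  rw [Fin.sum_univ_one, Subsingleton.elim (Fin.tail g) (Fin.contractNth 0 (· * ·) g)]
  simp

lemma circleCochain_notMem_coboundaries :
    circleCochain ∉ coboundaries (classifyingSpace (Multiplicative ℤ)) 1 := by
  rintro ⟨b, hb⟩
  rw [coboundary_zero_classifyingSpace] at hb
  have h := circleCochain_barSimplex (fun _ => Multiplicative.ofAdd 1)
  rw [← hb] at h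
  simp at h

/-- The cocycle identity on `(1, k)` says that `c` grows by `c 1` at each step, so `c` is exactly `c
1` times the fundamental cochain. -/
lemma exists_sub_smul_circleCochain_mem {c : classifyingSpace (Multiplicative ℤ) _⦋1⦌ → ℚ}
    (hc : c ∈ cocycles (classifyingSpace (Multiplicative ℤ)) 1) :
    ∃ r : ℚ, c - r • circleCochain ∈ coboundaries (classifyingSpace (Multiplicative ℤ)) 1 := by
  have h (k : ℤ) : c (barSimplex fun _ => Multiplicative.ofAdd k) -
        c (barSimplex fun _ => Multiplicative.ofAdd (1 + k)) +
        c (barSimplex fun _ => Multiplicative.ofAdd 1) = 0 := by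
    have h := congrFun hc (barSimplex ![Multiplicative.ofAdd 1, Multiplicative.ofAdd k])
    rw [coboundary_barSimplex, Fin.sum_univ_two] at h
    have h₀ : Fin.tail ![Multiplicative.ofAdd 1, Multiplicative.ofAdd k] =
      fun _ => Multiplicative.ofAdd k := by ext i; fin_cases i; rfl
    have h₁ : Fin.contractNth 0 (· * ·) ![Multiplicative.ofAdd 1, Multiplicative.ofAdd k] =
      fun _ => Multiplicative.ofAdd (1 + k) := by ext i; fin_cases i; rfl
    have h₂ : Fin.contractNth 1 (· * ·) ![Multiplicative.ofAdd 1, Multiplicative.ofAdd k] =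
      fun _ => Multiplicative.ofAdd 1 := by ext i; fin_cases i; rfl
    rw [h₀, h₁, h₂] at h
    simp only [Fin.val_zero, Fin.val_one, zero_add, pow_one, neg_mul, one_mul,
      Pi.zero_apply, show (-1 : ℚ) ^ (1 + 1) = 1 by norm_num] at h
    linarith
  refine ⟨c (barSimplex fun _ => Multiplicative.ofAdd 1), ⟨0, ?_⟩⟩
  rw [map_zero, eq_comm, sub_eq_zero]
  refine funext fun x => ?_
  obtain ⟨g, rfl⟩ := (barEquiv _ _).surjective x
  change c (barSimplex g) = _ * circleCochain (barSimplex g)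
  rw [circleCochain_barSimplex]
  obtain ⟨k, rfl⟩ : ∃ k, g = fun _ => Multiplicative.ofAdd k :=
    ⟨Multiplicative.toAdd (g 0), by ext i; fin_cases i; rfl⟩
  have h' := int_eq_of_step (F := fun k => c (barSimplex fun _ => Multiplicative.ofAdd k) -
    c (barSimplex fun _ => Multiplicative.ofAdd 1) * k) (fun k => by
      have := h k
      push_cast
      linarith) k
  simp only [Int.cast_one, mul_one, sub_self] at h'
  exact sub_eq_zero.1 h'

end Circle

end

section

/-! ### Multiplication by the Euler class -/

section Euler

variable {A : Type} [CommGroup A]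

lemma δ_zero_δ_succ (X : SSet.{0}) {n : ℕ} (j : Fin (n + 2)) (x : X _⦋n + 2⦌) :
    X.δ 0 (X.δ j.succ x) = X.δ j (X.δ 0 x) :=
  ConcreteCategory.congr_hom (X.δ_comp_δ (Fin.zero_le j)) x

/-- The face of a simplex spanned by the first `k + 1` vertices. -/
def frontFace (k s : ℕ) : ⦋k⦌ ⟶ ⦋s + k⦌ :=
  SimplexCategory.mkHom (Fin.castLEOrderEmb (by omega)).toOrderHom

/-- The product of the cochain `y` with the Euler class of the character `χ`. -/
def eulerCup (χ : A →* Multiplicative ℤ) {s : ℕ} (y : doubleClassifyingSpace A _⦋s⦌ → ℚ) :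
    doubleClassifyingSpace A _⦋s + 2⦌ → ℚ :=
  fun a => (Multiplicative.toAdd (χ (a.1 (frontFace 2 s))) : ℤ) *
    y ((doubleClassifyingSpace A).δ 0 ((doubleClassifyingSpace A).δ 0 a))

/-- The cocycle identity of `χ ∘ a` on the front 3-face merges the terms of faces 0, 1 and 2 into
the first term of `e ∪ δy`; the later faces match one by one. No sign appears since the Euler class
has even degree. -/
lemma coboundary_eulerCup (χ : A →* Multiplicative ℤ) {s : ℕ}
    (y : doubleClassifyingSpace A _⦋s⦌ → ℚ) :
    coboundary _ (s + 2) (eulerCup χ y) = eulerCup χ (coboundary _ s y) := by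
  refine funext fun a => ?_
  have h₀ : ((doubleClassifyingSpace A).δ 0 a).1 (frontFace 2 s) = a.1 (SimplexCategory.δ 0 ≫ frontFace 3 s) :=
    congrArg a.1 (by ext i : 3; fin_cases i <;> rfl)
  have h₁ : ((doubleClassifyingSpace A).δ 1 a).1 (frontFace 2 s) = a.1 (SimplexCategory.δ 1 ≫ frontFace 3 s) :=
    congrArg a.1 (by ext i : 3; fin_cases i <;> rfl)
  have h₂ : ((doubleClassifyingSpace A).δ (Fin.succ 1) a).1 (frontFace 2 s) =
      a.1 (SimplexCategory.δ 2 ≫ frontFace 3 s) :=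
    congrArg a.1 (by ext i : 3; fin_cases i <;> rfl)
  have h₃ (j : Fin (s + 1)) : ((doubleClassifyingSpace A).δ j.succ.succ.succ a).1 (frontFace 2 s) =
      a.1 (SimplexCategory.δ 3 ≫ frontFace 3 s) :=
    congrArg a.1 (by ext i : 3; fin_cases i <;> rfl)
  have h₄ : a.1 (frontFace 2 (s + 1)) = a.1 (SimplexCategory.δ 3 ≫ frontFace 3 s) :=
    congrArg a.1 (by ext i : 3; fin_cases i <;> rfl)
  have h := congrArg (fun x => ((Multiplicative.toAdd (χ x) : ℤ) : ℚ)) (a.2.2 (frontFace 3 s))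
  simp only [map_mul, toAdd_mul, Int.cast_add] at h
  have e₁ : (doubleClassifyingSpace A).δ 0 ((doubleClassifyingSpace A).δ 0 ((doubleClassifyingSpace A).δ 1 a)) = (doubleClassifyingSpace A).δ 0 ((doubleClassifyingSpace A).δ 0 ((doubleClassifyingSpace A).δ 0 a)) :=
    congrArg ((doubleClassifyingSpace A).δ 0) (δ_zero_δ_succ (doubleClassifyingSpace A) 0 a)
  have e₂ : (doubleClassifyingSpace A).δ 0 ((doubleClassifyingSpace A).δ 0 ((doubleClassifyingSpace A).δ (Fin.succ 1) a)) = (doubleClassifyingSpace A).δ 0 ((doubleClassifyingSpace A).δ 0 ((doubleClassifyingSpace A).δ 0 a)) :=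
    (congrArg ((doubleClassifyingSpace A).δ 0) (δ_zero_δ_succ (doubleClassifyingSpace A) 1 a)).trans (δ_zero_δ_succ (doubleClassifyingSpace A) 0 _)
  have e₃ (j : Fin (s + 1)) : (doubleClassifyingSpace A).δ 0 ((doubleClassifyingSpace A).δ 0 ((doubleClassifyingSpace A).δ j.succ.succ.succ a)) =
      (doubleClassifyingSpace A).δ j.succ ((doubleClassifyingSpace A).δ 0 ((doubleClassifyingSpace A).δ 0 a)) :=
    (congrArg ((doubleClassifyingSpace A).δ 0) (δ_zero_δ_succ (doubleClassifyingSpace A) _ a)).trans (δ_zero_δ_succ (doubleClassifyingSpace A) j.succ _)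
  rw [coboundary_apply, eulerCup, coboundary_apply, Fin.sum_univ_succ, Fin.sum_univ_succ,
    Fin.sum_univ_succ, Fin.sum_univ_succ (fun k : Fin (s + 2) => _ * _)]
  simp only [eulerCup, Fin.succ_zero_eq_one, e₁, e₂, e₃, h₀, h₁, h₂, h₃, h₄]
  rw [mul_add, Finset.mul_sum, ← add_assoc, ← add_assoc]
  refine congrArg₂ (· + ·) ?_ (Finset.sum_congr rfl fun j _ => ?_)
  · simp only [Fin.val_zero, Fin.val_succ, Fin.val_one]
    linear_combination y ((doubleClassifyingSpace A).δ 0 ((doubleClassifyingSpace A).δ 0 ((doubleClassifyingSpace A).δ 0 a))) * h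
  · simp only [Fin.val_succ, pow_succ]
    ring

variable (χ : A →* Multiplicative ℤ)

lemma commute_of_comm (a : A) (g : Multiplicative ℤ) : χ a * g = g * χ a := mul_comm _ _

/-- The cochain on the total space transgressing to the product with the Euler class. -/
def eulerTransgression {s : ℕ} (y : doubleClassifyingSpace A _⦋s⦌ → ℚ) :
    twistedSpace χ _⦋s + 1⦌ → ℚ :=
  fun x => (Multiplicative.toAdd (x.1.1 (SimplexCategory.mkOfSucc 0)) : ℤ) *
    y ((doubleClassifyingSpace A).δ 0 x.1.2)

/-- On the circle bundle the cochain `γ` satisfies `δγ = χ ∘ a`, so it is a primitive of the Euler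
class, and `γ ∪ y` is one of its product with the cocycle `y`. -/
lemma coboundary_eulerTransgression {s : ℕ} {y : doubleClassifyingSpace A _⦋s⦌ → ℚ}
    (hy : y ∈ cocycles (doubleClassifyingSpace A) s) :
    coboundary _ (s + 1) (eulerTransgression χ y) =
      cochainPullback (twistedProj χ) (s + 2) (eulerCup χ y) := by
  refine funext fun x => ?_
  have h₀ : ((twistedSpace χ).δ 0 x).1.1 (SimplexCategory.mkOfSucc 0) =
      x.1.1 (SimplexCategory.δ 0 ≫ frontFace 2 s) :=
    congrArg x.1.1 (by ext i : 3; fin_cases i <;> rfl)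
  have h₁ : ((twistedSpace χ).δ 1 x).1.1 (SimplexCategory.mkOfSucc 0) =
      x.1.1 (SimplexCategory.δ 1 ≫ frontFace 2 s) :=
    congrArg x.1.1 (by ext i : 3; fin_cases i <;> rfl)
  have h₂ (j : Fin (s + 1)) : ((twistedSpace χ).δ j.succ.succ x).1.1 (SimplexCategory.mkOfSucc 0) =
      x.1.1 (SimplexCategory.δ 2 ≫ frontFace 2 s) :=
    congrArg x.1.1 (by ext i : 3; fin_cases i <;> rfl)
  have h := congrArg (fun x => ((Multiplicative.toAdd x : ℤ) : ℚ)) (x.2.2 (frontFace 2 s))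
  simp only [toAdd_mul, Int.cast_add] at h
  have e₀ (k : Fin (s + 3)) : ((twistedSpace χ).δ k x).1.2 = (doubleClassifyingSpace A).δ k x.1.2 := rfl
  have e₁ : (doubleClassifyingSpace A).δ 0 ((doubleClassifyingSpace A).δ 1 x.1.2) = (doubleClassifyingSpace A).δ 0 ((doubleClassifyingSpace A).δ 0 x.1.2) := δ_zero_δ_succ (doubleClassifyingSpace A) 0 _
  have e₂ (j : Fin (s + 1)) : (doubleClassifyingSpace A).δ 0 ((doubleClassifyingSpace A).δ j.succ.succ x.1.2) = (doubleClassifyingSpace A).δ j.succ ((doubleClassifyingSpace A).δ 0 x.1.2) :=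
    δ_zero_δ_succ (doubleClassifyingSpace A) j.succ _
  have hy' := congrFun hy ((doubleClassifyingSpace A).δ 0 x.1.2)
  rw [coboundary_apply, Fin.sum_univ_succ] at hy'
  rw [coboundary_apply, Fin.sum_univ_succ, Fin.sum_univ_succ]
  change _ = (Multiplicative.toAdd (χ (x.1.2.1 (frontFace 2 s))) : ℤ) * y ((doubleClassifyingSpace A).δ 0 ((doubleClassifyingSpace A).δ 0 x.1.2))
  simp only [eulerTransgression, Fin.succ_zero_eq_one, e₀, e₁, e₂, h₀, h₁, h₂]
  have hs : ∑ j : Fin (s + 1), (-1 : ℚ) ^ (j.succ.succ : ℕ) *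
      ((Multiplicative.toAdd (x.1.1 (SimplexCategory.δ 2 ≫ frontFace 2 s)) : ℤ) *
        y ((doubleClassifyingSpace A).δ j.succ ((doubleClassifyingSpace A).δ 0 x.1.2))) =
      -((Multiplicative.toAdd (x.1.1 (SimplexCategory.δ 2 ≫ frontFace 2 s)) : ℤ) *
        ∑ j : Fin (s + 1), (-1 : ℚ) ^ (j.succ : ℕ) *
          y ((doubleClassifyingSpace A).δ j.succ ((doubleClassifyingSpace A).δ 0 x.1.2))) := by
    rw [Finset.mul_sum, ← Finset.sum_neg_distrib]
    refine Finset.sum_congr rfl fun j _ => ?_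
    simp only [Fin.val_succ, pow_succ]
    ring
  rw [hs]
  simp at hy' ⊢
  linear_combination y ((doubleClassifyingSpace A).δ 0 ((doubleClassifyingSpace A).δ 0 x.1.2)) * h -
    (Multiplicative.toAdd (x.1.1 (SimplexCategory.δ 2 ≫ frontFace 2 s)) : ℤ) * hy'

/-- The value of a section on an edge of a product of simplices. -/
def sectionEdge {Γ : Type} [Group Γ] {ι : A →* Γ} {i n k : SimplexCategory}
    (τ : SSet.stdSimplex.{0}.obj i ⊗ SSet.stdSimplex.{0}.obj n ⟶ twistedSpace ι)
    (f : k ⟶ i) (f' : k ⟶ n) : (twistedSpace ι).obj (op k) :=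
  SSet.yonedaEquiv (lift (SSet.stdSimplex.map f) (SSet.stdSimplex.map f') ≫ τ)

lemma map_sectionEdge {Γ : Type} [Group Γ] {ι : A →* Γ} {i n k k' : SimplexCategory}
    (τ : SSet.stdSimplex.{0}.obj i ⊗ SSet.stdSimplex.{0}.obj n ⟶ twistedSpace ι)
    (f : k ⟶ i) (f' : k ⟶ n) (h : k' ⟶ k) :
    (twistedSpace ι).map h.op (sectionEdge τ f f') = sectionEdge τ (h ≫ f) (h ≫ f') := by
  refine (SSet.yonedaEquiv_naturality h _).trans ?_
  refine congrArg SSet.yonedaEquiv ?_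
  have e := SSet.stdSimplex.{0}.map_comp h f
  have e' := SSet.stdSimplex.{0}.map_comp h f'
  rw [← Category.assoc, comp_lift, ← e, ← e']

/-- The triangle has degenerate image in the base, where the normalised 2-cocycle is 1. -/
lemma sectionEdge_mul {Γ : Type} [Group Γ] {ι : A →* Γ} {i n : SimplexCategory}
    {τ : SSet.stdSimplex.{0}.obj i ⊗ SSet.stdSimplex.{0}.obj n ⟶ twistedSpace ι}
    {s : SSet.stdSimplex.{0}.obj i ⟶ doubleClassifyingSpace A}
    (hs : τ ≫ twistedProj ι = fst _ _ ≫ s) (f : ⦋2⦌ ⟶ i) (f' : ⦋2⦌ ⟶ n)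
    (hf : f.toOrderHom 0 = f.toOrderHom 1 ∨ f.toOrderHom 1 = f.toOrderHom 2) :
    (sectionEdge τ (SimplexCategory.δ 2 ≫ f) (SimplexCategory.δ 2 ≫ f')).1.1 (𝟙 _) *
      (sectionEdge τ (SimplexCategory.δ 0 ≫ f) (SimplexCategory.δ 0 ≫ f')).1.1 (𝟙 _) =
      (sectionEdge τ (SimplexCategory.δ 1 ≫ f) (SimplexCategory.δ 1 ≫ f')).1.1 (𝟙 _) := by
  rw [← map_sectionEdge, ← map_sectionEdge, ← map_sectionEdge]
  have h := (sectionEdge τ f f').2.2 (𝟙 _)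
  have h' : (sectionEdge τ f f').1.2 = SSet.yonedaEquiv (SSet.stdSimplex.map f ≫ s) := by
    refine (SSet.yonedaEquiv_comp _ (twistedProj ι)).symm.trans (congrArg SSet.yonedaEquiv ?_)
    rw [Category.assoc, hs, lift_fst_assoc]
  have h'' : (sectionEdge τ f f').1.2.1 (𝟙 _) = 1 := by
    rw [h', ← SSet.yonedaEquiv_naturality]
    exact doubleClassifyingSpace_apply_eq_one (SSet.yonedaEquiv s) (𝟙 _ ≫ f) hf
  rw [h'', map_one, one_mul] at h
  exact h

end Euler

end

/-! ### The Gysin sequence of a circle bundle -/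

section

section Transgression

lemma serreEval_comp {X Y : SSet.{0}} (p : X ⟶ Y) (m : SimplexCategoryᵒᵖ)
    (κ : (serreRow p (op ⦋0⦌)).obj m) :
    (serreEval p ≫ p).app m κ = SSet.yonedaEquiv κ.1.2 := by
  refine (SSet.yonedaEquiv_comp _ p).symm.trans (congrArg SSet.yonedaEquiv ?_)
  rw [Category.assoc, κ.2, lift_fst_assoc, Category.id_comp]

lemma cochainPullback_serreEval_eq_productCochain {A Γ : Type} [CommGroup A] [Group Γ]
    {ι : A →* Γ} (hι : ∀ a g, ι a * g = g * ι a) {s : ℕ}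
    (y : doubleClassifyingSpace A _⦋s⦌ → ℚ) :
    cochainPullback (serreEval (twistedProj ι) ≫ twistedProj ι) s y =
      productCochain hι (n := 0) y (fun _ => 1) := by
  refine funext fun κ => ?_
  refine (congrArg y (serreEval_comp (twistedProj ι) _ κ)).trans ?_
  exact (mul_one _).symm

variable {A : Type} [CommGroup A] (χ : A →* Multiplicative ℤ)

lemma fibreRestriction_serreBase_const {s : ℕ} (j : Fin (s + 1))
    (κ : serreFibre (twistedProj χ) ⦋s⦌ _⦋1⦌) :
    ((fibreRestriction (commute_of_comm χ) ⦋0⦌).app _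
      ((serreBase (twistedProj χ) (SimplexCategory.const ⦋0⦌ ⦋s⦌ j)).app _ κ)).1 (𝟙 _) =
      (sectionEdge κ.1.1 (SimplexCategory.const ⦋1⦌ ⦋s⦌ j) (𝟙 _)).1.1 (𝟙 _) := by
  rw [fibreRestriction_apply]
  refine congrArg (fun f : SSet.stdSimplex.{0}.obj ⦋1⦌ ⟶ twistedSpace χ =>
    (SSet.yonedaEquiv f).1.1 (𝟙 _)) ?_
  change initialSimplex ⦋0⦌ ⦋1⦌ ≫ (SSet.stdSimplex.map _ ▷ _) ≫ κ.1.1 = _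
  rw [← Category.assoc]
  refine congrArg (· ≫ κ.1.1) ?_
  rw [SSet.stdSimplex.{0}.map_id ⦋1⦌]
  rfl

lemma serreEval_δ_mkOfSucc {s : ℕ} (j : Fin 2) (κ : serreFibre (twistedProj χ) ⦋s + 1⦌ _⦋1⦌) :
    ((serreEval (twistedProj χ)).app (op ⦋s + 1⦌)
      ((serreFibre (twistedProj χ) ⦋s + 1⦌).δ j κ)).1.1 (SimplexCategory.mkOfSucc 0) =
      (sectionEdge κ.1.1 (SimplexCategory.mkOfSucc 0)
        (SimplexCategory.const ⦋1⦌ ⦋0⦌ 0 ≫ SimplexCategory.δ j)).1.1 (𝟙 _) := by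
  have h : (serreEval (twistedProj χ)).app (op ⦋s + 1⦌)
      ((serreFibre (twistedProj χ) ⦋s + 1⦌).δ j κ) = sectionEdge κ.1.1 (𝟙 _)
        (SimplexCategory.const ⦋s + 1⦌ ⦋0⦌ 0 ≫ SimplexCategory.δ j) := by
    refine congrArg SSet.yonedaEquiv ?_
    change lift (𝟙 _) _ ≫ (_ ◁ SSet.stdSimplex.map (SimplexCategory.δ j)) ≫ κ.1.1 = _
    rw [← Category.assoc]
    refine congrArg (· ≫ κ.1.1) ?_
    rw [lift_whiskerLeft, SSet.stdSimplex.{0}.map_id ⦋s + 1⦌]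
    rfl
  rw [h]
  exact (congrArg (fun x => x.1.1 (𝟙 _))
    (map_sectionEdge κ.1.1 _ _ (SimplexCategory.mkOfSucc (0 : Fin (s + 1)))))

/-- By `coboundaryBase_crossCochain_sub` the left side is, up to sign, `y` times the difference
between the values of the section on the fibre edge over vertices 0 and 1. On the square spanned by
a base edge and a fibre edge, this is the difference between the two sides in the base direction,
which the transgression cochain measures. The identity holds exactly, not merely up to coboundaries.
-/
lemma coboundaryBase_productCochain_circleCochain {s : ℕ}
    {y : doubleClassifyingSpace A _⦋s⦌ → ℚ} (hy : y ∈ cocycles (doubleClassifyingSpace A) s) :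
    coboundaryBase (twistedProj χ) s 1 (productCochain (commute_of_comm χ) y circleCochain) =
      coboundary (serreFibre (twistedProj χ) ⦋s + 1⦌) 0
        (cochainPullback (serreEval (twistedProj χ)) (s + 1) (eulerTransgression χ y)) := by
  have hW : crossCochain (twistedProj χ) y (cochainPullback
      (fibreRestriction (commute_of_comm χ) ⦋0⦌) 1 circleCochain) =
      productCochain (commute_of_comm χ) y circleCochain := by
    rw [crossCochain_eq_productCochain (commute_of_comm χ) _ _ (basePoint A)
      fun _ => stdSimplex_hom_ext_of_subsingleton _ _]
    congr 1
    exact funext fun x => congrArg circleCochain (fibreRestriction_fibreInclusion _ _ _ x)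
  refine funext fun κ => ?_
  have h := coboundaryBase_crossCochain_sub (twistedProj χ) y (cochainPullback
      (fibreRestriction (commute_of_comm χ) ⦋0⦌) 1 circleCochain) κ
  have hy' : coboundary (doubleClassifyingSpace A) s y = 0 := hy
  have h0 : crossCochain (twistedProj χ) (0 : doubleClassifyingSpace A _⦋s + 1⦌ → ℚ) (cochainPullback
      (fibreRestriction (commute_of_comm χ) ⦋0⦌) 1 circleCochain) = 0 :=
    funext fun κ => zero_mul _
  rw [hW, hy', h0, sub_zero] at h
  refine h.trans (Eq.trans ?_ (coboundary_apply (serreFibre (twistedProj χ) ⦋s + 1⦌) 0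
    (cochainPullback (serreEval (twistedProj χ)) (s + 1) (eulerTransgression χ y)) κ).symm)
  rw [Fin.sum_univ_two]
  have e (j : Fin 2) : cochainPullback (serreEval (twistedProj χ)) (s + 1) (eulerTransgression χ y)
      ((serreFibre (twistedProj χ) ⦋s + 1⦌).δ j κ) =
      (Multiplicative.toAdd ((sectionEdge κ.1.1 (SimplexCategory.mkOfSucc 0)
        (SimplexCategory.const ⦋1⦌ ⦋0⦌ 0 ≫ SimplexCategory.δ j)).1.1 (𝟙 _)) : ℤ) *
      y (SSet.yonedaEquiv (SSet.stdSimplex.map (SimplexCategory.δ 0) ≫ κ.1.2)) := by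
    rw [← serreEval_δ_mkOfSucc]
    refine congrArg (_ * y ·) ?_
    refine (congrArg ((doubleClassifyingSpace A).δ 0)
      (serreEval_comp (twistedProj χ) _ ((serreFibre (twistedProj χ) ⦋s + 1⦌).δ j κ))).trans ?_
    exact SSet.yonedaEquiv_naturality (SimplexCategory.δ 0) κ.1.2
  rw [e, e]
  have e' (j : Fin (s + 2)) : cochainPullback (fibreRestriction (commute_of_comm χ) ⦋0⦌) 1
      circleCochain ((serreBase (twistedProj χ) (SimplexCategory.const ⦋0⦌ ⦋s + 1⦌ j)).app _ κ) =
      (Multiplicative.toAdd ((sectionEdge κ.1.1 (SimplexCategory.const ⦋1⦌ ⦋s + 1⦌ j)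
        (𝟙 _)).1.1 (𝟙 _)) : ℤ) := by
    rw [← fibreRestriction_serreBase_const]
    rfl
  rw [e', e']
  -- The two triangles of this square both have degenerate image in the base; their common diagonal
  -- is eliminated by `t₁.trans t₂.symm`.
  have t₁ := sectionEdge_mul κ.2 (SimplexCategory.σ 0 ≫ SimplexCategory.mkOfSucc 0)
    (SimplexCategory.σ 1) (.inl rfl)
  have t₂ := sectionEdge_mul κ.2 (SimplexCategory.σ 1 ≫ SimplexCategory.mkOfSucc 0)
    (SimplexCategory.σ 0) (.inr rfl)
  have f₁ : SimplexCategory.δ 2 ≫ SimplexCategory.σ 0 ≫ SimplexCategory.mkOfSucc (0 : Fin (s + 1)) =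
    SimplexCategory.const ⦋1⦌ ⦋s + 1⦌ 0 := SimplexCategory.Hom.ext_one_left _ _
  have f₂ : SimplexCategory.δ 0 ≫ SimplexCategory.σ 0 ≫ SimplexCategory.mkOfSucc (0 : Fin (s + 1)) =
    SimplexCategory.mkOfSucc 0 := SimplexCategory.Hom.ext_one_left _ _
  have f₃ : SimplexCategory.δ 1 ≫ SimplexCategory.σ 0 ≫ SimplexCategory.mkOfSucc (0 : Fin (s + 1)) =
    SimplexCategory.mkOfSucc 0 := SimplexCategory.Hom.ext_one_left _ _
  have g₁ : SimplexCategory.δ 2 ≫ SimplexCategory.σ 1 ≫ SimplexCategory.mkOfSucc (0 : Fin (s + 1)) =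
    SimplexCategory.mkOfSucc 0 := SimplexCategory.Hom.ext_one_left _ _
  have g₂ : SimplexCategory.δ 0 ≫ SimplexCategory.σ 1 ≫ SimplexCategory.mkOfSucc (0 : Fin (s + 1)) =
    SimplexCategory.const ⦋1⦌ ⦋s + 1⦌ 1 := SimplexCategory.Hom.ext_one_left _ _
  have g₃ : SimplexCategory.δ 1 ≫ SimplexCategory.σ 1 ≫ SimplexCategory.mkOfSucc (0 : Fin (s + 1)) =
    SimplexCategory.mkOfSucc 0 := SimplexCategory.Hom.ext_one_left _ _
  have k₁ : SimplexCategory.δ 2 ≫ SimplexCategory.σ (1 : Fin 2) = 𝟙 _ :=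
    SimplexCategory.Hom.ext_one_left _ _
  have k₂ : SimplexCategory.δ 0 ≫ SimplexCategory.σ (1 : Fin 2) =
    SimplexCategory.const ⦋1⦌ ⦋0⦌ 0 ≫ SimplexCategory.δ 0 := SimplexCategory.Hom.ext_one_left _ _
  have k₃ : SimplexCategory.δ 1 ≫ SimplexCategory.σ (1 : Fin 2) = 𝟙 _ :=
    SimplexCategory.Hom.ext_one_left _ _
  have l₁ : SimplexCategory.δ 2 ≫ SimplexCategory.σ (0 : Fin 2) =
    SimplexCategory.const ⦋1⦌ ⦋0⦌ 0 ≫ SimplexCategory.δ 1 := SimplexCategory.Hom.ext_one_left _ _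
  have l₂ : SimplexCategory.δ 0 ≫ SimplexCategory.σ (0 : Fin 2) = 𝟙 _ :=
    SimplexCategory.Hom.ext_one_left _ _
  have l₃ : SimplexCategory.δ 1 ≫ SimplexCategory.σ (0 : Fin 2) = 𝟙 _ :=
    SimplexCategory.Hom.ext_one_left _ _
  rw [f₁, f₂, f₃, k₁, k₂, k₃] at t₁
  rw [g₁, g₂, g₃, l₁, l₂, l₃] at t₂
  have t := congrArg (fun x => ((Multiplicative.toAdd x : ℤ) : ℚ)) (t₁.trans t₂.symm)
  simp only [toAdd_mul, Int.cast_add] at t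
  simp only [Fin.val_zero, Fin.val_one, pow_zero, pow_one]
  linear_combination
    y (SSet.yonedaEquiv (SSet.stdSimplex.map (SimplexCategory.δ 0) ≫ κ.1.2)) * (-1) * t


/-- The pull-back of cochains from the base to the bottom row of the double complex. -/
def basePullback {Γ : Type} [Group Γ] (ι : A →* Γ) (s : ℕ) :
    (doubleClassifyingSpace A _⦋s⦌ → ℚ) →ₗ[ℚ] (twistedDouble ι).C s 0 :=
  cochainPullback (serreEval (twistedProj ι) ≫ twistedProj ι) s

section

variable {Γ : Type} [Group Γ] {ι : A →* Γ} (hι : ∀ a g, ι a * g = g * ι a)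

instance subsingleton_classifyingSpace_zero : Subsingleton (classifyingSpace Γ _⦋0⦌) :=
  (barEquiv Γ 0).symm.injective.subsingleton

include hι in
lemma basePullback_injective (s : ℕ) : Function.Injective (basePullback ι s) := by
  rw [injective_iff_map_eq_zero]
  intro y hy
  refine eq_zero_of_productCochain_mem hι (n := 0) (m := fun _ => 1) ?_
    (((cochainPullback_serreEval_eq_productCochain hι y).symm.trans hy :))
  intro h
  have := congrFun (h : (fun _ => 1 : classifyingSpace Γ _⦋0⦌ → ℚ) = 0) (barSimplex Fin.elim0)
  simp at this

lemma dh_basePullback {s : ℕ} (y : doubleClassifyingSpace A _⦋s⦌ → ℚ) :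
    (twistedDouble ι).dh s 0 (basePullback ι s y) = basePullback ι (s + 1) (coboundary _ s y) :=
  coboundary_cochainPullback (serreEval (twistedProj ι) ≫ twistedProj ι) s y

include hι in
lemma dv_basePullback {s : ℕ} (y : doubleClassifyingSpace A _⦋s⦌ → ℚ) :
    (twistedDouble ι).dv s 0 (basePullback ι s y) = 0 := by
  refine (serreDouble_dv_eq_zero _).2 ?_
  have h : basePullback ι s y = _ := cochainPullback_serreEval_eq_productCochain hι y
  rw [h]
  refine (coboundary_sectionCochain hι _).trans (funext fun κ => ?_)
  rw [sectionCochain, coboundary_zero_classifyingSpace]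
  rfl

-- `BΓ` has a single vertex and there are no nonzero coboundaries in degree 0, so a vertical cocycle
-- of the bottom row depends on the base simplex only.
include hι in
lemma exists_eq_basePullback {s : ℕ} {c : (twistedDouble ι).C s 0}
    (hc : (twistedDouble ι).dv s 0 c = 0) : ∃ y, c = basePullback ι s y := by
  obtain ⟨y, hy⟩ := exists_sub_productCochain_mem hι (m := fun _ => 1)
    (fun c _ => ⟨c (barSimplex Fin.elim0), funext fun x => by
      rw [Subsingleton.elim x (barSimplex Fin.elim0)]; simp⟩)
    ((serreDouble_dv_eq_zero _).1 hc)
  exact ⟨y, (sub_eq_zero.1 hy).trans (cochainPullback_serreEval_eq_productCochain hι y).symm⟩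

end

lemma DoubleComplex.tot_single {D : DoubleComplex} (i n : ℕ) (c : D.C i n) :
    D.tot (DoubleComplex.single i n c) = DoubleComplex.single (i + 1) n (D.dh i n c) +
      DoubleComplex.single i (n + 1) (D.dv i n c) := by
  ext i' n'
  by_cases h₁ : i' = i + 1 ∧ n' = n
  · obtain ⟨rfl, rfl⟩ := h₁
    rw [tot_single_right, Pi.add_apply, Pi.add_apply, single_self, single_of_ne _ (by omega),
      add_zero]
  by_cases h₂ : i' = i ∧ n' = n + 1
  · obtain ⟨rfl, rfl⟩ := h₂
    rw [tot_single_up, Pi.add_apply, Pi.add_apply, single_self, single_of_ne _ (by omega),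
      zero_add]
  · rw [Pi.add_apply, Pi.add_apply, single_of_ne _ (by omega), single_of_ne _ (by omega), add_zero]
    rcases i' with _ | i' <;> rcases n' with _ | n' <;> simp only [tot]
    · rw [single_of_ne _ (by omega), map_zero]
    · rw [single_of_ne _ (by omega), map_zero]
    · rw [single_of_ne _ (by omega), single_of_ne _ (by omega), map_zero, map_zero, add_zero]

lemma DoubleComplex.single_zero {D : DoubleComplex} (i n : ℕ) :
    DoubleComplex.single i n (0 : D.C i n) = 0 := by
  simp [DoubleComplex.single]

lemma DoubleComplex.single_add {D : DoubleComplex} {i n : ℕ} (c c' : D.C i n) :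
    DoubleComplex.single i n (c + c') = DoubleComplex.single i n c + DoubleComplex.single i n c' := by
  simp [DoubleComplex.single, Pi.single_add]

/-- The transgression cochain, in the bottom row of the double complex. -/
def eulerTransgressionRow {s : ℕ} (y : doubleClassifyingSpace A _⦋s⦌ → ℚ) :
    (twistedDouble χ).C (s + 1) 0 :=
  cochainPullback (serreEval (twistedProj χ)) (s + 1) (eulerTransgression χ y)

/-- The product with the fundamental class of the fibre. -/
def circleProduct {s : ℕ} (y : doubleClassifyingSpace A _⦋s⦌ → ℚ) : (twistedDouble χ).C s 1 :=
  productCochain (commute_of_comm χ) y circleCochain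

lemma dh_eulerTransgressionRow {s : ℕ} {y : doubleClassifyingSpace A _⦋s⦌ → ℚ}
    (hy : y ∈ cocycles (doubleClassifyingSpace A) s) :
    (twistedDouble χ).dh (s + 1) 0 (eulerTransgressionRow χ y) =
      basePullback χ (s + 2) (eulerCup χ y) :=
  (coboundary_cochainPullback (serreEval (twistedProj χ)) (s + 1) (eulerTransgression χ y)).trans
    (congrArg _ (coboundary_eulerTransgression χ hy))

lemma dh_circleProduct {s : ℕ} {y : doubleClassifyingSpace A _⦋s⦌ → ℚ}
    (hy : y ∈ cocycles (doubleClassifyingSpace A) s) :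
    (twistedDouble χ).dh s 1 (circleProduct χ y) +
      (twistedDouble χ).dv (s + 1) 0 ((-1 : ℚ) ^ s • eulerTransgressionRow χ y) = 0 := by
  have h : (twistedDouble χ).dh s 1 (circleProduct χ y) =
      coboundary (serreFibre (twistedProj χ) ⦋s + 1⦌) 0 (eulerTransgressionRow χ y) :=
    coboundaryBase_productCochain_circleCochain χ hy
  have h' : (twistedDouble χ).dv (s + 1) 0 (eulerTransgressionRow χ y) =
      (-1 : ℚ) ^ (s + 1) • (twistedDouble χ).dh s 1 (circleProduct χ y) := by
    rw [h]
    rfl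
  rw [map_smul, h', smul_smul, ← pow_add, show s + (s + 1) = 2 * s + 1 by ring, pow_succ, pow_mul]
  simp

lemma dv_circleProduct {s : ℕ} (y : doubleClassifyingSpace A _⦋s⦌ → ℚ) :
    (twistedDouble χ).dv s 1 (circleProduct χ y) = 0 := by
  refine (serreDouble_dv_eq_zero _).2 ?_
  refine (coboundary_sectionCochain (commute_of_comm χ)
    fun s' => y (SSet.yonedaEquiv s') • circleCochain).trans (funext fun κ => ?_)
  have h : coboundary (classifyingSpace (Multiplicative ℤ)) 1 circleCochain = 0 :=
    circleCochain_mem_cocycles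
  rw [sectionCochain, map_smul, h, smul_zero]
  rfl

lemma eulerCup_smul {s : ℕ} (r : ℚ) (y : doubleClassifyingSpace A _⦋s⦌ → ℚ) :
    eulerCup χ (r • y) = r • eulerCup χ y :=
  funext fun _ => mul_left_comm _ _ _

/-- A class which vanishes on the circle bundle with Euler class `χ` is a multiple of the
Euler class. -/
lemma exists_sub_eulerCup_mem {s : ℕ} {y : doubleClassifyingSpace A _⦋s + 2⦌ → ℚ}
    (hy : y ∈ cocycles (doubleClassifyingSpace A) (s + 2))
    (hy' : cochainPullback (twistedProj χ) (s + 2) y ∈ coboundaries (twistedSpace χ) (s + 2)) :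
    ∃ y' ∈ cocycles (doubleClassifyingSpace A) s,
      y - eulerCup χ y' ∈ coboundaries (doubleClassifyingSpace A) (s + 2) := by
  have hχ := commute_of_comm χ
  have hdy : (twistedDouble χ).dh (s + 2) 0 (basePullback χ (s + 2) y) = 0 := by
    have hy₀ : coboundary _ (s + 2) y = 0 := hy
    rw [dh_basePullback, hy₀, map_zero]
  -- Placed in the bottom row, the pull-back of `y` is a total cocycle, and by assumption the total
  -- coboundary of some `t`.
  obtain ⟨t, ht, htz⟩ := (serreRowContraction (twistedProj χ)).exists_tot_eq (N := s + 2)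
    (DoubleComplex.isHomogeneous_single rfl (basePullback χ (s + 2) y))
    (by rw [DoubleComplex.tot_single, hdy, dv_basePullback hχ, DoubleComplex.single_zero,
      DoubleComplex.single_zero, add_zero]) (by
      rw [DoubleComplex.single_self, serreDouble_hBoundaries]
      exact cochainPullback_mem_coboundaries (serreEval (twistedProj χ)) _ _ hy')
  -- As the fibre is a circle, `t` may be taken to have leading entry `y' × [S¹]` at `(s, 1)`,
  -- leaving only the entry at `(s + 1, 0)`.
  obtain ⟨w, -, hwt, y', hwy⟩ := exists_sub_tot_eq_productCochain hχ (d := 1) (s := s) (t := t)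
    (fun _ h => cocycles_le_coboundaries_int h) (fun _ h => exists_sub_smul_circleCochain_mem h)
    (fun i n h => ht i n (by omega))
    (fun i hi n => by rw [htz]; exact DoubleComplex.single_of_ne _ (by omega))
    (by rw [htz]; exact DoubleComplex.single_of_ne _ (by omega))
  have hu : (twistedDouble χ).tot (t - (twistedDouble χ).tot w) =
      DoubleComplex.single (s + 2) 0 (basePullback χ (s + 2) y) := by
    rw [DoubleComplex.tot_sub, DoubleComplex.tot_tot, sub_zero]
    exact htz
  generalize t - (twistedDouble χ).tot w = u at hwt hwy hu
  have hu₁ : (twistedDouble χ).tot u (s + 1) 1 = 0 := by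
    rw [hu]
    exact DoubleComplex.single_of_ne _ (by omega)
  have hu₂ : (twistedDouble χ).dh (s + 1) 0 (u (s + 1) 0) = basePullback χ (s + 2) y := by
    refine (congrFun (congrFun hu (s + 2)) 0).trans (DoubleComplex.single_self _ _ _)
  have hy'c : y' ∈ cocycles (doubleClassifyingSpace A) s := by
    have h := productCochain_coboundary_sub_tot_mem hχ circleCochain_mem_cocycles hwy hu₁
    exact eq_zero_of_productCochain_mem hχ circleCochain_notMem_coboundaries
      ((congrArg (· ∈ coboundaries _ 1) (sub_zero _)).mp h)
  -- The entry at `(s + 1, 0)` and the signed transgression of `y'` have the same vertical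
  -- differential, so they differ by a cochain `c` of the base. Applying `dh` gives `y = ±(e ∪ y') +
  -- δc`.
  obtain ⟨c, hc⟩ := exists_eq_basePullback hχ
    (c := u (s + 1) 0 - (-1 : ℚ) ^ s • eulerTransgressionRow χ y') (by
      have h := dh_circleProduct χ hy'c
      have h' : (twistedDouble χ).dh s 1 (circleProduct χ y') +
        (twistedDouble χ).dv (s + 1) 0 (u (s + 1) 0) = 0 :=
        (congrArg (fun a => (twistedDouble χ).dh s 1 a + _) hwy.symm).trans hu₁
      rw [map_sub, sub_eq_zero]
      exact add_left_cancel (h'.trans h.symm))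
  refine ⟨(-1 : ℚ) ^ s • y', Submodule.smul_mem _ _ hy'c, c, basePullback_injective hχ _ ?_⟩
  rw [← dh_basePullback, ← hc, map_sub, map_smul, hu₂, dh_eulerTransgressionRow χ hy'c,
    eulerCup_smul, map_sub, map_smul]

end Transgression

end

section

/-! ### Circle bundles with a section of the character -/

section Cut

variable {A N : Type} [CommGroup A] [CommGroup N]

/-- The product of two simplices of `B²A`. -/
def mulCocycle {n : SimplexCategoryᵒᵖ} (a b : (doubleClassifyingSpace A).obj n) :
    (doubleClassifyingSpace A).obj n :=
  ⟨fun τ => a.1 τ * b.1 τ, fun i e => by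
    simpa only [mul_one] using congrArg₂ (· * ·) (a.2.1 i e) (b.2.1 i e), fun θ => by
    simpa only [mul_mul_mul_comm] using congrArg₂ (· * ·) (a.2.2 θ) (b.2.2 θ)⟩

/-- The coboundary of a normalised `1`-cochain. -/
def cochainCoboundary {n : SimplexCategoryᵒᵖ} (γ : (⦋1⦌ ⟶ n.unop) → N)
    (hγ : ∀ v : ⦋0⦌ ⟶ n.unop, γ (SimplexCategory.σ 0 ≫ v) = 1) :
    (doubleClassifyingSpace N).obj n :=
  ⟨fun τ => γ (SimplexCategory.δ 2 ≫ τ) * γ (SimplexCategory.δ 0 ≫ τ) *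
    (γ (SimplexCategory.δ 1 ≫ τ))⁻¹, fun i e => by
      have h₀ (f : ⦋1⦌ ⟶ ⦋1⦌) (hf : f.toOrderHom 0 = f.toOrderHom 1) : γ (f ≫ e) = 1 := by
        have : f ≫ e = SimplexCategory.σ 0 ≫ SimplexCategory.δ 0 ≫ f ≫ e := by
          rw [← Category.assoc (SimplexCategory.δ 0), ← Category.assoc]
          exact congrArg (· ≫ e) (SimplexCategory.Hom.ext_one_left _ _ hf rfl)
        rw [this, hγ]
      simp only [← Category.assoc]
      fin_cases i
      · have h₁ : SimplexCategory.δ 0 ≫ SimplexCategory.σ (0 : Fin 2) = 𝟙 _ :=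
          SimplexCategory.Hom.ext_one_left _ _
        have h₂ : SimplexCategory.δ 1 ≫ SimplexCategory.σ (0 : Fin 2) = 𝟙 _ :=
          SimplexCategory.Hom.ext_one_left _ _
        simp only [Fin.zero_eta, h₁, h₂]
        rw [h₀ (SimplexCategory.δ 2 ≫ SimplexCategory.σ 0) rfl, one_mul, mul_inv_cancel]
      · have h₁ : SimplexCategory.δ 2 ≫ SimplexCategory.σ (1 : Fin 2) = 𝟙 _ :=
          SimplexCategory.Hom.ext_one_left _ _
        have h₂ : SimplexCategory.δ 1 ≫ SimplexCategory.σ (1 : Fin 2) = 𝟙 _ :=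
          SimplexCategory.Hom.ext_one_left _ _
        simp only [Fin.mk_one, h₁, h₂]
        rw [h₀ (SimplexCategory.δ 0 ≫ SimplexCategory.σ 1) rfl, mul_one, mul_inv_cancel],
    fun θ => by
      have e₁ : SimplexCategory.δ 2 ≫ SimplexCategory.δ (0 : Fin 4) ≫ θ =
        SimplexCategory.δ 0 ≫ SimplexCategory.δ 3 ≫ θ := by
        simp only [← Category.assoc]
        exact congrArg (· ≫ θ) (SimplexCategory.Hom.ext_one_left _ _)
      have e₂ : SimplexCategory.δ 0 ≫ SimplexCategory.δ (0 : Fin 4) ≫ θ =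
        SimplexCategory.δ 0 ≫ SimplexCategory.δ 1 ≫ θ := by
        simp only [← Category.assoc]
        exact congrArg (· ≫ θ) (SimplexCategory.Hom.ext_one_left _ _)
      have e₃ : SimplexCategory.δ 1 ≫ SimplexCategory.δ (0 : Fin 4) ≫ θ =
        SimplexCategory.δ 0 ≫ SimplexCategory.δ 2 ≫ θ := by
        simp only [← Category.assoc]
        exact congrArg (· ≫ θ) (SimplexCategory.Hom.ext_one_left _ _)
      have e₄ : SimplexCategory.δ 2 ≫ SimplexCategory.δ (2 : Fin 4) ≫ θ =
        SimplexCategory.δ 2 ≫ SimplexCategory.δ 3 ≫ θ := by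
        simp only [← Category.assoc]
        exact congrArg (· ≫ θ) (SimplexCategory.Hom.ext_one_left _ _)
      have e₅ : SimplexCategory.δ 1 ≫ SimplexCategory.δ (2 : Fin 4) ≫ θ =
        SimplexCategory.δ 1 ≫ SimplexCategory.δ 1 ≫ θ := by
        simp only [← Category.assoc]
        exact congrArg (· ≫ θ) (SimplexCategory.Hom.ext_one_left _ _)
      have e₆ : SimplexCategory.δ 2 ≫ SimplexCategory.δ (1 : Fin 4) ≫ θ =
        SimplexCategory.δ 1 ≫ SimplexCategory.δ 3 ≫ θ := by
        simp only [← Category.assoc]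
        exact congrArg (· ≫ θ) (SimplexCategory.Hom.ext_one_left _ _)
      simp only [e₁, e₂, e₃, e₄, e₅, e₆]
      refine Additive.ofMul.injective ?_
      simp only [ofMul_mul, ofMul_inv]
      abel⟩

/-- The restriction of a `1`-cochain to the part of a simplex where `t = 1`. -/
def cutCochain {n : SimplexCategory} (t : n ⟶ ⦋1⦌) (γ : (⦋1⦌ ⟶ n) → N) (e : ⦋1⦌ ⟶ n) : N :=
  if ((e ≫ t).toOrderHom 0 : Fin 2) = 1 then γ e else 1

lemma cutCochain_σ {n : SimplexCategory} (t : n ⟶ ⦋1⦌) {γ : (⦋1⦌ ⟶ n) → N}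
    (hγ : ∀ v : ⦋0⦌ ⟶ n, γ (SimplexCategory.σ 0 ≫ v) = 1) (v : ⦋0⦌ ⟶ n) :
    cutCochain t γ (SimplexCategory.σ 0 ≫ v) = 1 := by
  rw [cutCochain, hγ, ite_self]

variable (χ : A →* N) (σ : N →* A)

/-- The endomorphism `a ↦ a / σ (χ a)`. -/
def killing : A →* A where
  toFun a := a * (σ (χ a))⁻¹
  map_one' := by simp
  map_mul' a b := by simp [mul_mul_mul_comm, mul_comm]

variable {χ σ} (hσ : ∀ m, χ (σ m) = m)

include hσ in
lemma character_killing (a : A) : χ (killing χ σ a) = 1 := by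
  simp [killing, hσ]

/-- The map of the circle bundle of `χ` induced by `killing`. -/
def killingMap : twistedSpace χ ⟶ twistedSpace χ where
  app n := ↾fun x => ⟨(fun _ => 1, (doubleClassifyingMap (killing χ σ)).app n x.1.2),
    fun _ => rfl, fun τ => by
      change 1 * 1 = χ (killing χ σ (x.1.2.1 τ)) * 1
      rw [character_killing hσ]⟩

/-- The map `killingMap` is homotopic to the identity. -/
def killingHomotopy : SSet.Homotopy (killingMap hσ) (𝟙 (twistedSpace χ)) :=
  homotopyOfFamily _ _
    -- The 2-cocycle is `killing(a) · σ(δγ_t)`, with `γ_t` the cut cochain; `χ` maps it to `δγ_t`,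
    -- as required. At `t = 1` it is `a`, because `δγ = χ ∘ a`.
    (fun n x t => ⟨(cutCochain t x.1.1, mulCocycle ((doubleClassifyingMap (killing χ σ)).app n x.1.2)
      ((doubleClassifyingMap σ).app n (cochainCoboundary (cutCochain t x.1.1)
        (cutCochain_σ t x.2.1)))), cutCochain_σ t x.2.1, fun τ => by
        change _ = χ (killing χ σ (x.1.2.1 τ) * σ (_ * _ * _)) * _
        rw [map_mul, character_killing hσ, hσ, one_mul, inv_mul_cancel_right]⟩)
    (fun {n n'} φ x t => rfl)
    (fun n x => by
      have h : cutCochain (SimplexCategory.const n.unop ⦋1⦌ 0) x.1.1 = fun _ => 1 :=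
        funext fun e => if_neg (by exact zero_ne_one (α := Fin 2))
      refine Subtype.ext (Prod.ext h (Subtype.ext (funext fun τ => ?_)))
      change killing χ σ (x.1.2.1 τ) * σ (cutCochain _ _ _ * cutCochain _ _ _ *
        (cutCochain _ _ _)⁻¹) = killing χ σ (x.1.2.1 τ)
      rw [h]
      simp)
    (fun n x => by
      have h : cutCochain (SimplexCategory.const n.unop ⦋1⦌ 1) x.1.1 = x.1.1 :=
        funext fun e => if_pos rfl
      refine Subtype.ext (Prod.ext h (Subtype.ext (funext fun τ => ?_)))
      change killing χ σ (x.1.2.1 τ) * σ (cutCochain _ _ _ * cutCochain _ _ _ *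
        (cutCochain _ _ _)⁻¹) = x.1.2.1 τ
      rw [h, x.2.2 τ, mul_inv_cancel_right]
      exact inv_mul_cancel_right _ _)

include hσ in
/-- A class and its pull-back under `killing` agree on the circle bundle. -/
lemma cochainPullback_killing_sub_mem {s : ℕ} {y : doubleClassifyingSpace A _⦋s⦌ → ℚ}
    (hy : y ∈ cocycles (doubleClassifyingSpace A) s) :
    cochainPullback (twistedProj χ) s
      (y - cochainPullback (doubleClassifyingMap (killing χ σ)) s y) ∈
      coboundaries (twistedSpace χ) s := by
  have h := Submodule.neg_mem _ (sub_mem_coboundaries_of_homotopy (killingHomotopy hσ)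
    (cochainPullback_mem_cocycles (twistedProj χ) s y hy))
  rwa [neg_sub] at h

end Cut

/-- The coboundary of a constant cochain is zero in even degrees and the same constant in odd
degrees. So a constant cocycle of odd degree is zero, and one of positive even degree is the
coboundary of the constant below it. -/
lemma mem_coboundaries_of_eq {X : SSet.{0}} {n : ℕ} {c : X _⦋n + 1⦌ → ℚ}
    (hc : c ∈ cocycles X (n + 1)) {r : ℚ} (h : ∀ x, c x = r) : c ∈ coboundaries X (n + 1) := by
  have hδ (m : ℕ) (r : ℚ) (x : X _⦋m + 1⦌) : coboundary X m (fun _ => r) x =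
      (if Even m then 0 else 1) * r := by
    rw [coboundary_apply, ← Finset.sum_mul, Fin.sum_neg_one_pow]
    simp [Nat.even_add]
  obtain rfl : c = fun _ => r := funext h
  by_cases hn : Even n
  · refine ⟨0, funext fun x => ?_⟩
    have h := congrFun hc (X.σ 0 x)
    rw [hδ, if_neg (by simpa [Nat.even_add_one] using hn), one_mul] at h
    rw [map_zero, h]
    rfl
  · refine ⟨fun _ => r, funext fun x => ?_⟩
    rw [hδ, if_neg hn, one_mul]

/-- For `χ = σ = id` the endomorphism `killing` is trivial, so `killingHomotopy` contracts the total
space to a point. -/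
lemma mem_coboundaries_twistedSpace_id {N : Type} [CommGroup N] {n : ℕ}
    {c : twistedSpace (MonoidHom.id N) _⦋n + 1⦌ → ℚ}
    (hc : c ∈ cocycles (twistedSpace (MonoidHom.id N)) (n + 1)) :
    c ∈ coboundaries (twistedSpace (MonoidHom.id N)) (n + 1) := by
  have hid : ∀ m : N, MonoidHom.id N (MonoidHom.id N m) = m := fun _ => rfl
  have h₁ := sub_mem_coboundaries_of_homotopy (killingHomotopy hid) hc
  have h₂ : cochainPullback (killingMap hid) (n + 1) c ∈ coboundaries _ (n + 1) := by
    refine mem_coboundaries_of_eq (cochainPullback_mem_cocycles _ _ c hc)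
      (r := c ⟨(fun _ => 1, ⟨fun _ => 1, fun _ _ => rfl, fun _ => rfl⟩), fun _ => rfl,
        fun _ => rfl⟩) fun x => ?_
    refine congrArg c (Subtype.ext (Prod.ext rfl (Subtype.ext (funext fun τ => ?_))))
    exact mul_inv_cancel _
  have h₃ := Submodule.sub_mem _ h₂ h₁
  rwa [sub_sub_cancel] at h₃

/-- Multiplication by the Euler class is injective on the cohomology of `K(ℤ, 2)`. -/
lemma mem_coboundaries_of_eulerCup_mem {s : ℕ}
    {y : doubleClassifyingSpace (Multiplicative ℤ) _⦋s⦌ → ℚ}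
    (hy : y ∈ cocycles (doubleClassifyingSpace (Multiplicative ℤ)) s)
    (hy' : eulerCup (MonoidHom.id _) y ∈
      coboundaries (doubleClassifyingSpace (Multiplicative ℤ)) (s + 2)) :
    y ∈ coboundaries (doubleClassifyingSpace (Multiplicative ℤ)) s := by
  obtain ⟨c, hc⟩ := hy'
  let χ := MonoidHom.id (Multiplicative ℤ)
  have hχ := commute_of_comm χ
  have hq : cochainPullback (serreEval (twistedProj χ)) (s + 1)
      ((-1 : ℚ) ^ s • (eulerTransgression χ y - cochainPullback (twistedProj χ) (s + 1) c)) =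
      ((-1 : ℚ) ^ s • (eulerTransgressionRow χ y - basePullback χ (s + 1) c) :
        (twistedDouble χ).C (s + 1) 0) := rfl
  -- The transgression of `y` and the pull-back of `c` both have coboundary `e ∪ y`, so their
  -- difference is a cocycle, hence a coboundary, on the contractible total space.
  have hb : ((-1 : ℚ) ^ s • (eulerTransgressionRow χ y - basePullback χ (s + 1) c) :
        (twistedDouble χ).C (s + 1) 0) ∈ (twistedDouble χ).hBoundaries (s + 1) 0 := by
    rw [← hq, serreDouble_hBoundaries]
    refine cochainPullback_mem_coboundaries (serreEval (twistedProj χ)) _ _ ?_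
    refine Submodule.smul_mem _ _ (mem_coboundaries_twistedSpace_id ?_)
    change coboundary _ _ _ = 0
    rw [map_sub, coboundary_eulerTransgression χ hy, coboundary_cochainPullback, hc, sub_self]
  have hv : (twistedDouble χ).dv (s + 1) 0 ((-1 : ℚ) ^ s •
      (eulerTransgressionRow χ y - basePullback χ (s + 1) c)) =
      (twistedDouble χ).dv (s + 1) 0 ((-1 : ℚ) ^ s • eulerTransgressionRow χ y) := by
    rw [map_smul, map_sub, dv_basePullback hχ, sub_zero, map_smul]
  have hh : (twistedDouble χ).dh (s + 1) 0 ((-1 : ℚ) ^ s •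
      (eulerTransgressionRow χ y - basePullback χ (s + 1) c)) = 0 := by
    rw [map_smul, map_sub, dh_eulerTransgressionRow χ hy, dh_basePullback, hc, sub_self, smul_zero]
  generalize ((-1 : ℚ) ^ s • (eulerTransgressionRow χ y - basePullback χ (s + 1) c) :
        (twistedDouble χ).C (s + 1) 0) = q at hb hv hh
  -- `y × [S¹]` is completed by `q` to a total cocycle whose bottom entry is a boundary; it is
  -- therefore a total coboundary, and its leading term becomes a boundary in the base.
  obtain ⟨t, ht⟩ : ∃ t, t = DoubleComplex.single s 1 (circleProduct χ y) +
    DoubleComplex.single (s + 1) 0 q := ⟨_, rfl⟩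
  have htot : (twistedDouble χ).tot t = 0 := by
    rw [ht, DoubleComplex.tot_add, DoubleComplex.tot_single, DoubleComplex.tot_single, hh,
      dv_circleProduct, DoubleComplex.single_zero, DoubleComplex.single_zero, add_zero, zero_add]
    refine (DoubleComplex.single_add (i := s + 1) (n := 1) _ _).symm.trans ?_
    rw [hv, dh_circleProduct χ hy, DoubleComplex.single_zero]
  have hhom : (twistedDouble χ).IsHomogeneous (s + 1) t := by
    rw [ht]
    exact (DoubleComplex.isHomogeneous_single rfl _).add
      (DoubleComplex.isHomogeneous_single (add_zero _) _)
  have ht₁ : t s 1 = circleProduct χ y := by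
    rw [ht, Pi.add_apply, Pi.add_apply, DoubleComplex.single_self,
      DoubleComplex.single_of_ne _ (by omega), add_zero]
  have ht₀ : t (s + 1) 0 = q := by
    rw [ht, Pi.add_apply, Pi.add_apply, DoubleComplex.single_self,
      DoubleComplex.single_of_ne _ (by omega), zero_add]
  have ht₂ (i n) (h : i < s) : t i n = 0 := by
    rw [ht, Pi.add_apply, Pi.add_apply, DoubleComplex.single_of_ne _ (by omega),
      DoubleComplex.single_of_ne _ (by omega), zero_add]
  obtain ⟨w, hw, hwt⟩ := (serreRowContraction (twistedProj χ)).exists_tot_eq hhom htot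
    (by rw [ht₀]; exact hb)
  cases s with
  | zero =>
    -- In degree 0 there is no column to the left: `y × [S¹]` is a vertical coboundary, so `y = 0`.
    refine eq_zero_of_productCochain_mem hχ circleCochain_notMem_coboundaries ?_
    refine (serreDouble_dv_mem _).1 ⟨w 0 0, ?_⟩
    exact (congrFun (congrFun hwt 0) 1).trans ht₁
  | succ s =>
    -- After normalisation the primitive has leading term `b × [S¹]`; comparing entries at `(s + 1,
    -- 1)` gives `δb = y`.
    obtain ⟨v, -, hwv, b, hb⟩ := exists_sub_tot_eq_productCochain hχ (d := 1) (s := s) (t := w)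
      (fun _ h => cocycles_le_coboundaries_int h) (fun _ h => exists_sub_smul_circleCochain_mem h)
      (fun i n h => hw i n (by omega))
      (fun i hi n => by rw [hwt]; exact ht₂ _ _ (by omega))
      (by rw [hwt]; exact ht₂ _ _ (by omega))
    have hu : (twistedDouble χ).tot (w - (twistedDouble χ).tot v) = t := by
      rw [DoubleComplex.tot_sub, DoubleComplex.tot_tot, sub_zero]
      exact hwt
    have h := productCochain_coboundary_sub_tot_mem hχ circleCochain_mem_cocycles hb
      ((congrFun (congrFun hu (s + 1)) 1).trans ht₁)
    rw [circleProduct, ← productCochain_sub] at h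
    exact ⟨b, sub_eq_zero.1
      (eq_zero_of_productCochain_mem hχ circleCochain_notMem_coboundaries h)⟩

end

section

/-! ### Polynomial functions on the integers -/

section Polynomial

variable {V W : Type} [AddCommGroup V] [Module ℚ V] [AddCommGroup W] [Module ℚ W]

variable (V) in
/-- The polynomial functions on the integers with values in a vector space. -/
def polynomialFunctions : Submodule ℚ (ℤ → V) :=
  Submodule.span ℚ {f | ∃ (k : ℕ) (v : V), f = fun n : ℤ => (n : ℚ) ^ k • v}

lemma const_mem_polynomialFunctions (v : V) : (fun _ => v) ∈ polynomialFunctions V :=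
  Submodule.subset_span ⟨0, v, by simp⟩

lemma intCast_smul_mem_polynomialFunctions {f : ℤ → V} (hf : f ∈ polynomialFunctions V) :
    (fun n : ℤ => (n : ℚ) • f n) ∈ polynomialFunctions V := by
  induction hf using Submodule.span_induction with
  | mem f h =>
    obtain ⟨k, v, rfl⟩ := h
    exact Submodule.subset_span ⟨k + 1, v, by simp [pow_succ', smul_smul]⟩
  | zero =>
    rw [show (fun n : ℤ => (n : ℚ) • (0 : ℤ → V) n) = 0 by ext; simp]
    exact Submodule.zero_mem _
  | add f g _ _ hf hg => simpa [smul_add] using! Submodule.add_mem _ hf hg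
  | smul r f _ hf =>
    rw [show (fun n : ℤ => (n : ℚ) • (r • f) n) = r • fun n : ℤ => (n : ℚ) • f n from
      funext fun n => smul_comm (n : ℚ) r (f n)]
    exact Submodule.smul_mem _ r hf

lemma comp_mem_polynomialFunctions (ℓ : V →ₗ[ℚ] W) {f : ℤ → V} (hf : f ∈ polynomialFunctions V) :
    (fun n => ℓ (f n)) ∈ polynomialFunctions W := by
  induction hf using Submodule.span_induction with
  | mem f h =>
    obtain ⟨k, v, rfl⟩ := h
    exact Submodule.subset_span ⟨k, ℓ v, by simp⟩
  | zero =>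
    rw [show (fun n : ℤ => ℓ ((0 : ℤ → V) n)) = 0 by ext; simp]
    exact Submodule.zero_mem _
  | add f g _ _ hf hg => simpa using! Submodule.add_mem _ hf hg
  | smul r f _ hf => simpa using! Submodule.smul_mem _ r hf

lemma exists_polynomial {f : ℤ → ℚ} (hf : f ∈ polynomialFunctions ℚ) :
    ∃ p : Polynomial ℚ, ∀ n : ℤ, f n = p.eval (n : ℚ) := by
  induction hf using Submodule.span_induction with
  | mem f h =>
    obtain ⟨k, v, rfl⟩ := h
    exact ⟨Polynomial.C v * Polynomial.X ^ k, fun n => by simpa using mul_comm _ _⟩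
  | zero => exact ⟨0, by simp⟩
  | add f g _ _ hf hg =>
    obtain ⟨p, hp⟩ := hf
    obtain ⟨q, hq⟩ := hg
    exact ⟨p + q, by simp [hp, hq]⟩
  | smul r f _ hf =>
    obtain ⟨p, hp⟩ := hf
    exact ⟨r • p, by simp [hp]⟩

/-- Each linear functional turns `f` into a polynomial with infinitely many roots, so the
exceptional point `m` is forced to be a zero too. -/
lemma eq_zero_of_polynomialFunctions {f : ℤ → V} (hf : f ∈ polynomialFunctions V) {m : ℤ}
    (h : ∀ n, n ≠ m → f n = 0) (n : ℤ) : f n = 0 := by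
  rw [← Module.forall_dual_apply_eq_zero_iff ℚ]
  intro ℓ
  obtain ⟨p, hp⟩ := exists_polynomial (comp_mem_polynomialFunctions ℓ hf)
  have hp₀ : p = 0 := by
    refine Polynomial.eq_zero_of_infinite_isRoot p (Set.Infinite.mono ?_
      ((Set.finite_singleton m).infinite_compl.image (f := fun n : ℤ => (n : ℚ))
        (Int.cast_injective.injOn)))
    rintro _ ⟨n, hn, rfl⟩
    change p.eval (n : ℚ) = 0
    rw [← hp, h n hn, map_zero]
  rw [hp n, hp₀, Polynomial.eval_zero]

end Polynomial

/-! ### Detecting cohomology classes of `B²A` on cyclic subgroups -/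

section Detection

variable {A A' A'' : Type} [CommGroup A''] [CommGroup A'] [CommGroup A]

/-- The map induced by a homomorphism on the cohomology of `B²A`. -/
abbrev pullback (φ : A' →* A) (s : ℕ) :
    Cohomology (doubleClassifyingSpace A) s →ₗ[ℚ] Cohomology (doubleClassifyingSpace A') s :=
  cohomologyMap (doubleClassifyingMap φ) s

lemma cohomologyMap_comp {X Y Z : SSet.{0}} (f : X ⟶ Y) (g : Y ⟶ Z) (s : ℕ)
    (z : Cohomology Z s) :
    cohomologyMap (f ≫ g) s z = cohomologyMap f s (cohomologyMap g s z) := by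
  obtain ⟨z, rfl⟩ := Submodule.mkQ_surjective _ z
  rfl

lemma pullback_comp (φ : A' →* A) (ψ : A'' →* A') (s : ℕ)
    (y : Cohomology (doubleClassifyingSpace A) s) :
    pullback (φ.comp ψ) s y = pullback ψ s (pullback φ s y) :=
  cohomologyMap_comp (doubleClassifyingMap ψ) (doubleClassifyingMap φ) s y

lemma pullback_id (s : ℕ) (y : Cohomology (doubleClassifyingSpace A) s) :
    pullback (MonoidHom.id A) s y = y := by
  obtain ⟨z, rfl⟩ := Submodule.mkQ_surjective _ y
  rfl

/-- Multiplication by the Euler class of a character, on cochains. -/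
def eulerCupLinear (χ : A →* Multiplicative ℤ) (s : ℕ) :
    (doubleClassifyingSpace A _⦋s⦌ → ℚ) →ₗ[ℚ] (doubleClassifyingSpace A _⦋s + 2⦌ → ℚ) where
  toFun y := eulerCup χ y
  map_add' _ _ := funext fun _ => mul_add _ _ _
  map_smul' r y := eulerCup_smul χ r y

lemma eulerCup_mem_cocycles (χ : A →* Multiplicative ℤ) {s : ℕ}
    {y : doubleClassifyingSpace A _⦋s⦌ → ℚ} (hy : y ∈ cocycles (doubleClassifyingSpace A) s) :
    eulerCup χ y ∈ cocycles (doubleClassifyingSpace A) (s + 2) := by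
  have hy' : coboundary _ s y = 0 := hy
  refine (coboundary_eulerCup χ y).trans ?_
  rw [hy']
  exact map_zero (eulerCupLinear χ (s + 1))

lemma eulerCup_mem_coboundaries (χ : A →* Multiplicative ℤ) {s : ℕ}
    {y : doubleClassifyingSpace A _⦋s⦌ → ℚ} (hy : y ∈ coboundaries (doubleClassifyingSpace A) s) :
    eulerCup χ y ∈ coboundaries (doubleClassifyingSpace A) (s + 2) := by
  cases s with
  | zero =>
    obtain rfl : y = 0 := hy
    exact ⟨0, (map_zero _).trans (map_zero (eulerCupLinear χ 0)).symm⟩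
  | succ s =>
    obtain ⟨b, rfl⟩ := hy
    exact ⟨eulerCup χ b, coboundary_eulerCup χ b⟩

/-- Multiplication by the Euler class of a character. -/
def eulerMul (χ : A →* Multiplicative ℤ) (s : ℕ) :
    Cohomology (doubleClassifyingSpace A) s →ₗ[ℚ] Cohomology (doubleClassifyingSpace A) (s + 2) :=
  Submodule.mapQ _ _ ((eulerCupLinear χ s).restrict fun _ hy => eulerCup_mem_cocycles χ hy)
    (fun _ hy => eulerCup_mem_coboundaries χ hy)

lemma pullback_eulerMul (φ : A' →* A) (χ : A →* Multiplicative ℤ) (s : ℕ)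
    (y : Cohomology (doubleClassifyingSpace A) s) :
    pullback φ (s + 2) (eulerMul χ s y) = eulerMul (χ.comp φ) s (pullback φ s y) := by
  obtain ⟨z, rfl⟩ := Submodule.mkQ_surjective _ y
  rfl

/-- The degree of an endomorphism of `ℤ`. -/
def degree (χ : Multiplicative ℤ →* Multiplicative ℤ) : ℤ :=
  Multiplicative.toAdd (χ (Multiplicative.ofAdd 1))

lemma eulerMul_eq_degree_smul (χ : Multiplicative ℤ →* Multiplicative ℤ) (s : ℕ)
    (y : Cohomology (doubleClassifyingSpace (Multiplicative ℤ)) s) :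
    eulerMul χ s y = (degree χ : ℚ) • eulerMul (MonoidHom.id _) s y := by
  obtain ⟨z, rfl⟩ := Submodule.mkQ_surjective _ y
  refine congrArg (cohomologyClass _ _) (Subtype.ext (funext fun a => ?_))
  change (Multiplicative.toAdd (χ _) : ℤ) * _ = (degree χ : ℚ) *
    ((Multiplicative.toAdd (a.1 (frontFace 2 s)) : ℤ) * _)
  rw [← mul_assoc, ← Int.cast_mul]
  congr 2
  obtain ⟨k, hk⟩ := Multiplicative.ofAdd.surjective (a.1 (frontFace 2 s))
  rw [← hk, degree]
  have h : Multiplicative.ofAdd k = Multiplicative.ofAdd 1 ^ k := by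
    rw [← ofAdd_zsmul, smul_eq_mul, mul_one]
  rw [h, map_zpow, toAdd_zpow, toAdd_zpow]
  simp [mul_comm]

lemma eulerMul_id_injective (s : ℕ) :
    Function.Injective (eulerMul (MonoidHom.id (Multiplicative ℤ)) s) := by
  rw [injective_iff_map_eq_zero]
  intro y hy
  obtain ⟨z, rfl⟩ := Submodule.mkQ_surjective _ y
  exact (cohomologyClass_eq_zero z).2 (mem_coboundaries_of_eulerCup_mem z.2
    ((cohomologyClass_eq_zero (⟨_, eulerCup_mem_cocycles _ z.2⟩ : cocycles _ (s + 2))).1 hy))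

/-- The classes `y` and `killing^* y` agree on the circle bundle of `χ`, so their difference is a
multiple of its Euler class. This decomposition replaces a computation of the cohomology ring. -/
lemma exists_eq_pullback_killing_add {χ : A →* Multiplicative ℤ} {σ : Multiplicative ℤ →* A}
    (hσ : ∀ m, χ (σ m) = m) {s : ℕ} (y : Cohomology (doubleClassifyingSpace A) (s + 2)) :
    ∃ y', y = pullback (killing χ σ) (s + 2) y + eulerMul χ s y' := by
  obtain ⟨z, rfl⟩ := Submodule.mkQ_surjective _ y
  obtain ⟨y', hy', h⟩ := exists_sub_eulerCup_mem χ (Submodule.sub_mem _ z.2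
    (cochainPullback_mem_cocycles (doubleClassifyingMap (killing χ σ)) _ z.1 z.2))
    (cochainPullback_killing_sub_mem hσ z.2)
  refine ⟨cohomologyClass _ _ ⟨y', hy'⟩, ?_⟩
  refine (cohomologyClass_eq_iff z (⟨_, cochainPullback_mem_cocycles (doubleClassifyingMap
    (killing χ σ)) _ z.1 z.2⟩ + ⟨_, eulerCup_mem_cocycles χ hy'⟩)).2 ?_
  rw [sub_sub] at h
  exact h

/-- The classes of `B²A` are detected on cyclic subgroups, on which they depend polynomially. -/
def IsDetected (A : Type) [CommGroup A] (s : ℕ) : Prop :=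
  (∀ (y : Cohomology (doubleClassifyingSpace A) s) (g h : Multiplicative ℤ →* A),
    (fun n : ℤ => pullback (g * h ^ n) s y) ∈ polynomialFunctions _) ∧
  ∀ y : Cohomology (doubleClassifyingSpace A) s,
    (∀ g : Multiplicative ℤ →* A, pullback g s y = 0) → y = 0

lemma isDetected_zero : IsDetected A 0 := by
  constructor
  · intro y g h
    have e : (fun n : ℤ => pullback (g * h ^ n) 0 y) = fun _ => pullback 1 0 y := by
      obtain ⟨z, rfl⟩ := Submodule.mkQ_surjective _ y
      refine funext fun n => congrArg (cohomologyClass _ _) (Subtype.ext (funext fun a => ?_))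
      exact congrArg z.1 (Subsingleton.elim _ _)
    rw [e]
    exact const_mem_polynomialFunctions _
  · intro y hy
    have h := hy 1
    obtain ⟨z, rfl⟩ := Submodule.mkQ_surjective _ y
    refine (cohomologyClass_eq_zero z).2 (funext fun a => ?_)
    have h' := congrFun ((cohomologyClass_eq_zero (⟨_, cochainPullback_mem_cocycles
      (doubleClassifyingMap (1 : Multiplicative ℤ →* A)) 0 z.1 z.2⟩ : cocycles _ 0)).1 h)
      ⟨fun _ => 1, fun _ _ => rfl, fun _ => rfl⟩
    rw [Subsingleton.elim a]
    exact h'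

instance subsingleton_cohomology_one : Subsingleton (Cohomology (doubleClassifyingSpace A) 1) := by
  refine subsingleton_of_forall_eq 0 fun y => ?_
  obtain ⟨z, rfl⟩ := Submodule.mkQ_surjective _ y
  refine (cohomologyClass_eq_zero z).2 ⟨0, funext fun a => ?_⟩
  have h := congrFun z.2 ((doubleClassifyingSpace A).σ 0 a)
  rw [coboundary_apply, Fin.sum_univ_three] at h
  have e (i : Fin 3) : (doubleClassifyingSpace A).δ i ((doubleClassifyingSpace A).σ 0 a) = a :=
    Subsingleton.elim (α := doubleClassifyingSpace A _⦋1⦌) _ a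
  rw [e, e, e] at h
  rw [map_zero]
  simp only [Fin.val_zero, Fin.val_one, Fin.val_two] at h
  change (0 : ℚ) = z.1 a
  have h' : (0 : doubleClassifyingSpace A _⦋2⦌ → ℚ) ((doubleClassifyingSpace A).σ 0 a) = 0 := rfl
  have h'' := h.trans h'
  linarith

lemma isDetected_one : IsDetected A 1 := by
  refine ⟨fun y g h => ?_, fun y _ => Subsingleton.elim _ _⟩
  rw [Subsingleton.elim (fun n : ℤ => pullback (g * h ^ n) 1 y) fun _ => 0]
  exact const_mem_polynomialFunctions _

/-- Induction on the degree in steps of two, using `y = killing^* y + e y'`. The first summand comes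
from `A'`; on a cyclic subgroup `g` the class `e` becomes the degree of `χ ∘ g` times the Euler
class of `ℤ`. This degree is affine in `n` along `g * h ^ n`, so polynomiality passes from `y'` to
`y`; it is then used to prove detection. -/
lemma IsDetected.of_retract {χ : A →* Multiplicative ℤ} {σ : Multiplicative ℤ →* A}
    (hσ : ∀ m, χ (σ m) = m) {i : A' →* A} {r : A →* A'} (hir : killing χ σ = i.comp r)
    (h : ∀ s, IsDetected A' s) (s : ℕ) : IsDetected A s := by
  induction s using Nat.twoStepInduction with
  | zero => exact isDetected_zero
  | one => exact isDetected_one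
  | more s ih _ =>
    have hdeg (g h : Multiplicative ℤ →* A) (n : ℤ) :
        degree (χ.comp (g * h ^ n)) = degree (χ.comp g) + n * degree (χ.comp h) := by
      simp [degree]
    constructor
    · intro y g h'
      obtain ⟨y', hy'⟩ := exists_eq_pullback_killing_add hσ y
      have e : (fun n : ℤ => pullback (g * h' ^ n) (s + 2) y) =
          (fun n : ℤ => pullback ((r.comp g) * (r.comp h') ^ n) (s + 2) (pullback i _ y)) +
          ((degree (χ.comp g) : ℚ) • (fun n : ℤ => eulerMul (MonoidHom.id _) s
              (pullback (g * h' ^ n) s y')) +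
            (degree (χ.comp h') : ℚ) • fun n : ℤ => (n : ℚ) • eulerMul (MonoidHom.id _) s
              (pullback (g * h' ^ n) s y')) := by
        refine funext fun n => ?_
        have e₁ : (r.comp g) * (r.comp h') ^ n = r.comp (g * h' ^ n) := by
          ext; simp
        conv_lhs => rw [hy']
        rw [map_add, hir, pullback_eulerMul, eulerMul_eq_degree_smul, hdeg, ← pullback_comp,
          Pi.add_apply, e₁, ← pullback_comp]
        simp only [Pi.add_apply, Pi.smul_apply, smul_smul, ← add_smul, MonoidHom.comp_assoc]
        push_cast
        rw [mul_comm (n : ℚ)]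
      rw [e]
      have h₁ := comp_mem_polynomialFunctions (eulerMul (MonoidHom.id _) s) (ih.1 y' g h')
      exact Submodule.add_mem _ ((h (s + 2)).1 _ _ _) (Submodule.add_mem _
        (Submodule.smul_mem _ _ h₁)
        (Submodule.smul_mem _ _ (intCast_smul_mem_polynomialFunctions h₁)))
    · intro y hy
      obtain ⟨y', hy'⟩ := exists_eq_pullback_killing_add hσ y
      have h₁ : pullback i (s + 2) y = 0 := (h (s + 2)).2 _ fun g => by
        rw [← pullback_comp, hy]
      rw [hir, pullback_comp, h₁, map_zero, zero_add] at hy'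
      -- The Euler class acts injectively on the cohomology of `K(ℤ, 2)`, so `y'` vanishes on every
      -- `g` on which `χ` is nontrivial.
      have h₂ (g : Multiplicative ℤ →* A) (hg : degree (χ.comp g) ≠ 0) : pullback g s y' = 0 := by
        have h₃ := hy g
        rw [hy', pullback_eulerMul, eulerMul_eq_degree_smul] at h₃
        exact eulerMul_id_injective s (((smul_eq_zero_iff_right (Int.cast_ne_zero.2 hg)).1 h₃).trans
          (map_zero _).symm)
      rw [hy', ih.2 y' fun g => ?_, map_zero]
      -- On the line `g * σ ^ n` the degree is `degree (χ.comp g) + n`, zero for a single `n`;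
      -- polynomiality then covers `n = 0`, that is, an arbitrary `g`.
      have h₃ := eq_zero_of_polynomialFunctions (ih.1 y' g σ) (m := -degree (χ.comp g))
        (fun n hn => h₂ _ (by
          have : degree (χ.comp σ) = 1 := by simp [degree, hσ]
          rw [hdeg, this]
          omega)) 0
      simpa using h₃

lemma isDetected_of_subsingleton [Subsingleton A] (s : ℕ) : IsDetected A s := by
  constructor
  · intro y g h
    have (n : ℤ) : g * h ^ n = 1 := MonoidHom.ext fun _ => Subsingleton.elim _ _
    simp only [this]
    exact const_mem_polynomialFunctions _
  · intro y hy
    have h : MonoidHom.id A = (1 : Multiplicative ℤ →* A).comp 1 :=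
      MonoidHom.ext fun _ => Subsingleton.elim _ _
    rw [← pullback_id s y, h, pullback_comp, hy, map_zero]

/-- Splitting off coordinate 0, `killing` factors through the other `r` coordinates. -/
lemma isDetected_pi (r s : ℕ) : IsDetected (Fin r → Multiplicative ℤ) s := by
  induction r generalizing s with
  | zero => exact isDetected_of_subsingleton s
  | succ r ih =>
    refine IsDetected.of_retract (A' := Fin r → Multiplicative ℤ)
      (χ := Pi.evalMonoidHom _ 0) (σ := MonoidHom.mulSingle (fun _ : Fin (r + 1) => Multiplicative ℤ) 0) (fun m => by simp)
      (i := ⟨⟨fun a => Fin.cons 1 a, by ext k; refine Fin.cases ?_ ?_ k <;> simp⟩, fun a b => by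
        ext k; refine Fin.cases ?_ ?_ k <;> simp⟩)
      (r := ⟨⟨Fin.tail, rfl⟩, fun a b => rfl⟩) ?_ ih s
    refine MonoidHom.ext fun a => funext fun k => ?_
    refine Fin.cases ?_ (fun k => ?_) k <;> simp [killing]
    rfl

lemma IsDetected.of_equiv (e : A ≃* A') {s : ℕ} (h : IsDetected A s) : IsDetected A' s := by
  constructor
  · intro y g h'
    have := h.1 (pullback e.toMonoidHom s y) (e.symm.toMonoidHom.comp g)
      (e.symm.toMonoidHom.comp h')
    simp only [← pullback_comp] at this
    convert this using 4 with n
    ext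
    simp
  · intro y hy
    have h₁ : pullback e.toMonoidHom s y = 0 := h.2 _ fun g => by rw [← pullback_comp, hy]
    have h₂ : e.toMonoidHom.comp e.symm.toMonoidHom = MonoidHom.id A' := by ext; simp
    rw [← pullback_id s y, ← h₂, pullback_comp, h₁, map_zero]

end Detection

end

section

/-! ### Reduction to finitely generated groups -/

section Chains

variable (k : Type) [CommRing k]

/-- The boundary of chains. -/
def boundary (X : SSet.{0}) (n : ℕ) : (X _⦋n + 1⦌ →₀ k) →ₗ[k] (X _⦋n⦌ →₀ k) :=
  ∑ i : Fin (n + 2), (-1 : k) ^ (i : ℕ) • Finsupp.lmapDomain k k (fun x => X.δ i x)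

lemma boundary_apply (X : SSet.{0}) (n : ℕ) (z : X _⦋n + 1⦌ →₀ k) :
    boundary k X n z =
      ∑ i : Fin (n + 2), (-1 : k) ^ (i : ℕ) • z.mapDomain (fun x => X.δ i x) := by
  simp [boundary, Finsupp.lmapDomain_apply]

lemma boundary_single (X : SSet.{0}) (n : ℕ) (x : X _⦋n + 1⦌) (r : k) :
    boundary k X n (Finsupp.single x r) =
      ∑ i : Fin (n + 2), (-1 : k) ^ (i : ℕ) • Finsupp.single (X.δ i x) r := by
  simp [boundary, Finsupp.lmapDomain_apply, Finsupp.mapDomain_single]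

lemma linearCombination_boundary (X : SSet.{0}) (n : ℕ) (c : X _⦋n⦌ → ℚ) (z : X _⦋n + 1⦌ →₀ ℚ) :
    Finsupp.linearCombination ℚ c (boundary ℚ X n z) =
      Finsupp.linearCombination ℚ (coboundary X n c) z := by
  induction z using Finsupp.induction_linear with
  | zero => simp
  | add z z' h h' => rw [map_add, map_add, h, h', map_add]
  | single x r =>
    rw [boundary_single, map_sum, Finsupp.linearCombination_single, coboundary_apply,
      smul_eq_mul, Finset.mul_sum]
    refine Finset.sum_congr rfl fun i _ => ?_
    rw [map_smul, Finsupp.linearCombination_single, smul_eq_mul, smul_eq_mul, mul_left_comm]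

/-- Rational cochains are the full dual of chains, so a functional vanishing on cycles factors
through the boundary map. -/
lemma mem_coboundaries_of_linearCombination (X : SSet.{0}) {n : ℕ} {c : X _⦋n + 1⦌ → ℚ}
    (hc : ∀ z, boundary ℚ X n z = 0 → Finsupp.linearCombination ℚ c z = 0) :
    c ∈ coboundaries X (n + 1) := by
  have h : Finsupp.linearCombination ℚ c ∈ LinearMap.range (boundary ℚ X n).dualMap := by
    rw [LinearMap.range_dualMap_eq_dualAnnihilator_ker, Submodule.mem_dualAnnihilator]
    exact fun z hz => hc z hz
  obtain ⟨φ, hφ⟩ := h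
  refine ⟨fun x => φ (Finsupp.single x 1), funext fun x => ?_⟩
  have h := LinearMap.congr_fun hφ (Finsupp.single x 1)
  rw [LinearMap.dualMap_apply, boundary_single] at h
  rw [coboundary_apply]
  simpa only [map_sum, map_smul, smul_eq_mul, Finsupp.linearCombination_single, one_mul] using h

lemma boundary_mapDomain {X Y : SSet.{0}} (f : X ⟶ Y) (n : ℕ) (z : X _⦋n + 1⦌ →₀ ℚ) :
    boundary ℚ Y n (z.mapDomain fun x => f.app (op ⦋n + 1⦌) x) =
      (boundary ℚ X n z).mapDomain fun x => f.app (op ⦋n⦌) x := by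
  induction z using Finsupp.induction_linear with
  | zero => simp
  | add z z' h h' =>
    rw [Finsupp.mapDomain_add, map_add, map_add, h, h', Finsupp.mapDomain_add]
  | single x r =>
    rw [Finsupp.mapDomain_single, boundary_single, boundary_single, Finsupp.mapDomain_finsetSum]
    refine Finset.sum_congr rfl fun i _ => ?_
    rw [Finsupp.mapDomain_smul, Finsupp.mapDomain_single, SSet.δ_naturality_apply]

end Chains

section FinitelyGenerated

variable {A : Type} [CommGroup A]

lemma doubleClassifyingMap_app_injective {A' : Type} [CommGroup A'] {φ : A' →* A}
    (hφ : Function.Injective φ) (n : SimplexCategoryᵒᵖ) :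
    Function.Injective fun x => (doubleClassifyingMap φ).app n x := fun _ _ h =>
  Subtype.ext (funext fun τ => hφ (congrFun (congrArg Subtype.val h) τ))

lemma exists_fg_mem_range (n : ℕ) (S : Finset (doubleClassifyingSpace A _⦋n⦌)) :
    ∃ B : Subgroup A, B.FG ∧
      (S : Set _) ⊆ Set.range fun x => (doubleClassifyingMap B.subtype).app (op ⦋n⦌) x := by
  let T : Set A := ⋃ a ∈ S, Set.range a.1
  refine ⟨Subgroup.closure T, Subgroup.fg_iff _ |>.2 ⟨T, rfl, ?_⟩, fun a ha => ?_⟩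
  · exact S.finite_toSet.biUnion fun a _ => Set.finite_range _
  · have hT (τ : ⦋2⦌ ⟶ ⦋n⦌) : a.1 τ ∈ Subgroup.closure T :=
      Subgroup.subset_closure (Set.mem_biUnion ha ⟨τ, rfl⟩)
    exact ⟨⟨fun τ => ⟨a.1 τ, hT τ⟩, fun i e => Subtype.ext (a.2.1 i e),
      fun θ => Subtype.ext (a.2.2 θ)⟩, rfl⟩

/-- It suffices to evaluate on cycles. A cycle has finite support and involves finitely many
elements of `A`, so it comes from `B²B` with `B` finitely generated; injectivity on simplices makes
it a cycle there. -/
lemma eq_zero_of_forall_fg {s : ℕ} (y : Cohomology (doubleClassifyingSpace A) (s + 1))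
    (hy : ∀ B : Subgroup A, B.FG → pullback B.subtype (s + 1) y = 0) : y = 0 := by
  obtain ⟨c, rfl⟩ := Submodule.mkQ_surjective _ y
  refine (cohomologyClass_eq_zero c).2 (mem_coboundaries_of_linearCombination _ fun z hz => ?_)
  obtain ⟨B, hB, hS⟩ := exists_fg_mem_range (s + 1) z.support
  have hj (n : ℕ) := doubleClassifyingMap_app_injective (φ := B.subtype) Subtype.val_injective
    (op ⦋n⦌)
  obtain ⟨z₀, rfl⟩ : ∃ z₀ : doubleClassifyingSpace B _⦋s + 1⦌ →₀ ℚ,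
      z₀.mapDomain (fun x => (doubleClassifyingMap B.subtype).app (op ⦋s + 1⦌) x) = z :=
    ⟨_, Finsupp.mapDomain_comapDomain _ (hj (s + 1)) z hS⟩
  rw [boundary_mapDomain] at hz
  have hz₀ : boundary ℚ _ s z₀ = 0 :=
    Finsupp.mapDomain_injective (hj s) (hz.trans Finsupp.mapDomain_zero.symm)
  obtain ⟨b, hb⟩ := (cohomologyClass_eq_zero (⟨_, cochainPullback_mem_cocycles
    (doubleClassifyingMap B.subtype) _ c.1 c.2⟩ : cocycles _ (s + 1))).1 (hy B hB)
  rw [Finsupp.linearCombination_mapDomain]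
  refine (congrArg (fun f => Finsupp.linearCombination ℚ f z₀) hb.symm).trans ?_
  rw [← linearCombination_boundary, hz₀, map_zero]

lemma isDetected_of_fg [Group.FG A] (hA : ∀ a : A, IsOfFinOrder a → a = 1) (s : ℕ) :
    IsDetected A s := by
  have : IsMulTorsionFree A := isMulTorsionFree_iff_not_isOfFinOrder.2 fun a ha h => ha (hA a h)
  have : Module.Finite ℤ (Additive A) := Module.Finite.iff_addGroup_fg.2 inferInstance
  have : Module.Free ℤ (Additive A) := inferInstance
  let e := (Module.finBasis ℤ (Additive A)).equivFun.toAddEquiv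
  exact IsDetected.of_equiv (A := Fin _ → Multiplicative ℤ) (MulEquiv.symm
    ⟨⟨fun a i => Multiplicative.ofAdd (e (Additive.ofMul a) i),
      fun f => (e.symm fun i => (f i).toAdd).toMul, fun a => by simp, fun f => by simp⟩,
      fun a b => by ext; simp⟩) (isDetected_pi _ s)

lemma eq_zero_of_forall_pullback (hA : ∀ a : A, IsOfFinOrder a → a = 1) (s : ℕ)
    (y : Cohomology (doubleClassifyingSpace A) s)
    (hy : ∀ g : Multiplicative ℤ →* A, pullback g s y = 0) : y = 0 := by
  cases s with
  | zero => exact isDetected_zero.2 y hy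
  | succ s =>
    refine eq_zero_of_forall_fg y fun B hB => ?_
    have : Group.FG B := (Group.fg_iff_subgroup_fg B).2 hB
    refine (isDetected_of_fg (fun b hb => ?_) (s + 1)).2 _ fun g => ?_
    · exact Subtype.ext (hA b ((Submonoid.isOfFinOrder_coe).2 hb))
    · rw [← pullback_comp, hy]

/-- On a nontrivial torsion-free abelian group, rational classes of `B²A` are detected on
infinite cyclic subgroups. -/
theorem eq_zero_of_forall_not_isOfFinOrder [Nontrivial A] (hA : ∀ a : A, IsOfFinOrder a → a = 1)
    (s : ℕ) (y : Cohomology (doubleClassifyingSpace A) s)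
    (hy : ∀ a : A, ¬ IsOfFinOrder a → pullback (zpowersHom A a) s y = 0) : y = 0 := by
  refine eq_zero_of_forall_pullback hA s y fun g => ?_
  obtain ⟨a, rfl⟩ := (zpowersHom A).surjective g
  -- An element of finite order is 1, so the trivial homomorphism is left. It is the value at `n =
  -- 0` of the polynomial `n ↦ (b ^ n)^* y`, with `b` of infinite order, and this vanishes for `n ≠
  -- 0`.
  by_cases ha : IsOfFinOrder a
  · obtain rfl := hA a ha
    obtain ⟨b, hb⟩ := exists_ne (1 : A)
    have hb' : ¬ IsOfFinOrder b := fun h => hb (hA b h)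
    have hd : IsDetected (Multiplicative ℤ) s :=
      isDetected_of_fg (fun a ha => ha.eq_one') s
    have h := eq_zero_of_polynomialFunctions
      (hd.1 (pullback (zpowersHom A b) s y) 1 (MonoidHom.id _)) (m := 0) (fun n hn => ?_) 0
    · rw [← pullback_comp] at h
      have e : (zpowersHom A b).comp (1 * MonoidHom.id _ ^ (0 : ℤ)) = zpowersHom A 1 := by
        ext
        simp [zpowersHom_apply]
      rw [← e, h]
    · rw [← pullback_comp]
      have e : (zpowersHom A b).comp (1 * MonoidHom.id _ ^ n) = zpowersHom A (b ^ n) := by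
        ext
        simp [zpowersHom_apply]
      rw [e]
      refine hy _ fun h => hb' ?_
      rw [isOfFinOrder_iff_zpow_eq_one] at h ⊢
      obtain ⟨m, hm, h⟩ := h
      exact ⟨n * m, mul_ne_zero hn hm, by rw [zpow_mul, h]⟩
  · exact hy a ha

end FinitelyGenerated

end

section

/-! ### Simplicial modules are Kan complexes -/

section Kan

variable {k : Type} [CommRing k] (M : SimplicialObject (ModuleCat.{0} k))

/-- Faces of a horn agree on their common faces. -/
def IsHorn {n : ℕ} (l : Fin (n + 3)) (x : Fin (n + 3) → M _⦋n + 1⦌) : Prop :=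
  ∀ i j : Fin (n + 2), i ≤ j → i.castSucc ≠ l → j.succ ≠ l →
    M.δ i (x j.succ) = M.δ j (x i.castSucc)

variable {M}

lemma δ_σ_of_le {n : ℕ} {i : Fin (n + 2)} {j : Fin (n + 1)} (h : i ≤ j.castSucc)
    (x : M _⦋n + 1⦌) : M.δ i.castSucc (M.σ j.succ x) = M.σ j (M.δ i x) :=
  ConcreteCategory.congr_hom (M.δ_comp_σ_of_le h) x

lemma δ_σ_of_gt {n : ℕ} {i : Fin (n + 2)} {j : Fin (n + 1)} (h : j.castSucc < i)
    (x : M _⦋n + 1⦌) : M.δ i.succ (M.σ j.castSucc x) = M.σ j (M.δ i x) :=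
  ConcreteCategory.congr_hom (M.δ_comp_σ_of_gt h) x

lemma δ_σ_self {n : ℕ} (i : Fin (n + 1)) (x : M _⦋n⦌) : M.δ i.castSucc (M.σ i x) = x :=
  ConcreteCategory.congr_hom M.δ_comp_σ_self x

lemma δ_σ_succ {n : ℕ} (i : Fin (n + 1)) (x : M _⦋n⦌) : M.δ i.succ (M.σ i x) = x :=
  ConcreteCategory.congr_hom M.δ_comp_σ_succ x

lemma δ_δ {n : ℕ} {i j : Fin (n + 2)} (h : i ≤ j) (x : M _⦋n + 2⦌) :
    M.δ i (M.δ j.succ x) = M.δ j (M.δ i.castSucc x) :=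
  ConcreteCategory.congr_hom (M.δ_comp_δ h) x

namespace IsHorn

variable {n : ℕ} {l : Fin (n + 3)} {x : Fin (n + 3) → M _⦋n + 1⦌}

/-- Moore's argument: if the faces of `y` below `m` are right, subtracting `σ_m (d_m y - x_m)`
corrects face `m`, and the horn condition shows that the correction has zero faces below `m`. -/
lemma exists_lower (hx : IsHorn M l x) (m : ℕ) (hm : m ≤ l) :
    ∃ y : M _⦋n + 2⦌, ∀ i : Fin (n + 3), (i : ℕ) < m → M.δ i y = x i := by
  induction m with
  | zero => exact ⟨0, fun i hi => absurd hi (Nat.not_lt_zero _)⟩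
  | succ m ih =>
    obtain ⟨y, hy⟩ := ih (by omega)
    let j : Fin (n + 2) := ⟨m, by omega⟩
    refine ⟨y - M.σ j (M.δ j.castSucc y - x j.castSucc), fun i hi => ?_⟩
    rw [map_sub]
    rcases Nat.lt_succ_iff_lt_or_eq.1 hi with hi | hi
    · obtain ⟨i, rfl⟩ := i.eq_castSucc_of_ne_last (by
        rintro rfl
        have := l.2
        simp at hi
        omega)
      have hj : j ≠ 0 := by
        intro h
        have : m = 0 := congrArg Fin.val h
        omega
      obtain ⟨j', hj'⟩ := Fin.exists_succ_eq.2 hj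
      have hi' : (i : ℕ) < m := hi
      have hij : i ≤ j'.castSucc := by
        have : (j' : ℕ) + 1 = m := congrArg Fin.val hj'
        rw [Fin.le_def, Fin.val_castSucc]
        omega
      have hne : i.castSucc ≠ l := fun h => by
        have : (i : ℕ) = l := congrArg Fin.val h
        omega
      have hne' : j'.castSucc.succ ≠ l := fun h => by
        have : (j' : ℕ) + 1 = l := congrArg Fin.val h
        have : (j' : ℕ) + 1 = m := congrArg Fin.val hj'
        omega
      rw [← hj', δ_σ_of_le hij, map_sub, ← Fin.succ_castSucc, δ_δ hij, hx _ _ hij hne hne',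
        hy _ hi, sub_self, map_zero, sub_zero]
    · obtain rfl : i = j.castSucc := Fin.ext hi
      rw [δ_σ_self, sub_sub_cancel]

/-- The same correction from the top face downwards: the faces above `l` of index at least `n + 3 -
m` are treated, and those below `l` remain correct. -/
lemma exists_upper (hx : IsHorn M l x) (m : ℕ) :
    ∃ y : M _⦋n + 2⦌, ∀ i : Fin (n + 3), i < l ∨ (l < i ∧ n + 3 ≤ (i : ℕ) + m) →
      M.δ i y = x i := by
  induction m with
  | zero =>
    obtain ⟨y, hy⟩ := hx.exists_lower l le_rfl
    refine ⟨y, fun i hi => hy i ?_⟩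
    rcases hi with hi | hi
    · exact hi
    · have := i.2
      omega
  | succ m ih =>
    obtain ⟨y, hy⟩ := ih
    by_cases hm : (l : ℕ) + 1 + m ≤ n + 2
    swap
    · refine ⟨y, fun i hi => hy i (hi.imp_right fun h => ⟨h.1, ?_⟩)⟩
      have : (l : ℕ) < i := h.1
      omega
    let j : Fin (n + 2) := ⟨n + 1 - m, by omega⟩
    have hj : (j : ℕ) = n + 1 - m := rfl
    have hlj : l ≤ j.castSucc := by
      rw [Fin.le_def, Fin.val_castSucc]
      omega
    have hne' : j.succ ≠ l := fun h => by
      have : (j : ℕ) + 1 = l := congrArg Fin.val h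
      omega
    refine ⟨y - M.σ j (M.δ j.succ y - x j.succ), fun i hi => ?_⟩
    rw [map_sub]
    by_cases hij : i = j.succ
    · subst hij
      rw [δ_σ_succ, sub_sub_cancel]
    have hi' : i < l ∨ (l < i ∧ n + 3 ≤ (i : ℕ) + m) := by
      refine hi.imp_right fun h => ⟨h.1, ?_⟩
      have : (i : ℕ) ≠ j + 1 := fun h => hij (Fin.ext h)
      omega
    rw [hy i hi']
    rcases hi' with hil | ⟨hli, him⟩
    · have hil' : (i : ℕ) < l := hil
      have hlj' : (l : ℕ) ≤ j := hlj
      obtain ⟨i, rfl⟩ := i.eq_castSucc_of_ne_last (by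
        rintro rfl
        have := l.2
        simp at hil'
        omega)
      rw [Fin.val_castSucc] at hil'
      obtain ⟨j', hj'⟩ := Fin.exists_succ_eq.2 (show j ≠ 0 by
        intro h
        have : (j : ℕ) = 0 := congrArg Fin.val h
        omega)
      have hji : (j' : ℕ) + 1 = j := congrArg Fin.val hj'
      have hij : i ≤ j'.castSucc := by
        rw [Fin.le_def, Fin.val_castSucc]
        omega
      have hij' : i ≤ j := by
        rw [Fin.le_def]
        omega
      have h := δ_σ_of_le hij (M.δ j.succ y - x j.succ)
      rw [hj'] at h
      rw [h, map_sub, δ_δ hij', hx _ _ hij' hil.ne hne', hy _ (Or.inl hil), sub_self, map_zero,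
        sub_zero]
    · have hi₂ := i.2
      have hli' : (l : ℕ) < i := hli
      obtain ⟨i, rfl⟩ := Fin.exists_succ_eq.2 (show i ≠ 0 by
        rintro rfl
        simp at hli')
      rw [Fin.val_succ] at him
      obtain ⟨j', hj'⟩ := Fin.exists_castSucc_eq.2 (show j ≠ Fin.last _ by
        intro h
        have : (j : ℕ) = n + 1 := congrArg Fin.val h
        have := i.2
        omega)
      have hji : (j' : ℕ) = j := congrArg Fin.val hj'
      have hij : j'.castSucc < i := by
        rw [Fin.lt_def, Fin.val_castSucc]
        omega
      have hij' : j'.succ ≤ i := by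
        rw [Fin.le_def, Fin.val_succ]
        omega
      have h := δ_σ_of_gt hij (M.δ j.succ y - x j.succ)
      rw [hj'] at h
      have e : j.succ = j'.succ.castSucc := Fin.ext (by simp [hji])
      rw [h, map_sub, e, ← δ_δ hij', ← hx _ _ hij' (e ▸ hne') hli.ne', hy _ (Or.inr ⟨hli, him⟩),
        sub_self, map_zero, sub_zero]

lemma exists_filler (hx : IsHorn M l x) :
    ∃ y : M _⦋n + 2⦌, ∀ i : Fin (n + 3), i ≠ l → M.δ i y = x i := by
  obtain ⟨y, hy⟩ := hx.exists_upper (n + 3)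
  exact ⟨y, fun i hi => hy i ((lt_or_gt_of_ne hi).imp_right fun h => ⟨h, by omega⟩)⟩

end IsHorn

variable (M) in
/-- The simplicial set underlying a simplicial module. -/
abbrev underlying : SSet.{0} := ((SimplicialObject.whiskering _ _).obj (forget (ModuleCat k))).obj M

/-- Contractibility is tested on maps to Kan complexes; this makes the free simplicial module on `X`
an admissible target. -/
instance kanComplex_underlying : SSet.KanComplex (underlying M) := by
  refine SSet.KanComplex.iff.2 fun n l f hf => ?_
  suffices h : ∃ y : M _⦋n + 1⦌, ∀ j hj, M.δ j y = SSet.yonedaEquiv (f j hj) by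
    obtain ⟨y, hy⟩ := h
    refine ⟨SSet.yonedaEquiv.symm y, fun j hj => SSet.yonedaEquiv.injective ?_⟩
    rw [← hy]
    refine (SSet.yonedaEquiv_naturality (SimplexCategory.δ j) _).symm.trans ?_
    exact congrArg (fun w => (underlying M).map (SimplexCategory.δ j).op w)
      (Equiv.apply_symm_apply (SSet.yonedaEquiv (X := underlying M)) y)
  cases n with
  | zero =>
    rcases Fin.exists_fin_two.1 ⟨l, rfl⟩ with h | h <;> obtain rfl := h
    · refine ⟨M.σ 0 (SSet.yonedaEquiv (f 1 (by simp))), fun j hj => ?_⟩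
      obtain rfl : j = 1 := Fin.eq_one_of_ne_zero j hj
      exact δ_σ_succ (M := M) 0 _
    · refine ⟨M.σ 0 (SSet.yonedaEquiv (f 0 (by simp))), fun j hj => ?_⟩
      obtain rfl : j = 0 := by
        by_contra h
        exact hj (Fin.eq_one_of_ne_zero j h)
      exact δ_σ_self (M := M) 0 _
  | succ n =>
    let x (j : Fin (n + 3)) : M _⦋n + 1⦌ :=
      if hj : j ≠ l then SSet.yonedaEquiv (f j hj) else (0 : M _⦋n + 1⦌)
    have hx' (j) (hj : j ≠ l) : x j = SSet.yonedaEquiv (f j hj) := dif_pos hj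
    have hx : IsHorn M l x := fun i j hij hi hj => by
      rw [hx' _ hi, hx' _ hj]
      have h := hf i.castSucc j.succ hi hj (Fin.castSucc_lt_succ_iff.2 hij)
      rw [Fin.pred_succ, Fin.castPred_castSucc] at h
      have h' := congrArg SSet.yonedaEquiv h
      exact ((SSet.yonedaEquiv_naturality (SimplexCategory.δ i) _).trans h'.symm).trans
        (SSet.yonedaEquiv_naturality (SimplexCategory.δ j) _).symm
    obtain ⟨y, hy⟩ := hx.exists_filler
    exact ⟨y, fun j hj => (hy j hj).trans (hx' j hj)⟩

end Kan

/-! ### Contractible simplicial sets are acyclic -/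

section Acyclic

variable (k : Type) [CommRing k]

/-- The simplicial module of chains. -/
abbrev chains (X : SSet.{0}) : SimplicialObject (ModuleCat.{0} k) :=
  ((SimplicialObject.whiskering _ _).obj (ModuleCat.free k)).obj X

lemma alternatingFaceMapComplex_chains_d (X : SSet.{0}) (n : ℕ) :
    ((AlgebraicTopology.alternatingFaceMapComplex _).obj (chains k X)).d (n + 1) n =
      ModuleCat.ofHom (boundary k X n) := by
  rw [AlgebraicTopology.alternatingFaceMapComplex_obj_d,
    AlgebraicTopology.AlternatingFaceMapComplex.objD]
  refine ModuleCat.hom_ext ?_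
  rw [ModuleCat.hom_sum]
  change _ = ∑ i : Fin (n + 2), _
  refine Finset.sum_congr rfl fun i _ => ?_
  rw [ModuleCat.hom_zsmul, ← Int.cast_smul_eq_zsmul k]
  push_cast
  rfl

/-- The inclusion of the basis of simplices. -/
def chainsUnit (X : SSet.{0}) : X ⟶ underlying (chains k X) where
  app n := ↾fun x => (Finsupp.single x 1 : X.obj n →₀ k)
  naturality n n' f := by
    refine ConcreteCategory.hom_ext _ _ fun x => ?_
    exact (Finsupp.mapDomain_single).symm

/-- The augmentation of chains. -/
def augmentation (T : Type) : (T →₀ k) →ₗ[k] k := Finsupp.linearCombination k fun _ => 1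

lemma augmentation_single {T : Type} (t : T) (r : k) :
    augmentation k T (Finsupp.single t r) = r := by
  simp [augmentation]

lemma augmentation_mapDomain {T T' : Type} (f : T → T') (x : T →₀ k) :
    augmentation k T' (x.mapDomain f) = augmentation k T x := by
  simp only [augmentation, Finsupp.linearCombination_mapDomain]
  rfl

lemma augmentation_boundary (X : SSet.{0}) (n : ℕ) (x : X _⦋n + 1⦌ →₀ k) :
    augmentation k _ (boundary k X n x) =
      (if Even (n + 2) then 0 else 1) * augmentation k _ x := by
  simp only [boundary_apply, map_sum, map_smul, augmentation_mapDomain]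
  rw [← Finset.sum_smul, Fin.sum_neg_one_pow, smul_eq_mul]

variable {k} in
/-- The linear extension of the identity to formal linear combinations. -/
def collapse {X : SSet.{0}} (n : ℕ) :
    (underlying (chains k X) _⦋n⦌ →₀ k) →ₗ[k] (X _⦋n⦌ →₀ k) :=
  Finsupp.linearCombination k (M := X _⦋n⦌ →₀ k) (fun x => x)

variable {k}

lemma collapse_single {X : SSet.{0}} (n : ℕ) (x : X _⦋n⦌ →₀ k) (r : k) :
    collapse (X := X) n (Finsupp.single x r) = r • x :=
  Finsupp.linearCombination_single k r x

lemma collapse_boundary {X : SSet.{0}} (n : ℕ) (w : underlying (chains k X) _⦋n + 1⦌ →₀ k) :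
    collapse n (boundary k _ n w) = boundary k X n (collapse (n + 1) w) := by
  induction w using Finsupp.induction_linear with
  | zero => simp
  | add w w' h h' => rw [map_add, map_add, h, h', map_add, map_add]
  | single x r =>
    have key (x : X _⦋n + 1⦌ →₀ k) : boundary k X n (collapse (X := X) (n + 1)
        (Finsupp.single x r)) =
        ∑ i : Fin (n + 2), (-1 : k) ^ (i : ℕ) • r • x.mapDomain (fun x => X.δ i x) := by
      rw [collapse_single, map_smul, boundary_apply, Finset.smul_sum]
      exact Finset.sum_congr rfl fun i _ => smul_comm _ _ _
    refine Eq.trans ?_ (key x).symm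
    rw [boundary_single, map_sum]
    refine Finset.sum_congr rfl fun i _ => ?_
    rw [map_smul]
    exact congrArg _ (collapse_single n _ r)

lemma collapse_mapDomain_chainsUnit {X : SSet.{0}} (n : ℕ) (x : X _⦋n⦌ →₀ k) :
    collapse n (x.mapDomain fun y => (chainsUnit k X).app (op ⦋n⦌) y) = x := by
  induction x using Finsupp.induction_linear with
  | zero => simp
  | add x x' h h' => rw [Finsupp.mapDomain_add, map_add, h, h']
  | single y r =>
    rw [Finsupp.mapDomain_single]
    refine (collapse_single n (Finsupp.single y 1) r).trans ?_
    rw [Finsupp.smul_single, smul_eq_mul, mul_one]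

/-- The degenerate simplices on a vertex of the chains. -/
abbrev constChain {X : SSet.{0}} (z : underlying (chains k X) _⦋0⦌) (n : ℕ) : X _⦋n⦌ →₀ k :=
  (underlying (chains k X)).map (SimplexCategory.const ⦋n⦌ ⦋0⦌ 0).op z

lemma boundary_constChain {X : SSet.{0}} (z : underlying (chains k X) _⦋0⦌) (n : ℕ) :
    boundary k X n (constChain z (n + 1)) = (if Even (n + 2) then 0 else (1 : k)) •
      constChain z n := by
  rw [boundary_apply, ← Fin.sum_neg_one_pow, Finset.sum_smul]
  refine Finset.sum_congr rfl fun i _ => congrArg _ ?_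
  refine (ConcreteCategory.congr_hom ((underlying (chains k X)).map_comp
    (SimplexCategory.const ⦋n + 1⦌ ⦋0⦌ 0).op (SimplexCategory.δ i).op) z).symm.trans ?_
  exact congrArg (fun f => (underlying (chains k X)).map f z)
    (congrArg Quiver.Hom.op (Subsingleton.elim _ _))

lemma collapse_mapDomain_const {X : SSet.{0}} (z : underlying (chains k X) _⦋0⦌) (n : ℕ)
    (x : X _⦋n⦌ →₀ k) :
    collapse n (x.mapDomain fun y => (SSet.const z : X ⟶ _).app (op ⦋n⦌) y) =
      augmentation k _ x • constChain z n := by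
  induction x using Finsupp.induction_linear with
  | zero => simp
  | add x x' h h' => rw [Finsupp.mapDomain_add, map_add, map_add, h, h', add_smul]
  | single y r =>
    rw [augmentation_single, Finsupp.mapDomain_single]
    exact collapse_single n (constChain z n) r

/-- Chains on a contractible simplicial set are exact. -/
lemma exists_boundary_eq {X : SSet.{0}} (hX : IsContractible X) {n : ℕ} {x : X _⦋n + 1⦌ →₀ k}
    (hx : boundary k X n x = 0) : ∃ w, boundary k X (n + 1) w = x := by
  -- The unit `X → k[X]` is homotopic to a constant map, and `collapse` carries the resulting chain
  -- homotopy back to the chains of `X`.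
  obtain ⟨z, ⟨H⟩⟩ := hX.2 _ (chainsUnit k X)
  have h := (H.toSimplicialObjectHomotopy.whiskerRight (ModuleCat.free k)).toChainHomotopy
  let B (i j : ℕ) : (X _⦋i⦌ →₀ k) →ₗ[k] (underlying (chains k X) _⦋j⦌ →₀ k) := (h.hom i j).hom
  have := h.comm (n + 1)
  rw [dNext_eq (i' := n) (w := by simp), prevD_eq (j' := n + 2) (w := by simp)] at this
  rw [alternatingFaceMapComplex_chains_d, alternatingFaceMapComplex_chains_d] at this
  have key : (x.mapDomain fun y => (chainsUnit k X).app (op ⦋n + 1⦌) y) =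
      B n (n + 1) (boundary k X n x) + boundary k _ (n + 1) (B (n + 1) (n + 2) x) +
      x.mapDomain fun y => (SSet.const z : X ⟶ _).app (op ⦋n + 1⦌) y :=
    ConcreteCategory.congr_hom this x
  rw [hx, map_zero, zero_add] at key
  have key' := congrArg (collapse (n + 1)) key
  rw [map_add, collapse_boundary, collapse_mapDomain_chainsUnit, collapse_mapDomain_const] at key'
  have hε := augmentation_boundary k X n x
  rw [hx, map_zero] at hε
  -- The constant map contributes the augmentation of `x` times a degenerate chain. In odd degree `n
  -- + 1` this is itself a boundary; in even degree a cycle has augmentation zero.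
  by_cases hn : Even (n + 2)
  · refine ⟨collapse (n + 2) (B (n + 1) (n + 2) x) +
      augmentation k _ x • constChain z (n + 2), ?_⟩
    have hn' : ¬ Even (n + 1 + 2) := by
      rw [show n + 1 + 2 = n + 2 + 1 by omega, Nat.even_add_one, not_not]
      exact hn
    rw [map_add, map_smul, boundary_constChain, if_neg hn', one_smul, ← key']
  · rw [if_neg hn, one_mul] at hε
    rw [← hε, zero_smul, add_zero] at key'
    exact ⟨_, key'.symm⟩

lemma exists_boundary_eq_of_augmentation {X : SSet.{0}} (hX : IsContractible X)
    {x : X _⦋0⦌ →₀ k} (hx : augmentation k _ x = 0) : ∃ w, boundary k X 0 w = x := by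
  obtain ⟨z, ⟨H⟩⟩ := hX.2 _ (chainsUnit k X)
  have h := (H.toSimplicialObjectHomotopy.whiskerRight (ModuleCat.free k)).toChainHomotopy
  let B (i j : ℕ) : (X _⦋i⦌ →₀ k) →ₗ[k] (underlying (chains k X) _⦋j⦌ →₀ k) := (h.hom i j).hom
  have := h.comm 0
  rw [prevD_eq (j' := 1) (w := by simp), dNext_eq_zero _ _ (by simp), zero_add,
    alternatingFaceMapComplex_chains_d] at this
  have key : (x.mapDomain fun y => (chainsUnit k X).app (op ⦋0⦌) y) =
      boundary k _ 0 (B 0 1 x) + x.mapDomain fun y => (SSet.const z : X ⟶ _).app (op ⦋0⦌) y :=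
    ConcreteCategory.congr_hom this x
  have key' := congrArg (collapse 0) key
  rw [map_add, collapse_boundary, collapse_mapDomain_chainsUnit, collapse_mapDomain_const, hx,
    zero_smul, add_zero] at key'
  exact ⟨_, key'.symm⟩

end Acyclic

end

section

/-! ### The resolution given by a free action on a contractible simplicial set -/

section Resolution

variable (k : Type) [CommRing k] {G : Type} [Group G] {Y : SSet.{0}} (ρ : G →* Aut Y)

lemma action_one {n : SimplexCategoryᵒᵖ} (y : Y.obj n) : (ρ 1).hom.app n y = y := by
  rw [map_one]
  rfl

lemma action_mul (g h : G) {n : SimplexCategoryᵒᵖ} (y : Y.obj n) :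
    (ρ (g * h)).hom.app n y = (ρ g).hom.app n ((ρ h).hom.app n y) := by
  rw [map_mul]
  rfl

lemma action_map (g : G) {n n' : SimplexCategoryᵒᵖ} (f : n ⟶ n') (y : Y.obj n) :
    Y.map f ((ρ g).hom.app n y) = (ρ g).hom.app n' (Y.map f y) :=
  (ConcreteCategory.congr_hom ((ρ g).hom.naturality f) y).symm

/-- The representation on the chains of a fixed degree. -/
def chainRepresentation (n : SimplexCategoryᵒᵖ) : Representation k G (Y.obj n →₀ k) where
  toFun g := Finsupp.lmapDomain k k fun y => (ρ g).hom.app n y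
  map_one' := by
    ext y : 2
    simp
    rfl
  map_mul' g h := by
    ext y : 2
    simp
    rfl

lemma chainRepresentation_single (n : SimplexCategoryᵒᵖ) (g : G) (y : Y.obj n) (r : k) :
    chainRepresentation k ρ n g (Finsupp.single y r) = Finsupp.single ((ρ g).hom.app n y) r :=
  Finsupp.mapDomain_single

/-- The simplicial representation of chains. -/
def chainRep : SimplicialObject (Rep.{0} k G) where
  obj n := Rep.of (chainRepresentation k ρ n)
  map f := Rep.ofHom ⟨Finsupp.lmapDomain k k fun y => Y.map f y, fun g => by
    ext y : 2
    simp [chainRepresentation]⟩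
  map_id n := by
    ext y : 4
    simp
  map_comp f f' := by
    ext y : 4
    simp

/-- The chain complex of representations. -/
abbrev chainRepComplex : ChainComplex (Rep.{0} k G) ℕ :=
  (AlgebraicTopology.alternatingFaceMapComplex _).obj (chainRep k ρ)

variable {k} in
lemma sum_hom_apply {A B : Rep.{0} k G} {ι : Type} (s : Finset ι) (f : ι → (A ⟶ B)) (x : A) :
    (∑ i ∈ s, f i).hom x = ∑ i ∈ s, (f i).hom x := by
  rw [Rep.sum_hom, Representation.IntertwiningMap.sum_apply]

lemma chainRepComplex_d_hom (n : ℕ) (x : Y _⦋n + 1⦌ →₀ k) :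
    ((chainRepComplex k ρ).d (n + 1) n).hom x = boundary k Y n x := by
  rw [AlgebraicTopology.alternatingFaceMapComplex_obj_d,
    AlgebraicTopology.AlternatingFaceMapComplex.objD]
  refine (sum_hom_apply (k := k) (G := G) _ _ _).trans ?_
  rw [boundary_apply]
  refine Finset.sum_congr rfl fun i _ => ?_
  have h (m : ℤ) (x' : Y _⦋n⦌ →₀ k) : m • x' = (m : k) • x' := (Int.cast_smul_eq_zsmul k m x').symm
  refine (h ((-1) ^ (i : ℕ)) _).trans ?_
  push_cast
  rfl

/-- An equivariant map from a free simplicial `G`-set to `G`. -/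
lemma exists_equivariant (hρ : ∀ (g : G) (n : ℕ) (y : Y _⦋n⦌), (ρ g).hom.app (op ⦋n⦌) y = y → g = 1)
    (n : ℕ) : ∃ φ : Y _⦋n⦌ → G, ∀ g y, φ ((ρ g).hom.app (op ⦋n⦌) y) = g * φ y := by
  let r : Setoid (Y _⦋n⦌) :=
    { r y y' := ∃ g, (ρ g).hom.app (op ⦋n⦌) y' = y
      iseqv := ⟨fun y => ⟨1, action_one ρ y⟩, fun {y y'} ⟨g, h⟩ => ⟨g⁻¹, by
        rw [← h, ← action_mul, inv_mul_cancel, action_one]⟩, fun {y y' y''} ⟨g, h⟩ ⟨g', h'⟩ =>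
        ⟨g * g', by rw [action_mul, h', h]⟩⟩ }
  have hr (y : Y _⦋n⦌) : ∃ g, (ρ g).hom.app (op ⦋n⦌) (Quotient.out (Quotient.mk r y)) = y := by
    obtain ⟨g, h⟩ := Quotient.mk_out (s := r) y
    exact ⟨g⁻¹, by rw [← h, ← action_mul, inv_mul_cancel, action_one]⟩
  choose φ hφ using hr
  refine ⟨φ, fun g y => ?_⟩
  have e : Quotient.mk r ((ρ g).hom.app (op ⦋n⦌) y) = Quotient.mk r y := Quotient.sound ⟨g, rfl⟩
  have h₁ := hφ ((ρ g).hom.app (op ⦋n⦌) y)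
  rw [e] at h₁
  have h₂ : (ρ (g * φ y)).hom.app (op ⦋n⦌) (Quotient.out (Quotient.mk r y)) =
      (ρ g).hom.app (op ⦋n⦌) y := by rw [action_mul, hφ]
  have h₃ := hρ ((g * φ y)⁻¹ * φ ((ρ g).hom.app (op ⦋n⦌) y)) n (Quotient.out (Quotient.mk r y)) (by
    rw [action_mul, h₁, ← h₂, ← action_mul, inv_mul_cancel, action_one])
  rwa [inv_mul_eq_one, eq_comm] at h₃

variable {ρ}

lemma chainRepresentation_hom_ext {n : SimplexCategoryᵒᵖ} {M : Rep.{0} k G}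
    {f f' : Rep.of (chainRepresentation k ρ n) ⟶ M}
    (h : ∀ y, f.hom (Finsupp.single y 1) = f'.hom (Finsupp.single y 1)) : f = f' := by
  ext y : 4
  exact h y

/-- Homomorphisms out of the chains. -/
def chainDesc {n : SimplexCategoryᵒᵖ} {M : Rep.{0} k G} (f : Y.obj n → M)
    (hf : ∀ g y, f ((ρ g).hom.app n y) = M.ρ g (f y)) :
    Rep.of (chainRepresentation k ρ n) ⟶ M :=
  Rep.ofHom ⟨Finsupp.linearCombination k f, fun g => by
    ext y : 2
    simp [chainRepresentation, hf]⟩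

lemma chainDesc_single {n : SimplexCategoryᵒᵖ} {M : Rep.{0} k G} (f : Y.obj n → M)
    (hf : ∀ g y, f ((ρ g).hom.app n y) = M.ρ g (f y)) (y : Y.obj n) (r : k) :
    (chainDesc k f hf).hom (Finsupp.single y r) = r • f y :=
  Finsupp.linearCombination_single k r y

/-- Lifts are chosen at the orbit representatives `φ(y)⁻¹ y` and transported by `φ(y)`. -/
lemma projective_chainRep {n : ℕ} {φ : Y _⦋n⦌ → G}
    (hφ : ∀ g y, φ ((ρ g).hom.app (op ⦋n⦌) y) = g * φ y) :
    Projective (Rep.of (chainRepresentation k ρ (op ⦋n⦌))) where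
  factors {E X} f e _ := by
    have he := (Rep.epi_iff_surjective e).1 inferInstance
    refine ⟨chainDesc k (fun y => E.ρ (φ y) (Function.surjInv he
      (f.hom (Finsupp.single ((ρ (φ y)⁻¹).hom.app (op ⦋n⦌) y) 1)))) (fun g y => ?_), ?_⟩
    · rw [hφ, ← action_mul, mul_inv_rev, mul_assoc, inv_mul_cancel, mul_one, map_mul]
      rfl
    · refine chainRepresentation_hom_ext k fun y => ?_
      rw [Rep.hom_comp, Representation.IntertwiningMap.comp_apply, chainDesc_single, one_smul,
        Rep.hom_comm_apply, Function.surjInv_eq he, ← Rep.hom_comm_apply]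
      refine congrArg f.hom ((chainRepresentation_single k ρ _ _ _ _).trans ?_)
      rw [← action_mul, mul_inv_cancel, action_one]

variable (ρ) in
/-- The augmentation, as a morphism of representations. -/
def chainAugmentation (n : SimplexCategoryᵒᵖ) :
    Rep.of (chainRepresentation k ρ n) ⟶ Rep.trivial k G k :=
  chainDesc k (M := Rep.trivial k G k) (fun _ => 1) fun _ _ => rfl

lemma chainAugmentation_hom (n : SimplexCategoryᵒᵖ) (x : Y.obj n →₀ k) :
    (chainAugmentation k ρ n).hom x = augmentation k _ x := rfl

variable {k} in
lemma exact_of_forall {S : ShortComplex (Rep.{0} k G)}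
    (h : ∀ x, S.g.hom x = 0 → ∃ y, S.f.hom y = x) : S.Exact := by
  rw [← ShortComplex.exact_map_iff_of_faithful S (forget₂ (Rep k G) (ModuleCat k)),
    ShortComplex.moduleCat_exact_iff]
  exact h


lemma chainRepComplex_d_comp_augmentation :
    (chainRepComplex k ρ).d 1 0 ≫ chainAugmentation k ρ (op ⦋0⦌) = 0 := by
  refine chainRepresentation_hom_ext k fun y => ?_
  refine (congrArg (chainAugmentation k ρ (op ⦋0⦌)).hom
    (chainRepComplex_d_hom k ρ 0 (Finsupp.single y 1))).trans ?_
  refine (augmentation_boundary k Y 0 (Finsupp.single y 1)).trans ?_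
  rw [if_pos (by decide), zero_mul]
  rfl

lemma chainRepComplex_exactAt_succ (hY : IsContractible Y) (n : ℕ) :
    (chainRepComplex k ρ).ExactAt (n + 1) := by
  rw [HomologicalComplex.exactAt_iff' _ (n + 1 + 1) (n + 1) n (by simp) (by simp)]
  refine exact_of_forall fun x hx => ?_
  obtain ⟨w, hw⟩ := exists_boundary_eq hY ((chainRepComplex_d_hom k ρ n x).symm.trans hx)
  exact ⟨w, (chainRepComplex_d_hom k ρ (n + 1) w).trans hw⟩

lemma augmentation_exact (hY : IsContractible Y) :
    (ShortComplex.mk _ _ (chainRepComplex_d_comp_augmentation (ρ := ρ) k)).Exact := by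
  refine exact_of_forall fun x hx => ?_
  obtain ⟨w, hw⟩ := exists_boundary_eq_of_augmentation hY
    ((chainAugmentation_hom (ρ := ρ) k (op ⦋0⦌) x).symm.trans hx)
  exact ⟨w, (chainRepComplex_d_hom k ρ 0 w).trans hw⟩

lemma epi_chainAugmentation (hY : IsContractible Y) : Epi (chainAugmentation k ρ (op ⦋0⦌)) := by
  rw [Rep.epi_iff_surjective]
  intro r
  obtain ⟨y⟩ := hY.1
  exact ⟨Finsupp.single y r, augmentation_single k y r⟩

variable (ρ) in
/-- The projective resolution given by a free action on a contractible simplicial set. -/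
def chainResolution
    (hρ : ∀ (g : G) (n : ℕ) (y : Y _⦋n⦌), (ρ g).hom.app (op ⦋n⦌) y = y → g = 1)
    (hY : IsContractible Y) : ProjectiveResolution (Rep.trivial k G k) where
  complex := chainRepComplex k ρ
  projective n := projective_chainRep k (exists_equivariant ρ hρ n).choose_spec
  π := (ChainComplex.toSingle₀Equiv _ _).symm ⟨chainAugmentation k ρ (op ⦋0⦌),
    chainRepComplex_d_comp_augmentation k⟩
  quasiIso := ⟨fun n => by
    cases n
    · rw [ChainComplex.quasiIsoAt₀_iff, ShortComplex.quasiIso_iff_of_zeros']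
      · refine (ShortComplex.exact_and_epi_g_iff_of_iso ?_).2
          ⟨augmentation_exact (ρ := ρ) k hY, epi_chainAugmentation (ρ := ρ) k hY⟩
        exact ShortComplex.isoMk (Iso.refl _) (Iso.refl _) (Iso.refl _)
          ((Category.id_comp _).trans (Category.comp_id _).symm)
          ((Category.id_comp _).trans (Eq.trans (by
            exact (ChainComplex.toSingle₀Equiv_symm_apply_f_zero (C := chainRepComplex k ρ)
              (chainAugmentation k ρ (op ⦋0⦌)) (chainRepComplex_d_comp_augmentation k)).symm)
            (Category.comp_id _).symm))
      all_goals rfl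
    · rw [quasiIsoAt_iff_exactAt']
      · exact chainRepComplex_exactAt_succ k hY _
      · apply ChainComplex.exactAt_succ_single_obj⟩

/-- In degree `n + 1` the homotopy formula expresses the identity through the differentials alone;
composing with `f`, which kills boundaries, leaves a factorisation through `d`. -/
lemma exists_comp_eq_of_homotopy {D : Type*} [Category* D] [Preadditive D] {C : ChainComplex D ℕ}
    {φ : C ⟶ C} (H : Homotopy φ (𝟙 C)) {n : ℕ} (hφ : φ.f (n + 1) = 0) {M : D}
    (f : C.X (n + 1) ⟶ M) (hf : C.d (n + 2) (n + 1) ≫ f = 0) :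
    ∃ g : C.X n ⟶ M, C.d (n + 1) n ≫ g = f := by
  have hH := H.comm (n + 1)
  rw [dNext_eq (i' := n) (w := by simp), prevD_eq (j' := n + 2) (w := by simp), hφ,
    HomologicalComplex.id_f] at hH
  have hf' := congrArg (· ≫ f) hH
  simp only [Preadditive.add_comp, Category.assoc, hf, Limits.comp_zero, add_zero,
    Limits.zero_comp, Category.id_comp] at hf'
  refine ⟨-(H.hom n (n + 1) ≫ f), ?_⟩
  rw [Preadditive.comp_neg]
  exact neg_eq_of_add_eq_zero_right hf'.symm

/-- Group cohomology vanishes above the dimension of a contractible simplicial set with free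
action. -/
lemma subsingleton_groupCohomology_of_degenerate
    (hρ : ∀ (g : G) (n : ℕ) (y : Y _⦋n⦌), (ρ g).hom.app (op ⦋n⦌) y = y → g = 1)
    (hY : IsContractible Y) {n : ℕ} (hn : Y.nonDegenerate (n + 1) = ∅) (M : Rep.{0} k G) :
    Subsingleton (groupCohomology M (n + 1)) := by
  suffices h : ((chainRepComplex k ρ).linearYonedaObj k M).ExactAt (n + 1) by
    have := (HomologicalComplex.exactAt_iff_isZero_homology _ _).1 h
    exact ModuleCat.subsingleton_of_isZero
      (this.of_iso (groupCohomologyIso M (n + 1) (chainResolution k ρ hρ hY)))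
  -- The Dold–Kan projector kills degenerate simplices, hence everything in degree `n + 1`, and it
  -- is homotopic to the identity.
  have hP : (AlgebraicTopology.DoldKan.PInfty (X := chainRep k ρ)).f (n + 1) = 0 := by
    refine chainRepresentation_hom_ext k fun y => ?_
    have hy : y ∈ Y.degenerate (n + 1) := by
      by_contra h
      exact Set.notMem_empty y (hn ▸ h)
    rw [SSet.degenerate_eq_iUnion_range_σ, Set.mem_iUnion] at hy
    obtain ⟨i, y', rfl⟩ := hy
    have h := congrArg (fun f => f.hom (Finsupp.single y' 1 : Y _⦋n⦌ →₀ k))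
      (AlgebraicTopology.DoldKan.σ_comp_PInfty (chainRep k ρ) i)
    exact (congrArg ((AlgebraicTopology.DoldKan.PInfty (X := chainRep k ρ)).f (n + 1)).hom
      (Finsupp.mapDomain_single (f := fun y => Y.σ i y)).symm).trans h
  rw [HomologicalComplex.exactAt_iff' _ n (n + 1) (n + 2) (by simp) (by simp),
    ShortComplex.moduleCat_exact_iff]
  intro (f : (chainRepComplex k ρ).X (n + 1) ⟶ M)
    (hf : (chainRepComplex k ρ).d (n + 2) (n + 1) ≫ f = 0)
  exact exists_comp_eq_of_homotopy (AlgebraicTopology.DoldKan.homotopyPInftyToId (chainRep k ρ))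
    hP f hf

end Resolution

end

section

/-! ### Groups of type `F` -/

section TypeF

variable {Γ : Type} [Group Γ]

/-- A free action with finitely many orbits of non-degenerate simplices on a contractible
simplicial set. -/
structure IsFiniteModel {Y : SSet.{0}} (ρ : Γ →* Aut Y) : Prop where
  contractible : IsContractible Y
  free : ∀ (g : Γ) (n : ℕ) (y : Y _⦋n⦌), (ρ g).hom.app (op ⦋n⦌) y = y → g = 1
  finite : ∃ F : Set (Σ n : ℕ, Y _⦋n⦌), F.Finite ∧
    ∀ (n : ℕ) (y : Y _⦋n⦌), y ∈ Y.nonDegenerate n →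
      ∃ g : Γ, (⟨n, (ρ g).hom.app (op ⦋n⦌) y⟩ : Σ n : ℕ, Y _⦋n⦌) ∈ F

variable {Y : SSet.{0}} {ρ : Γ →* Aut Y}

lemma IsFiniteModel.exists_nonDegenerate_eq_empty (hρ : IsFiniteModel ρ) :
    ∃ N, ∀ n, N < n → Y.nonDegenerate n = ∅ := by
  obtain ⟨F, hF, h⟩ := hρ.finite
  obtain ⟨N, hN⟩ := (hF.image Sigma.fst).bddAbove
  refine ⟨N, fun n hn => Set.eq_empty_of_forall_notMem fun y hy => ?_⟩
  obtain ⟨g, hg⟩ := h n y hy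
  exact absurd (hN ⟨_, hg, rfl⟩) (not_le.2 hn)

lemma IsFiniteModel.exists_subsingleton_groupCohomology (hρ : IsFiniteModel ρ) :
    ∃ N, ∀ n, N < n → ∀ M : Rep.{0} ℚ Γ, Subsingleton (groupCohomology M n) := by
  obtain ⟨N, hN⟩ := hρ.exists_nonDegenerate_eq_empty
  refine ⟨N, fun n hn M => ?_⟩
  obtain ⟨n, rfl⟩ : ∃ m, n = m + 1 := ⟨n - 1, by omega⟩
  exact subsingleton_groupCohomology_of_degenerate ℚ hρ.free hρ.contractible (hN _ hn) M

/-- In positive even degrees the integral cohomology of a finite cyclic group is `ℤ` modulo the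
norm, which is multiplication by the order. -/
lemma card_eq_one_of_subsingleton {H : Type} [CommGroup H] [Fintype H] {g : H}
    (hg : ∀ x, x ∈ Subgroup.zpowers g) {n : ℕ} [NeZero n] (hn : Even n)
    (h : Subsingleton (groupCohomology (Rep.trivial ℤ H ℤ) n)) : Fintype.card H = 1 := by
  have h₁ : (1 : ℤ) ∈ ((Rep.trivial ℤ H ℤ).applyAsHom g - 𝟙 _).hom.toLinearMap.ker := by
    refine LinearMap.mem_ker.2 ?_
    exact sub_self (1 : ℤ)
  have h₂ := (Rep.FiniteCyclicGroup.groupCohomologyπEven_eq_zero_iff (Rep.trivial ℤ H ℤ) g hg n hn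
    ⟨1, h₁⟩).1 (Subsingleton.elim _ _)
  obtain ⟨a, ha⟩ := h₂
  have h₃ : (Fintype.card H : ℤ) * a = 1 := by
    refine Eq.trans ?_ ha
    change (Fintype.card H : ℤ) * a = Representation.norm (Representation.trivial ℤ H ℤ) a
    simp [Representation.norm]
  have := Int.eq_one_or_neg_one_of_mul_eq_one h₃
  omega

/-- Groups acting freely on finite-dimensional contractible complexes are torsion-free. -/
lemma IsFiniteModel.eq_one_of_isOfFinOrder (hρ : IsFiniteModel ρ) {g : Γ} (hg : IsOfFinOrder g) :
    g = 1 := by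
  obtain ⟨N, hN⟩ := hρ.exists_nonDegenerate_eq_empty
  let H := Subgroup.zpowers g
  let : CommGroup H := { (inferInstance : Group H) with
    mul_comm := fun a b => by
      obtain ⟨_, m, rfl⟩ := a
      obtain ⟨_, n, rfl⟩ := b
      exact Subtype.ext (by simp [← zpow_add, add_comm]) }
  have : Finite H := hg.finite_zpowers
  let := Fintype.ofFinite H
  let ρ' : H →* Aut Y := ρ.comp H.subtype
  -- The even degree `2 * N + 2` exceeds the dimension. Coefficients are integral because rational
  -- cohomology does not see finite groups in positive degrees.
  have h := subsingleton_groupCohomology_of_degenerate (ρ := ρ') ℤ (n := 2 * N + 1)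
    (fun a n y h => Subtype.ext (hρ.free a n y h)) hρ.contractible (hN _ (by omega))
    (Rep.trivial ℤ H ℤ)
  have : NeZero (2 * N + 1 + 1) := ⟨by omega⟩
  have hc := card_eq_one_of_subsingleton (g := (⟨g, Subgroup.mem_zpowers g⟩ : H))
    (fun ⟨x, m, hm⟩ => ⟨m, Subtype.ext (by simpa using hm)⟩) ⟨N + 1, by ring⟩ h
  have := Fintype.card_le_one_iff_subsingleton.1 hc.le
  exact congrArg Subtype.val (Subsingleton.elim (⟨g, Subgroup.mem_zpowers g⟩ : H) 1)

end TypeF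

/-! ### Dimension shifting in group cohomology -/

section Shift

variable {G : Type} [Group G]

instance additive_groupCohomology_functor (n : ℕ) : (groupCohomology.functor ℚ G n).Additive where
  map_add := (groupCohomology.cochainsFunctor ℚ G ⋙
    HomologicalComplex.homologyFunctor _ _ n).map_add

variable {S : ShortComplex (Rep.{0} ℚ G)} (hS : S.ShortExact)

include hS in
lemma subsingleton_groupCohomology_of_shortExact {n : ℕ}
    (h₂ : Subsingleton (groupCohomology S.X₂ n)) (h₁ : Subsingleton (groupCohomology S.X₁ (n + 1))) :
    Subsingleton (groupCohomology S.X₃ n) := by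
  refine subsingleton_of_forall_eq 0 fun x => ?_
  obtain ⟨y, rfl⟩ := (ShortComplex.moduleCat_exact_iff _).1
    (groupCohomology.mapShortComplex₃_exact hS (i := n) rfl) x (Subsingleton.elim (α := groupCohomology S.X₁ (n + 1)) _ _)
  rw [Subsingleton.elim (α := groupCohomology S.X₂ n) y 0]
  exact map_zero _

include hS in
lemma map_surjective_of_shortExact {n : ℕ} (h₁ : Subsingleton (groupCohomology S.X₁ (n + 1))) :
    Function.Surjective ((groupCohomology.functor ℚ G n).map S.g) := fun x =>
  (ShortComplex.moduleCat_exact_iff _).1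
    (groupCohomology.mapShortComplex₃_exact hS (i := n) rfl) x (Subsingleton.elim (α := groupCohomology S.X₁ (n + 1)) _ _)

include hS in
lemma exists_map_eq_of_shortExact {n : ℕ} {x : groupCohomology S.X₂ n}
    (hx : (groupCohomology.functor ℚ G n).map S.g x = 0) :
    ∃ y, (groupCohomology.functor ℚ G n).map S.f y = x :=
  (ShortComplex.moduleCat_exact_iff _).1 (groupCohomology.mapShortComplex₂_exact hS n) x hx

end Shift

/-! ### Finite generation of the chains of a finite model -/

section Finite

variable {Γ : Type} [Group Γ] {Y : SSet.{0}} {ρ : Γ →* Aut Y}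

lemma IsFiniteModel.exists_finite (hρ : IsFiniteModel ρ) (n : ℕ) :
    ∃ R : Set (Y _⦋n⦌), R.Finite ∧ ∀ y, ∃ g : Γ, (ρ g).hom.app (op ⦋n⦌) y ∈ R := by
  obtain ⟨F, hF, h⟩ := hρ.finite
  refine ⟨⋃ p ∈ F, Set.range fun f : ⦋n⦌ ⟶ ⦋p.1⦌ => Y.map f.op p.2,
    hF.biUnion fun p _ => Set.finite_range _, fun y => ?_⟩
  obtain ⟨m, f, _, x, rfl⟩ := Y.exists_nonDegenerate y
  obtain ⟨g, hg⟩ := h m x.1 x.2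
  exact ⟨g, Set.mem_biUnion hg ⟨f, action_map ρ g f.op x.1⟩⟩

/-- The chains as a representation. -/
abbrev chainsRep (ρ : Γ →* Aut Y) (n : ℕ) : Rep.{0} ℚ Γ := Rep.of (chainRepresentation ℚ ρ (op ⦋n⦌))

/-- The inclusion of an orbit. -/
abbrev orbitInclusion (ρ : Γ →* Aut Y) {n : ℕ} (y : Y _⦋n⦌) :
    Rep.leftRegular ℚ Γ ⟶ chainsRep ρ n :=
  Rep.leftRegularHom (chainsRep ρ n) (Finsupp.single y 1)

lemma orbitInclusion_single {n : ℕ} (y : Y _⦋n⦌) (g : Γ) :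
    (orbitInclusion ρ y).hom (MonoidAlgebra.single g 1) =
      Finsupp.single ((ρ g).hom.app (op ⦋n⦌) y) 1 := by
  rw [Rep.leftRegularHom_hom_single, one_smul]
  exact chainRepresentation_single ℚ ρ _ g y 1

/-- An equivariant map to `Γ`, as a morphism of representations. -/
def foldHom {n : ℕ} (φ : Y _⦋n⦌ → Γ) (hφ : ∀ g y, φ ((ρ g).hom.app (op ⦋n⦌) y) = g * φ y) :
    chainsRep ρ n ⟶ Rep.leftRegular ℚ Γ :=
  chainDesc ℚ (M := Rep.leftRegular ℚ Γ) (fun y => MonoidAlgebra.single (φ y) 1) fun g y => by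
    rw [hφ]
    simp

open Classical in
/-- The projection to an orbit. -/
def orbitProjection {n : ℕ} (φ : Y _⦋n⦌ → Γ)
    (hφ : ∀ g y, φ ((ρ g).hom.app (op ⦋n⦌) y) = g * φ y) (r : Y _⦋n⦌) :
    chainsRep ρ n ⟶ Rep.leftRegular ℚ Γ :=
  chainDesc ℚ (M := Rep.leftRegular ℚ Γ)
    (fun y => if (ρ (φ y)⁻¹).hom.app (op ⦋n⦌) y = r then MonoidAlgebra.single (φ y) 1 else 0)
    fun g y => by
      rw [hφ, ← action_mul, mul_inv_rev, mul_assoc, inv_mul_cancel, mul_one]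
      split_ifs
      · simp
      · simp

/-- The chains of a finite model are finitely generated and free. -/
lemma IsFiniteModel.exists_sum_eq_id (hρ : IsFiniteModel ρ) (n : ℕ) :
    ∃ (R : Finset (Y _⦋n⦌)) (π : Y _⦋n⦌ → (chainsRep ρ n ⟶ Rep.leftRegular ℚ Γ)),
      ∑ r ∈ R, π r ≫ orbitInclusion ρ r = 𝟙 _ := by
  obtain ⟨φ, hφ⟩ := exists_equivariant ρ hρ.free n
  obtain ⟨R, hR, h⟩ := hρ.exists_finite n
  let base (y : Y _⦋n⦌) : Y _⦋n⦌ := (ρ (φ y)⁻¹).hom.app (op ⦋n⦌) y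
  have hb (g : Γ) (y : Y _⦋n⦌) : base ((ρ g).hom.app (op ⦋n⦌) y) = base y := by
    change (ρ _).hom.app _ _ = _
    rw [hφ, ← action_mul, mul_inv_rev, mul_assoc, inv_mul_cancel, mul_one]
  -- `base` sends a simplex to the chosen representative of its orbit, so each orbit contributes
  -- exactly one element of this finite set.
  refine ⟨(hR.image base).toFinset, orbitProjection φ hφ, ?_⟩
  refine chainRepresentation_hom_ext ℚ fun y => ?_
  have hy : base y ∈ (hR.image base).toFinset := by
    obtain ⟨g, hg⟩ := h y
    rw [Set.Finite.mem_toFinset, ← hb g y]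
    exact ⟨_, hg, rfl⟩
  rw [sum_hom_apply, Finset.sum_eq_single_of_mem _ hy]
  · rw [Rep.hom_comp, Representation.IntertwiningMap.comp_apply, orbitProjection, chainDesc_single,
      if_pos rfl, one_smul, orbitInclusion_single, ← action_mul, mul_inv_cancel, action_one]
    rfl
  · intro r _ hr
    rw [Rep.hom_comp, Representation.IntertwiningMap.comp_apply, orbitProjection, chainDesc_single,
      if_neg hr.symm, smul_zero, map_zero]

lemma moduleCat_sum_apply {M N : ModuleCat.{0} ℚ} {ι : Type} (s : Finset ι) (f : ι → (M ⟶ N))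
    (x : M) : (∑ i ∈ s, f i) x = ∑ i ∈ s, f i x := by
  change ModuleCat.Hom.hom _ x = _
  rw [ModuleCat.hom_sum, LinearMap.sum_apply]

lemma map_comp_apply {A B C : Rep.{0} ℚ Γ} (f : A ⟶ B) (g : B ⟶ C) {m : ℕ}
    (x : groupCohomology A m) :
    (groupCohomology.functor ℚ Γ m).map (f ≫ g) x =
      (groupCohomology.functor ℚ Γ m).map g ((groupCohomology.functor ℚ Γ m).map f x) := by
  rw [Functor.map_comp]
  rfl

lemma IsFiniteModel.exists_eq_sum (hρ : IsFiniteModel ρ) (n m : ℕ) :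
    ∃ (R : Finset (Y _⦋n⦌)) (π : Y _⦋n⦌ → (chainsRep ρ n ⟶ Rep.leftRegular ℚ Γ)),
      ∀ x : groupCohomology (chainsRep ρ n) m,
        x = ∑ r ∈ R, (groupCohomology.functor ℚ Γ m).map (orbitInclusion ρ r)
          ((groupCohomology.functor ℚ Γ m).map (π r) x) := by
  obtain ⟨R, π, h⟩ := hρ.exists_sum_eq_id n
  refine ⟨R, π, fun x => ?_⟩
  have h' := congrArg (groupCohomology.functor ℚ Γ m).map h
  rw [Functor.map_sum, CategoryTheory.Functor.map_id] at h'
  have h'' := ConcreteCategory.congr_hom h' x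
  refine h''.symm.trans ((moduleCat_sum_apply _ _ _).trans (Finset.sum_congr rfl fun r _ => ?_))
  exact map_comp_apply _ _ x

end Finite

end

section

/-! ### Cohomology of Poincaré duality groups -/

section Duality

variable {Γ : Type} [Group Γ] {Y : SSet.{0}} {ρ : Γ →* Aut Y}

/-- The boundary, as a morphism of representations. -/
def chainBoundary (ρ : Γ →* Aut Y) (n : ℕ) : chainsRep ρ (n + 1) ⟶ chainsRep ρ n :=
  (chainRepComplex ℚ ρ).d (n + 1) n

lemma chainBoundary_hom (n : ℕ) (x : Y _⦋n + 1⦌ →₀ ℚ) :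
    (chainBoundary ρ n).hom x = boundary ℚ Y n x :=
  chainRepComplex_d_hom ℚ ρ n x

lemma boundary_chainRepresentation (n : ℕ) (g : Γ) (x : Y _⦋n + 1⦌ →₀ ℚ) :
    boundary ℚ Y n (chainRepresentation ℚ ρ (op ⦋n + 1⦌) g x) =
      chainRepresentation ℚ ρ (op ⦋n⦌) g (boundary ℚ Y n x) :=
  (chainBoundary_hom n _).symm.trans ((Rep.hom_comm_apply (chainBoundary ρ n) g x).trans
    (congrArg (chainRepresentation ℚ ρ (op ⦋n⦌) g) (chainBoundary_hom n x)))

lemma range_boundary_le_comap (n : ℕ) (g : Γ) :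
    LinearMap.range (boundary ℚ Y n) ≤
      (LinearMap.range (boundary ℚ Y n)).comap (chainRepresentation ℚ ρ (op ⦋n⦌) g) := by
  rintro _ ⟨x, rfl⟩
  exact ⟨chainRepresentation ℚ ρ (op ⦋n + 1⦌) g x, boundary_chainRepresentation n g x⟩

/-- The representation on the boundaries. -/
abbrev boundariesRep (ρ : Γ →* Aut Y) (n : ℕ) : Rep.{0} ℚ Γ :=
  (chainsRep ρ n).subrepresentation (LinearMap.range (boundary ℚ Y n)) (range_boundary_le_comap n)

/-- The inclusion of boundaries. -/
def boundariesInclusion (ρ : Γ →* Aut Y) (n : ℕ) : boundariesRep ρ n ⟶ chainsRep ρ n :=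
  Rep.subtype _ _ _

/-- The boundary, as a morphism onto the boundaries. -/
def toBoundaries (ρ : Γ →* Aut Y) (n : ℕ) : chainsRep ρ (n + 1) ⟶ boundariesRep ρ n :=
  Rep.ofHom ⟨(boundary ℚ Y n).rangeRestrict, fun g =>
    LinearMap.ext fun x => Subtype.ext (boundary_chainRepresentation n g x)⟩

lemma toBoundaries_comp_boundariesInclusion (n : ℕ) :
    toBoundaries ρ n ≫ boundariesInclusion ρ n = chainBoundary ρ n :=
  chainRepresentation_hom_ext ℚ fun y => (chainBoundary_hom n (Finsupp.single y 1)).symm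

lemma shortExact_of_forall {S : ShortComplex (Rep.{0} ℚ Γ)} (hf : Function.Injective S.f.hom)
    (hg : Function.Surjective S.g.hom) (h : ∀ x, S.g.hom x = 0 → ∃ y, S.f.hom y = x) :
    S.ShortExact where
  exact := exact_of_forall h
  mono_f := (Rep.mono_iff_injective _).2 hf
  epi_g := (Rep.epi_iff_surjective _).2 hg

lemma boundary_boundary (n : ℕ) (x : Y _⦋n + 2⦌ →₀ ℚ) :
    boundary ℚ Y n (boundary ℚ Y (n + 1) x) = 0 := by
  have h := (((AlgebraicTopology.alternatingFaceMapComplex _).obj (chains ℚ Y)).d_comp_d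
    (n + 2) (n + 1) n)
  rw [alternatingFaceMapComplex_chains_d, alternatingFaceMapComplex_chains_d] at h
  exact ConcreteCategory.congr_hom h x

/-- The short complex `Bₙ₊₁ → Cₙ₊₁ → Bₙ`. -/
abbrev boundariesShortComplex (ρ : Γ →* Aut Y) (n : ℕ) : ShortComplex (Rep.{0} ℚ Γ) :=
  ShortComplex.mk (boundariesInclusion ρ (n + 1)) (toBoundaries ρ n) (by
    refine Rep.hom_ext (Representation.IntertwiningMap.toLinearMap_injective _ _
      (LinearMap.ext ?_))
    rintro ⟨_, x, rfl⟩
    exact Subtype.ext (boundary_boundary n x))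

/-- The short complex `B₀ → C₀ → ℚ`. -/
abbrev augmentationShortComplex (ρ : Γ →* Aut Y) : ShortComplex (Rep.{0} ℚ Γ) :=
  ShortComplex.mk (boundariesInclusion ρ 0) (chainAugmentation ℚ ρ (op ⦋0⦌)) (by
    refine Rep.hom_ext (Representation.IntertwiningMap.toLinearMap_injective _ _
      (LinearMap.ext ?_))
    rintro ⟨_, x, rfl⟩
    refine (augmentation_boundary ℚ Y 0 x).trans ?_
    rw [if_pos (by decide), zero_mul]
    rfl)

lemma boundariesShortComplex_shortExact (hY : IsContractible Y) (n : ℕ) :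
    (boundariesShortComplex ρ n).ShortExact :=
  shortExact_of_forall Subtype.val_injective (LinearMap.surjective_rangeRestrict _)
    fun x hx => by
      obtain ⟨w, hw⟩ := exists_boundary_eq hY (congrArg Subtype.val hx)
      exact ⟨⟨x, w, hw⟩, rfl⟩

lemma augmentationShortComplex_shortExact (hY : IsContractible Y) :
    (augmentationShortComplex ρ).ShortExact :=
  shortExact_of_forall Subtype.val_injective
    ((Rep.epi_iff_surjective _).1 (epi_chainAugmentation ℚ hY)) fun x hx => by
      obtain ⟨w, hw⟩ := exists_boundary_eq_of_augmentation hY hx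
      exact ⟨⟨x, w, hw⟩, rfl⟩

variable {d : ℕ}

/-- Every class is a finite sum of images of classes with coefficients `ℚΓ`. Finiteness of the
number of orbits is what makes additivity of cohomology sufficient. -/
lemma subsingleton_groupCohomology_chainsRep (hΓ : IsOrientedPoincareDualityGroup Γ d)
    (hρ : IsFiniteModel ρ) {n : ℕ} (hn : n ≠ d) (j : ℕ) :
    Subsingleton (groupCohomology (chainsRep ρ j) n) := by
  obtain ⟨R, π, h⟩ := hρ.exists_eq_sum j n
  refine subsingleton_of_forall_eq 0 fun x => (h x).trans (Finset.sum_eq_zero fun r _ => ?_)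
  have := hΓ.concentrated n hn
  exact (congrArg ((groupCohomology.functor ℚ Γ n).map (orbitInclusion ρ r))
    (Subsingleton.elim (α := groupCohomology (Rep.leftRegular ℚ Γ) n) _ 0)).trans (map_zero _)

/-- Descending induction on the degree from above the dimension of the model: in `Bⱼ₊₁ → Cⱼ₊₁ → Bⱼ`,
the cohomology of `Bⱼ` in degree `n` is squeezed between that of `Cⱼ₊₁` in degree `n` and of `Bⱼ₊₁`
in degree `n + 1`. -/
lemma subsingleton_groupCohomology_boundariesRep (hΓ : IsOrientedPoincareDualityGroup Γ d)
    (hρ : IsFiniteModel ρ) {n : ℕ} (hn : d < n) (j : ℕ) :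
    Subsingleton (groupCohomology (boundariesRep ρ j) n) := by
  obtain ⟨N, hN⟩ := hρ.exists_subsingleton_groupCohomology
  suffices h : ∀ t n, N < n + t → d < n → ∀ j, Subsingleton (groupCohomology (boundariesRep ρ j) n)
    from h (N + 1) n (by omega) hn j
  intro t
  induction t with
  | zero => exact fun n hn _ j => hN n hn _
  | succ t ih =>
    intro n hn hdn j
    exact subsingleton_groupCohomology_of_shortExact
      (boundariesShortComplex_shortExact hρ.contractible j)
      (subsingleton_groupCohomology_chainsRep hΓ hρ hdn.ne' (j + 1))
      (ih (n + 1) (by omega) (by omega) (j + 1))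

lemma subsingleton_groupCohomology_trivial (hΓ : IsOrientedPoincareDualityGroup Γ d)
    (hρ : IsFiniteModel ρ) {n : ℕ} (hn : d < n) :
    Subsingleton (groupCohomology (Rep.trivial ℚ Γ ℚ) n) :=
  subsingleton_groupCohomology_of_shortExact
    (augmentationShortComplex_shortExact (ρ := ρ) hρ.contractible)
    (subsingleton_groupCohomology_chainsRep hΓ hρ hn.ne' 0)
    (subsingleton_groupCohomology_boundariesRep hΓ hρ (by omega) 0)

lemma leftRegular_hom_ext {M : Rep.{0} ℚ Γ} {f f' : Rep.leftRegular ℚ Γ ⟶ M}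
    (h : ∀ g, f.hom (MonoidAlgebra.single g 1) = f'.hom (MonoidAlgebra.single g 1)) : f = f' := by
  refine Rep.hom_ext (Representation.IntertwiningMap.toLinearMap_injective _ _ ?_)
  exact MonoidAlgebra.lhom_ext' fun g => LinearMap.ext_ring (h g)

lemma orbitInclusion_comp_augmentation {n : ℕ} (y : Y _⦋n⦌) :
    orbitInclusion ρ y ≫ chainAugmentation ℚ ρ (op ⦋n⦌) =
      Rep.leftRegularHom (Rep.trivial ℚ Γ ℚ) (1 : ℚ) := by
  refine leftRegular_hom_ext fun g => ?_
  rw [Rep.hom_comp, Representation.IntertwiningMap.comp_apply, orbitInclusion_single,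
    chainAugmentation_hom, augmentation_single, Rep.leftRegularHom_hom_single]
  simp

lemma orbitInclusion_comp_foldHom {n : ℕ} (φ : Y _⦋n⦌ → Γ)
    (hφ : ∀ g y, φ ((ρ g).hom.app (op ⦋n⦌) y) = g * φ y) (y : Y _⦋n⦌) :
    orbitInclusion ρ y ≫ foldHom φ hφ =
      Rep.leftRegularHom (Rep.leftRegular ℚ Γ) (MonoidAlgebra.single (φ y) 1) := by
  refine leftRegular_hom_ext fun g => ?_
  rw [Rep.hom_comp, Representation.IntertwiningMap.comp_apply, orbitInclusion_single, foldHom,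
    chainDesc_single, Rep.leftRegularHom_hom_single, hφ]
  simp

lemma orbitInclusion_comp_chainBoundary (e : Y _⦋1⦌) :
    orbitInclusion ρ e ≫ chainBoundary ρ 0 =
      orbitInclusion ρ (Y.δ 0 e) - orbitInclusion ρ (Y.δ 1 e) := by
  refine leftRegular_hom_ext fun g => ?_
  rw [Rep.hom_comp, Representation.IntertwiningMap.comp_apply, orbitInclusion_single,
    chainBoundary_hom, boundary_single, Fin.sum_univ_two, Rep.sub_hom]
  change _ = (orbitInclusion ρ (Y.δ 0 e)).hom (MonoidAlgebra.single g 1) -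
    (orbitInclusion ρ (Y.δ 1 e)).hom (MonoidAlgebra.single g 1)
  rw [orbitInclusion_single, orbitInclusion_single, Fin.val_zero, Fin.val_one, pow_zero, pow_one,
    one_smul, neg_one_smul, ← sub_eq_add_neg]
  exact congrArg₂ (fun a b : Y _⦋0⦌ => Finsupp.single a (1 : ℚ) - Finsupp.single b 1)
    (action_map ρ g _ e) (action_map ρ g _ e)

/-- The top cohomology of a Poincaré duality group is one-dimensional. -/
lemma exists_generator_groupCohomology (hΓ : IsOrientedPoincareDualityGroup Γ d)
    (hρ : IsFiniteModel ρ) :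
    ∃ u : groupCohomology (Rep.trivial ℚ Γ ℚ) d, u ≠ 0 ∧ ∀ x, ∃ r : ℚ, r • u = x := by
  obtain ⟨e⟩ := hΓ.equiv_rat
  have he (x : groupCohomology (Rep.leftRegular ℚ Γ) d) : x = e x • e.symm 1 := by
    rw [← map_smul, smul_eq_mul, mul_one, e.symm_apply_apply]
  let H := groupCohomology.functor ℚ Γ d
  let ε := H.map (Rep.leftRegularHom (Rep.trivial ℚ Γ ℚ) (1 : ℚ))
  have hsurj := map_surjective_of_shortExact
    (augmentationShortComplex_shortExact (ρ := ρ) hρ.contractible)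
    (subsingleton_groupCohomology_boundariesRep hΓ hρ (lt_add_one d) 0)
  -- Each orbit inclusion followed by the augmentation of the chains is the augmentation of `ℚΓ`, so
  -- all orbits contribute multiples of one class.
  have hspan (x : groupCohomology (Rep.trivial ℚ Γ ℚ) d) : ∃ r : ℚ, r • ε (e.symm 1) = x := by
    obtain ⟨x₀, rfl⟩ := hsurj x
    obtain ⟨R, π, h⟩ := hρ.exists_eq_sum 0 d
    refine ⟨∑ r ∈ R, e (H.map (π r) x₀), ?_⟩
    refine Eq.trans ?_ (congrArg (H.map (chainAugmentation ℚ ρ (op ⦋0⦌))) (h x₀)).symm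
    rw [map_sum, Finset.sum_smul]
    refine Finset.sum_congr rfl fun r _ => ?_
    refine ((map_smul ε.hom _ _).symm.trans (congrArg ε (he _).symm)).trans ?_
    refine Eq.trans ?_ (map_comp_apply _ _ _)
    rw [orbitInclusion_comp_augmentation]
  -- If this class were zero, the orbit class of a vertex would come from `H^d(C₁)` through the
  -- boundary. But `foldHom` kills such classes and inverts the orbit inclusion, because right
  -- multiplications act trivially on `H^d(Γ; ℚΓ)`.
  refine ⟨ε (e.symm 1), fun h₀ => ?_, hspan⟩
  obtain ⟨v⟩ := hρ.contractible.1
  obtain ⟨φ, hφ⟩ := exists_equivariant ρ hρ.free 0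
  have h₁ : H.map (orbitInclusion ρ v) (e.symm 1) ∈
      Set.range (H.map (chainBoundary ρ 0)) := by
    obtain ⟨w, hw⟩ := exists_map_eq_of_shortExact
      (augmentationShortComplex_shortExact (ρ := ρ) hρ.contractible)
      (x := H.map (orbitInclusion ρ v) (e.symm 1)) (by
        refine (map_comp_apply _ _ _).symm.trans ?_
        rw [orbitInclusion_comp_augmentation]
        exact h₀)
    obtain ⟨w, rfl⟩ := map_surjective_of_shortExact
      (boundariesShortComplex_shortExact (ρ := ρ) hρ.contractible 0)
      (subsingleton_groupCohomology_boundariesRep hΓ hρ (lt_add_one d) 1) w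
    refine ⟨w, Eq.trans ?_ hw⟩
    rw [← toBoundaries_comp_boundariesInclusion]
    exact map_comp_apply _ _ _
  obtain ⟨w, hw⟩ := h₁
  have h₂ : H.map (foldHom φ hφ) (H.map (orbitInclusion ρ v) (e.symm 1)) = e.symm 1 := by
    refine (map_comp_apply _ _ _).symm.trans ?_
    rw [orbitInclusion_comp_foldHom, hΓ.trivial_action]
    rfl
  have h₃ (r : Y _⦋1⦌) : H.map (orbitInclusion ρ r ≫ chainBoundary ρ 0 ≫ foldHom φ hφ) = 0 := by
    rw [← Category.assoc, orbitInclusion_comp_chainBoundary, Preadditive.sub_comp,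
      orbitInclusion_comp_foldHom, orbitInclusion_comp_foldHom, Functor.map_sub,
      hΓ.trivial_action, hΓ.trivial_action, sub_self]
  obtain ⟨R, π, h⟩ := hρ.exists_eq_sum 1 d
  have h₄ : H.map (chainBoundary ρ 0 ≫ foldHom φ hφ) w = 0 := by
    rw [h w, map_sum]
    refine Finset.sum_eq_zero fun r _ => ?_
    refine (map_comp_apply _ _ _).symm.trans ?_
    rw [h₃]
    rfl
  have h₅ : e.symm 1 = 0 := by
    rw [← h₂, ← hw]
    exact (map_comp_apply _ _ _).symm.trans h₄
  exact one_ne_zero (e.symm.map_eq_zero_iff.1 h₅)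

end Duality

end

section

/-! ### Group cohomology as the cohomology of the classifying space -/

section Comparison

variable {G : Type} [Group G]

lemma inhomogeneousCochains_d_bar {n : ℕ} (c : classifyingSpace G _⦋n⦌ → ℚ) :
    inhomogeneousCochains.d (Rep.trivial ℚ G ℚ) n (fun g => c (barSimplex g)) =
      fun g => coboundary (classifyingSpace G) n c (barSimplex g) :=
  funext fun g => (coboundary_barSimplex c g).symm

lemma iCocycles_injective (A : Rep.{0} ℚ G) (n : ℕ) :
    Function.Injective (groupCohomology.iCocycles A n) :=
  (ModuleCat.mono_iff_injective _).1 inferInstance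

lemma inhomogeneousCochains_d_bar_eq_zero {n : ℕ} (c : cocycles (classifyingSpace G) n) :
    inhomogeneousCochains.d (Rep.trivial ℚ G ℚ) n (fun g => c.1 (barSimplex g)) = 0 := by
  have hc : coboundary _ n c.1 = 0 := c.2
  rw [inhomogeneousCochains_d_bar, hc]
  rfl

/-- Simplicial cocycles of the classifying space as inhomogeneous cocycles. -/
def barCocycle (n : ℕ) : cocycles (classifyingSpace G) n →ₗ[ℚ]
    groupCohomology.cocycles (Rep.trivial ℚ G ℚ) n where
  toFun c := groupCohomology.cocyclesMk (fun g => c.1 (barSimplex g))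
    (inhomogeneousCochains_d_bar_eq_zero c)
  map_add' c c' := iCocycles_injective _ n (by
    rw [map_add, groupCohomology.iCocycles_mk, groupCohomology.iCocycles_mk,
      groupCohomology.iCocycles_mk]
    rfl)
  map_smul' r c := iCocycles_injective _ n (by
    rw [map_smul, groupCohomology.iCocycles_mk, groupCohomology.iCocycles_mk]
    rfl)

lemma iCocycles_barCocycle {n : ℕ} (c : cocycles (classifyingSpace G) n) :
    groupCohomology.iCocycles (Rep.trivial ℚ G ℚ) n (barCocycle n c) =
      fun g => c.1 (barSimplex g) :=
  groupCohomology.iCocycles_mk (A := Rep.trivial ℚ G ℚ) (fun g => c.1 (barSimplex g))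
    (inhomogeneousCochains_d_bar_eq_zero c)

lemma barCocycle_surjective (n : ℕ) : Function.Surjective (barCocycle (G := G) n) := fun z => by
  have hz := ConcreteCategory.congr_hom
    ((groupCohomology.inhomogeneousCochains (Rep.trivial ℚ G ℚ)).iCycles_d n (n + 1)) z
  rw [groupCohomology.inhomogeneousCochains.d_def] at hz
  let f : (Fin n → G) → ℚ := groupCohomology.iCocycles _ n z
  let c : classifyingSpace G _⦋n⦌ → ℚ := fun x => f ((barEquiv G n).symm x)
  have hc' : (fun g => c (barSimplex g)) = f :=
    funext fun g => congrArg f ((barEquiv G n).symm_apply_apply g)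
  have hc : c ∈ cocycles (classifyingSpace G) n := by
    refine funext fun x => ?_
    obtain ⟨g, rfl⟩ := (barEquiv G (n + 1)).surjective x
    have h := congrFun (inhomogeneousCochains_d_bar c) g
    rw [hc'] at h
    exact h.symm.trans (congrFun hz g)
  exact ⟨⟨c, hc⟩, iCocycles_injective _ n ((iCocycles_barCocycle _).trans hc')⟩

/-- With `barCocycle_surjective` this identifies group cohomology with trivial coefficients and the
cohomology of the classifying space. In degree 0 a cocycle is its own class. -/
lemma π_barCocycle_eq_zero_iff {n : ℕ} (c : cocycles (classifyingSpace G) n) :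
    groupCohomology.π (Rep.trivial ℚ G ℚ) n (barCocycle n c) = 0 ↔
      c.1 ∈ coboundaries (classifyingSpace G) n := by
  cases n with
  | zero =>
    have hinj : Function.Injective (groupCohomology.π (Rep.trivial ℚ G ℚ) 0) := by
      have : IsIso ((groupCohomology.inhomogeneousCochains (Rep.trivial ℚ G ℚ)).homologyπ 0) :=
        CochainComplex.isIso_homologyπ₀ _
      exact (ModuleCat.mono_iff_injective
        ((groupCohomology.inhomogeneousCochains (Rep.trivial ℚ G ℚ)).homologyπ 0)).1 inferInstance
    constructor
    · intro h
      have h' := hinj (h.trans (map_zero _).symm)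
      have h'' := (iCocycles_barCocycle c).symm.trans
        ((congrArg (groupCohomology.iCocycles _ 0) h').trans (map_zero _))
      refine funext fun x => ?_
      obtain ⟨g, rfl⟩ := (barEquiv G 0).surjective x
      exact congrFun h'' g
    · intro h
      have : c = 0 := Subtype.ext h
      rw [this, map_zero, map_zero]
  | succ n =>
    have hex := ShortComplex.exact_of_g_is_cokernel (ShortComplex.mk _ _
      ((groupCohomology.inhomogeneousCochains (Rep.trivial ℚ G ℚ)).toCycles_comp_homologyπ n
        (n + 1))) ((groupCohomology.inhomogeneousCochains
          (Rep.trivial ℚ G ℚ)).homologyIsCokernel n (n + 1) (by simp))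
    have hto (b : (Fin n → G) → ℚ) : groupCohomology.iCocycles (Rep.trivial ℚ G ℚ) (n + 1)
        (groupCohomology.toCocycles _ n (n + 1) b) =
        inhomogeneousCochains.d (Rep.trivial ℚ G ℚ) n b := by
      have h := ConcreteCategory.congr_hom
        ((groupCohomology.inhomogeneousCochains (Rep.trivial ℚ G ℚ)).toCycles_i n (n + 1)) b
      rw [groupCohomology.inhomogeneousCochains.d_def] at h
      exact h
    constructor
    · intro h
      obtain ⟨b, hb⟩ := (ShortComplex.moduleCat_exact_iff _).1 hex _ h
      let b' : classifyingSpace G _⦋n⦌ → ℚ := fun x => b ((barEquiv G n).symm x)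
      have hb' : (fun g => b' (barSimplex g)) = b :=
        funext fun g => congrArg b ((barEquiv G n).symm_apply_apply g)
      refine ⟨b', funext fun x => ?_⟩
      obtain ⟨g, rfl⟩ := (barEquiv G (n + 1)).surjective x
      have h₁ := (hto b).symm.trans ((congrArg (groupCohomology.iCocycles _ (n + 1)) hb).trans
        (iCocycles_barCocycle c))
      have h₂ := inhomogeneousCochains_d_bar b'
      rw [hb'] at h₂
      exact congrFun (h₂.symm.trans h₁) g
    · rintro ⟨b, hb⟩
      have h : barCocycle (n + 1) c = groupCohomology.toCocycles (Rep.trivial ℚ G ℚ) n (n + 1)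
          (fun g => b (barSimplex g)) := by
        refine iCocycles_injective _ _ ((iCocycles_barCocycle c).trans ?_)
        refine Eq.trans ?_ (hto _).symm
        rw [inhomogeneousCochains_d_bar, hb]
      rw [h]
      exact ConcreteCategory.congr_hom
        ((groupCohomology.inhomogeneousCochains (Rep.trivial ℚ G ℚ)).toCycles_comp_homologyπ n
        (n + 1)) _

variable {Γ : Type} [Group Γ] {d : ℕ}

lemma IsTypeF.exists_isFiniteModel (h : IsTypeF Γ) :
    ∃ (Y : SSet.{0}) (ρ : Γ →* Aut Y), IsFiniteModel ρ := by
  obtain ⟨Y, ρ, h₁, h₂, h₃⟩ := h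
  exact ⟨Y, ρ, h₁, h₂, h₃⟩

namespace IsOrientedPoincareDualityGroup

lemma eq_one_of_isOfFinOrder (hΓ : IsOrientedPoincareDualityGroup Γ d) {g : Γ}
    (hg : IsOfFinOrder g) : g = 1 := by
  obtain ⟨Y, ρ, hρ⟩ := hΓ.typeF.exists_isFiniteModel
  exact hρ.eq_one_of_isOfFinOrder hg

lemma cocycles_le_coboundaries (hΓ : IsOrientedPoincareDualityGroup Γ d) {n : ℕ} (hn : d < n) :
    cocycles (classifyingSpace Γ) n ≤ coboundaries (classifyingSpace Γ) n := fun c hc => by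
  obtain ⟨Y, ρ, hρ⟩ := hΓ.typeF.exists_isFiniteModel
  have := subsingleton_groupCohomology_trivial hΓ hρ hn
  exact (π_barCocycle_eq_zero_iff ⟨c, hc⟩).1 (Subsingleton.elim
    (α := groupCohomology (Rep.trivial ℚ Γ ℚ) n) _ _)

lemma exists_generator (hΓ : IsOrientedPoincareDualityGroup Γ d) :
    ∃ μ : Cohomology (classifyingSpace Γ) d, μ ≠ 0 ∧ Submodule.span ℚ {μ} = ⊤ := by
  obtain ⟨Y, ρ, hρ⟩ := hΓ.typeF.exists_isFiniteModel
  obtain ⟨u, hu, hspan⟩ := exists_generator_groupCohomology hΓ hρ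
  obtain ⟨z, rfl⟩ : ∃ z, groupCohomology.π (Rep.trivial ℚ Γ ℚ) d z = u :=
    groupCohomology_induction_on u fun z => ⟨z, rfl⟩
  obtain ⟨c, rfl⟩ := barCocycle_surjective d z
  refine ⟨cohomologyClass _ _ c, fun h => hu ?_, eq_top_iff.2 fun x _ => ?_⟩
  · exact (π_barCocycle_eq_zero_iff c).2 ((cohomologyClass_eq_zero c).1 h)
  · obtain ⟨c', rfl⟩ := Submodule.mkQ_surjective _ x
    obtain ⟨r, hr⟩ := hspan (groupCohomology.π _ d (barCocycle d c'))
    refine Submodule.mem_span_singleton.2 ⟨r, ?_⟩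
    refine (cohomologyClass_eq_iff (r • c) c').2 ?_
    refine (π_barCocycle_eq_zero_iff (r • c - c')).1 ?_
    rw [map_sub, map_smul, map_sub, map_smul]
    exact sub_eq_zero.2 hr

end IsOrientedPoincareDualityGroup

end Comparison

end

section

/-! ### The Gysin map over a point -/

/-- The transpose of a double complex. -/
def DoubleComplex.transpose (D : DoubleComplex) : DoubleComplex where
  C i n := D.C n i
  dh i n := D.dv n i
  dv i n := D.dh n i
  dh_dh i n c := D.dv_dv n i c
  dv_dv i n c := D.dh_dh n i c
  dh_dv i n c := by rw [D.dh_dv, neg_neg]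

lemma DoubleComplex.tot_transpose {D : DoubleComplex} (z : ∀ i n, D.transpose.C i n) (i n : ℕ) :
    D.tot (fun i n => z n i) i n = D.transpose.tot z n i := by
  rcases i with _ | i <;> rcases n with _ | n
  · rfl
  · rfl
  · rfl
  · exact add_comm _ _

section Point

variable {X Y : SSet.{0}} (p : X ⟶ Y)

lemma coboundaryBase_const {m n : ℕ} (c : serreFibre p ⦋n⦌ _⦋m⦌ → ℚ) (κ : serreFibre p ⦋0⦌ _⦋m⦌) :
    coboundaryBase p n m c ((serreBase p (SimplexCategory.const ⦋n + 1⦌ ⦋0⦌ 0)).app (op ⦋m⦌) κ) =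
      (∑ k : Fin (n + 2), (-1 : ℚ) ^ (k : ℕ)) *
        c ((serreBase p (SimplexCategory.const ⦋n⦌ ⦋0⦌ 0)).app (op ⦋m⦌) κ) := by
  rw [coboundaryBase_apply, Finset.sum_mul]
  refine Finset.sum_congr rfl fun k _ => ?_
  refine congrArg (fun a => (-1 : ℚ) ^ (k : ℕ) * c a) ?_
  exact (Functor.map_comp_apply (serreRow p (op ⦋m⦌)) (SimplexCategory.const ⦋n + 1⦌ ⦋0⦌ 0).op
    (SimplexCategory.δ k).op κ).symm

lemma transpose_serreDouble_hBoundaries (m n : ℕ) :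
    (serreDouble p).transpose.hBoundaries m n = coboundaries (serreFibre p ⦋n⦌) m := by
  cases m with
  | zero => rfl
  | succ m =>
    ext c
    exact serreDouble_dv_mem p

lemma serreBase_endo {n : SimplexCategoryᵒᵖ} (f : ⦋0⦌ ⟶ ⦋0⦌) (κ : (serreFibre p ⦋0⦌).obj n) :
    (serreBase p f).app n κ = κ := by
  obtain rfl : f = 𝟙 _ := Subsingleton.elim _ _
  exact Functor.map_id_apply (serreRow p n) (X := op ⦋0⦌) κ

/-- Restriction along a signed map of spaces of sections. -/
abbrev signedPullback {i j : SimplexCategory} (f : serreFibre p i ⟶ serreFibre p j) (n m : ℕ) :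
    (serreFibre p j _⦋m⦌ → ℚ) →ₗ[ℚ] (serreFibre p i _⦋m⦌ → ℚ) :=
  (-1 : ℚ) ^ (n * m) • cochainPullback f m

/-- The sign `(-1)^(nm)` absorbs the sign `(-1)^n` carried by the fibre differential in column `n`.
-/
lemma smul_coboundary_signedPullback {i j : SimplexCategory} (f : serreFibre p i ⟶ serreFibre p j)
    (n m : ℕ) (c : serreFibre p j _⦋m⦌ → ℚ) :
    (-1 : ℚ) ^ n • coboundary _ m (signedPullback p f n m c) =
      signedPullback p f n (m + 1) (coboundary _ m c) := by
  rw [LinearMap.smul_apply, LinearMap.smul_apply, map_smul, coboundary_cochainPullback, smul_smul,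
    mul_add, mul_one, pow_add, mul_comm]

lemma coboundary_signedPullback {i j : SimplexCategory} (f : serreFibre p i ⟶ serreFibre p j)
    (n m : ℕ) (c : serreFibre p j _⦋m⦌ → ℚ) :
    coboundary _ m (signedPullback p f n m c) =
      signedPullback p f n (m + 1) ((-1 : ℚ) ^ n • coboundary _ m c) := by
  rw [map_smul, ← smul_coboundary_signedPullback, smul_smul, ← pow_add,
    Even.neg_one_pow (Even.add_self _), one_smul]

lemma signedPullback_signedPullback {i j k : SimplexCategory}
    (f : serreFibre p i ⟶ serreFibre p j) (g : serreFibre p j ⟶ serreFibre p k)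
    (n m : ℕ) (c : serreFibre p k _⦋m⦌ → ℚ) :
    signedPullback p f n m (signedPullback p g n m c) = cochainPullback (f ≫ g) m c := by
  rw [LinearMap.smul_apply, LinearMap.smul_apply, map_smul, smul_smul, ← pow_add,
    Even.neg_one_pow (Even.add_self _), one_smul]
  rfl

variable [∀ n, Subsingleton (Y.obj n)]

/-- Over a point, the spaces of sections retract to the fibre. -/
def serreBaseHomotopy (i : ℕ) :
    SSet.Homotopy
      (serreBase p (SimplexCategory.const ⦋0⦌ ⦋i⦌ 0) ≫
        serreBase p (SimplexCategory.const ⦋i⦌ ⦋0⦌ 0))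
      (𝟙 (serreFibre p ⦋i⦌)) :=
  homotopyOfFamily _ _
    (fun n κ t => ⟨(sectionContraction ⦋i⦌ t ≫ κ.1.1, κ.1.2), by
      ext k x
      exact Subsingleton.elim _ _⟩)
    (fun φ κ t => rfl)
    (fun n κ => Subtype.ext (Prod.ext (by rw [sectionContraction_zero]; rfl)
      (by ext k x; exact Subsingleton.elim _ _)))
    (fun n κ => Subtype.ext (Prod.ext (by
      rw [sectionContraction_one]
      exact Category.id_comp _) rfl))

/-- Over a point, the columns of the double complex of cochains of Dress's bisimplicial set are all
equivalent to the cochains of the fibre. -/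
def serreColumnContraction : (serreDouble p).transpose.RowContraction where
  V m n := signedPullback p (serreBase p (SimplexCategory.const ⦋0⦌ ⦋n⦌ 0)) n m
  S m n := signedPullback p (serreBase p (SimplexCategory.const ⦋n⦌ ⦋0⦌ 0)) n m
  sgn m := (-1) ^ m
  sgn_ne_zero m := pow_ne_zero _ (by norm_num)
  dh_V m n c := (smul_coboundary_signedPullback p _ n m c).trans
    (congrArg (signedPullback p _ n (m + 1)) (one_smul ℚ (coboundary _ m c)).symm)
  dh_S m n c := (one_smul ℚ _).trans (coboundary_signedPullback p _ n m c)
  S_V m n c := (signedPullback_signedPullback p _ _ n m c).trans <| funext fun κ => congrArg c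
    ((Functor.map_comp_apply (serreRow p (op ⦋m⦌)) (SimplexCategory.const ⦋n⦌ ⦋0⦌ 0).op
      (SimplexCategory.const ⦋0⦌ ⦋n⦌ 0).op κ).symm.trans (serreBase_endo p _ κ))
  V_S m n c hc := by
    rw [transpose_serreDouble_hBoundaries]
    have h := Submodule.neg_mem _ (sub_mem_coboundaries_of_homotopy (serreBaseHomotopy p n)
      ((serreDouble_dv_eq_zero p).1 hc))
    rw [neg_sub] at h
    have e := signedPullback_signedPullback p (serreBase p (SimplexCategory.const ⦋0⦌ ⦋n⦌ 0))
      (serreBase p (SimplexCategory.const ⦋n⦌ ⦋0⦌ 0)) n m c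
    exact (congrArg (fun b => cochainPullback (𝟙 (serreFibre p ⦋n⦌)) m c - b ∈ coboundaries _ m)
      e).mpr h
  S_dv_even m n c hn := by
    refine funext fun κ => ?_
    refine (congrArg ((-1 : ℚ) ^ ((n + 1) * m) * ·) (coboundaryBase_const p c κ)).trans ?_
    rw [Fin.sum_neg_one_pow, if_pos (by simpa [Nat.even_add] using hn), zero_mul, mul_zero]
    rfl
  S_dv_odd m n c hn := by
    refine funext fun κ => ?_
    refine (congrArg ((-1 : ℚ) ^ ((n + 1) * m) * ·) (coboundaryBase_const p c κ)).trans ?_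
    rw [Fin.sum_neg_one_pow, if_neg (by simpa [Nat.even_add] using hn), one_mul, add_mul, one_mul,
      pow_add, mul_comm ((-1 : ℚ) ^ (n * m)), mul_assoc]
    rfl

/-- Over a point, every class of the fibre is the leading term of a class of the total space. -/
lemma exists_isGysin_of_subsingleton {d : ℕ} (μ : Cohomology (serreFibre p ⦋0⦌) d)
    (y : Cohomology Y 0) : ∃ x : Cohomology X (0 + d), IsGysin p μ x y := by
  obtain ⟨μ, rfl⟩ := Submodule.mkQ_surjective _ μ
  obtain ⟨y, rfl⟩ := Submodule.mkQ_surjective _ y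
  have hy : crossCochain p y.1 μ.1 ∈ cocycles (serreFibre p ⦋0⦌) d := by
    have hμ : coboundary _ d μ.1 = 0 := μ.2
    refine funext fun κ => ?_
    have hκ (κ' : serreFibre p ⦋0⦌ _⦋d⦌) : crossCochain p y.1 μ.1 κ' =
        y.1 (SSet.yonedaEquiv κ.1.2) * μ.1 κ' := by
      refine congrArg₂ (fun a b => y.1 a * μ.1 b) (Subsingleton.elim _ _)
        (serreBase_endo p _ κ')
    have h : crossCochain p y.1 μ.1 = y.1 (SSet.yonedaEquiv κ.1.2) • μ.1 := funext hκ
    rw [h, map_smul, hμ, smul_zero]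
  -- In the transposed complex the fibre over the point is the bottom row, so its cocycle extends to
  -- a total cocycle.
  obtain ⟨z, hz, hz', hzx⟩ := (serreColumnContraction p).exists_tot_eq_zero
    (x := crossCochain p y.1 μ.1) ((serreDouble_dv_eq_zero p).2 hy)
  have hz'' : (serreDouble p).tot (fun i n => z n i) = 0 :=
    funext fun i => funext fun n =>
      (DoubleComplex.tot_transpose z i n).trans (congrFun (congrFun hz' n) i)
  refine ⟨cohomologyClass _ _ ⟨cochainPullback (serreTotalMap p) (0 + d) (z 0 (0 + d)), ?_⟩,
    μ, y, ⟨_, _⟩, fun i n => z n (0 + i), rfl, rfl, rfl, ?_, ?_, ?_, hzx, rfl⟩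
  · exact cochainPullback_mem_cocycles (serreTotalMap p) _ _ (congrFun (congrFun hz'' (0 + d + 1)) 0)
  · exact (serreDouble_dv_eq_zero p).1 (congrFun (congrFun hz'' 0) (d + 1))
  · intro i n hin
    exact congrFun (congrFun hz'' (0 + i + 1)) (n + 1)
  · exact congrFun (congrFun hz'' (0 + d + 1)) 0

end Point

end

section

/-! ### The vanishing of the Gysin map of a central extension -/

lemma generator_of_bijective {V W : Type} [AddCommGroup V] [AddCommGroup W] [Module ℚ V]
    [Module ℚ W] {f : V →ₗ[ℚ] W} (hf : Function.Bijective f) {v : V} (hv : v ≠ 0)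
    (hspan : Submodule.span ℚ {v} = ⊤) : f v ≠ 0 ∧ Submodule.span ℚ {f v} = ⊤ := by
  refine ⟨(map_ne_zero_iff f hf.1).2 hv, ?_⟩
  rw [← Set.image_singleton, ← Submodule.map_span, hspan, Submodule.map_top,
    LinearMap.range_eq_top.2 hf.2]

section Extensions

variable {A A' Γ Q Q' : Type} [CommGroup A] [CommGroup A'] [Group Γ] [Group Q] [Group Q']

lemma fibreRestriction_app_bijective {ι : A →* Γ} (hι : ∀ a g, ι a * g = g * ι a)
    (n : SimplexCategoryᵒᵖ) : Function.Bijective ((fibreRestriction hι ⦋0⦌).app n) :=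
  ⟨Function.LeftInverse.injective (fibreRestriction_basePoint_fibreInclusion hι n),
    Function.RightInverse.surjective (fibreRestriction_fibreInclusion hι (basePoint A) n)⟩

/-- The map of classifying spaces induced by a homomorphism. -/
def classifyingMap (ψ : Q' →* Q) : classifyingSpace Q' ⟶ classifyingSpace Q where
  app n := ↾fun γ => ⟨fun e => ψ (γ.1 e), fun τ => by rw [← map_mul, γ.2 τ]⟩

lemma exists_twistedMap {ι : A →* Γ} {ι' : A' →* Γ} {φ : A' →* A} (hφ : ι.comp φ = ι')
    (hι : ∀ a g, ι a * g = g * ι a) :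
    ∃ (f : twistedSpace ι' ⟶ twistedSpace ι)
      (hf : twistedProj ι' ≫ doubleClassifyingMap φ = f ≫ twistedProj ι),
      (∀ n γa, (f.app n γa).1.1 = γa.1.1) ∧
      ∀ n, Function.Bijective
        ((serreFibreMap f (doubleClassifyingMap φ) hf ⦋0⦌).app n) := by
  subst hφ
  exact ⟨twistedMap φ ι, rfl, fun n γa => rfl, twistedFibreMap_app_bijective φ hι⟩

/-- `S'` maps to `S` over the identity of `Γ`, so the fibres agree and an orientation pulls back to
an orientation. By naturality `φ^* y` is a Gysin image for `S'`. -/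
lemma GysinVanishes.pullback_eq_zero {S : GroupExtension A Γ Q} {S' : GroupExtension A' Γ Q'}
    {φ : A' →* A} (hφ : S.inl.comp φ = S'.inl) {ψ : Q' →* Q}
    (hψ : ψ.comp S'.rightHom = S.rightHom) (hS : ∀ a g, S.inl a * g = g * S.inl a)
    {d : ℕ} (h : GysinVanishes S' d)
    {μ : Cohomology (serreFibre (extensionClassifyingMap S) ⦋0⦌) d} (hμ : μ ≠ 0)
    (hspan : Submodule.span ℚ {μ} = ⊤) {s : ℕ} {x : Cohomology (classifyingSpace Q) (s + d)}
    {y : Cohomology (doubleClassifyingSpace A) s}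
    (hxy : IsGysin (extensionClassifyingMap S) μ
      (cohomologyMap (extensionToQuotient S) (s + d) x) y) :
    pullback φ s y = 0 := by
  obtain ⟨f, hf, hf', hbij⟩ := exists_twistedMap hφ hS
  obtain ⟨hμ', hspan'⟩ := generator_of_bijective
    (cohomologyMap_bijective _ (fun n => hbij (op ⦋n⦌)) d) hμ hspan
  have e : f ≫ extensionToQuotient S = extensionToQuotient S' ≫ classifyingMap ψ := by
    ext n γa
    refine Subtype.ext (funext fun e => ?_)
    refine (congrArg (fun γ => S.rightHom (γ e)) (hf' n γa)).trans ?_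
    exact (DFunLike.congr_fun hψ _).symm
  have hxy' := hxy.cohomologyMap f (doubleClassifyingMap φ) hf
  refine (h _ hμ' hspan' s (cohomologyMap (classifyingMap ψ) (s + d) x) _).1 ?_
  have ex : cohomologyMap f (s + d) (cohomologyMap (extensionToQuotient S) (s + d) x) =
      cohomologyMap (extensionToQuotient S') (s + d) (cohomologyMap (classifyingMap ψ) (s + d) x) :=
    (cohomologyMap_comp f (extensionToQuotient S) _ x).symm.trans
      ((congrArg (fun f => cohomologyMap f (s + d) x) e).trans (cohomologyMap_comp _ _ _ x))
  rw [← ex]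
  exact hxy'

/-- `GysinVanishes` also requires 0 to be a value of the relation. By totality some value exists,
and if all values are 0 it is 0. -/
lemma gysinVanishes_iff {S : GroupExtension A Γ Q} (hS : ∀ a g, S.inl a * g = g * S.inl a) {d : ℕ}
    (hΓ : IsOrientedPoincareDualityGroup Γ d) :
    GysinVanishes S d ↔ ∀ μ : Cohomology (serreFibre (extensionClassifyingMap S) ⦋0⦌) d,
      μ ≠ 0 → Submodule.span ℚ {μ} = ⊤ → ∀ (s : ℕ) (x : Cohomology (classifyingSpace Q) (s + d))
      (y : Cohomology (doubleClassifyingSpace A) s), IsGysin (extensionClassifyingMap S) μ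
        (cohomologyMap (extensionToQuotient S) (s + d) x) y → y = 0 := by
  refine ⟨fun h μ hμ hspan s x y => (h μ hμ hspan s x y).1,
    fun h μ hμ hspan s x y => ⟨h μ hμ hspan s x y, ?_⟩⟩
  rintro rfl
  obtain ⟨y, hy⟩ := exists_isGysin hS (fun n hn => hΓ.cocycles_le_coboundaries hn) hμ hspan
    (cohomologyMap (extensionToQuotient S) (s + d) x)
  obtain rfl := h μ hμ hspan s x y hy
  exact hy

/-- For trivial `A` the projection `Γ → Q` is injective, so lifts are unique and form a cocycle. -/
lemma extensionToQuotient_app_bijective [Subsingleton A] (S : GroupExtension A Γ Q)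
    (n : SimplexCategoryᵒᵖ) : Function.Bijective ((extensionToQuotient S).app n) := by
  have hinj : Function.Injective S.rightHom := by
    rw [← MonoidHom.ker_eq_bot_iff, ← S.range_inl_eq_ker_rightHom, eq_bot_iff]
    rintro _ ⟨a, rfl⟩
    rw [Subsingleton.elim a 1, map_one]
    exact Subgroup.one_mem _
  constructor
  · intro γa γa' h
    refine Subtype.ext (Prod.ext (funext fun e => hinj ?_) (Subtype.ext (Subsingleton.elim _ _)))
    exact congrFun (congrArg Subtype.val h) e
  · intro γ
    choose r hr using S.rightHom_surjective
    refine ⟨⟨(fun e => r (γ.1 e), ⟨fun _ => 1, fun _ _ => rfl, fun _ => rfl⟩),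
      fun v => hinj ?_, fun τ => hinj ?_⟩, Subtype.ext (funext fun e => hr _)⟩
    · change S.rightHom (r _) = _
      rw [hr, classifyingSpace_σ, map_one]
    · change S.rightHom (r _ * r _) = S.rightHom (S.inl 1 * r _)
      rw [map_mul, hr, hr, map_one, one_mul, hr]
      exact γ.2 τ

/-- Over a point, the orientation of the fibre is the leading term of a class of the total space,
and the Gysin image of that class is 1. -/
lemma not_gysinVanishes_of_subsingleton [Subsingleton A] (S : GroupExtension A Γ Q) {d : ℕ}
    (hΓ : IsOrientedPoincareDualityGroup Γ d) : ¬ GysinVanishes S d := by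
  intro h
  have hS (a : A) (g : Γ) : S.inl a * g = g * S.inl a := by
    rw [Subsingleton.elim a 1, map_one, one_mul, mul_one]
  have (n : SimplexCategoryᵒᵖ) : Subsingleton ((doubleClassifyingSpace A).obj n) :=
    ⟨fun a b => Subtype.ext (Subsingleton.elim _ _)⟩
  obtain ⟨μ, hμ, hspan⟩ := hΓ.exists_generator
  obtain ⟨hμ', hspan'⟩ := generator_of_bijective (cohomologyMap_bijective _
    (fun n => fibreRestriction_app_bijective hS (op ⦋n⦌)) d) hμ hspan
  have hone : (1 : doubleClassifyingSpace A _⦋0⦌ → ℚ) ∈ cocycles (doubleClassifyingSpace A) 0 := by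
    refine funext fun a => ?_
    rw [coboundary_apply]
    simp [Fin.sum_univ_two]
  obtain ⟨x, hx⟩ := exists_isGysin_of_subsingleton (extensionClassifyingMap S)
    (cohomologyMap (fibreRestriction hS ⦋0⦌) d μ) (cohomologyClass _ _ ⟨1, hone⟩)
  obtain ⟨x, rfl⟩ := (cohomologyMap_bijective _
    (fun n => extensionToQuotient_app_bijective S (op ⦋n⦌)) _).2 x
  have h₀ := (cohomologyClass_eq_zero _).1 ((h _ hμ' hspan' 0 x _).1 hx)
  exact one_ne_zero (congrFun (show (1 : doubleClassifyingSpace A _⦋0⦌ → ℚ) = 0 from h₀)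
    ⟨fun _ => 1, fun _ _ => rfl, fun _ => rfl⟩)

end Extensions

/-- An element of infinite order embeds `ℤ` in `A`, and by flatness `ℚ` in the tensor product. -/
lemma isOfFinOrder_of_subsingleton_tensorProduct {A : Type} [CommGroup A]
    [Subsingleton (TensorProduct ℤ (Additive A) ℚ)] (a : A) : IsOfFinOrder a := by
  by_contra ha
  have hinj : Function.Injective (LinearMap.toSpanSingleton ℤ (Additive A) (Additive.ofMul a)) :=
    fun m n h => injective_zpow_iff_not_isOfFinOrder.2 ha (congrArg Additive.toMul h)
  have h := Module.Flat.rTensor_preserves_injective_linearMap (M := ℚ) _ hinj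
  exact not_subsingleton ℚ (h.comp (TensorProduct.lid ℤ ℚ).symm.injective).subsingleton

/-- The centre of an oriented Poincaré duality group has vanishing Gysin map as soon as it is
nontrivial and the Gysin maps of its infinite cyclic subgroups vanish. -/
lemma gysinVanishes_centerExtension {Γ : Type} [Group Γ] {d : ℕ}
    (hΓ : IsOrientedPoincareDualityGroup Γ d) [Nontrivial (Subgroup.center Γ)]
    (h : ∀ (g : Γ) (hg : g ∈ Subgroup.center Γ) (hord : ¬ IsOfFinOrder g),
      haveI := zpowers_normal hg
      GysinVanishes (cyclicExtension g hg hord) d) :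
    GysinVanishes (centerExtension Γ) d := by
  have hS (a : Subgroup.center Γ) (g : Γ) :
      (centerExtension Γ).inl a * g = g * (centerExtension Γ).inl a :=
    (Subgroup.mem_center_iff.1 a.2 g).symm
  refine (gysinVanishes_iff hS hΓ).2 fun μ hμ hspan s x y hxy => ?_
  refine eq_zero_of_forall_not_isOfFinOrder (fun a ha => ?_) s y fun a ha => ?_
  · exact Subtype.ext (hΓ.eq_one_of_isOfFinOrder
      ((Subgroup.center Γ).subtype.isOfFinOrder ha))
  · have hord : ¬ IsOfFinOrder a.1 := fun h' => ha (Submonoid.isOfFinOrder_coe.1 h')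
    have := zpowers_normal a.2
    exact (h a.1 a.2 hord).pullback_eq_zero (S := centerExtension Γ)
      (S' := cyclicExtension a.1 a.2 hord)
      (MonoidHom.ext_mint (by simp [centerExtension, cyclicExtension]))
      (ψ := QuotientGroup.map _ _ (MonoidHom.id Γ) (Subgroup.zpowers_le.2 a.2)) rfl hS hμ hspan hxy

end

end OscarTrick

end

/-! ### The proposition -/

theorem mainTheorem7 (Γ : Type) [Group Γ] (hΓ : OscarTrick.IVP Γ) :
    OscarTrick.VP Γ ↔
      Nontrivial (TensorProduct ℤ (Additive (Subgroup.center Γ)) ℚ) := by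
  constructor
  · rintro ⟨d, hd, hvan⟩
    by_contra h
    rw [not_nontrivial_iff_subsingleton] at h
    -- The centre is torsion by the tensor condition and torsion-free because `Γ` is of type `F`.
    have : Subsingleton (Subgroup.center Γ) := by
      refine subsingleton_of_forall_eq 1 fun a => Subtype.ext (hd.eq_one_of_isOfFinOrder ?_)
      exact (Subgroup.center Γ).subtype.isOfFinOrder
        (OscarTrick.isOfFinOrder_of_subsingleton_tensorProduct a)
    exact OscarTrick.not_gysinVanishes_of_subsingleton _ hd hvan
  · intro h
    obtain ⟨d, hd, hvan⟩ := hΓ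
    have : Nontrivial (Subgroup.center Γ) := by
      by_contra hC
      rw [not_nontrivial_iff_subsingleton] at hC
      have : Subsingleton (Additive (Subgroup.center Γ)) := hC
      refine not_nontrivial_iff_subsingleton.2 ?_ h
      infer_instance
    exact ⟨d, hd, OscarTrick.gysinVanishes_centerExtension hd hvan⟩
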